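/- Theorem 1. Consider the problem Feature Selection. An instance consists of a finite alphabet $\Sigma\subset\mathbb{Z}_{\ge 0}$, an $m\times n$ matrix $A$ with entries in $\Sigma$ ($m,n\ge 1$), a positive integer $k$ and non-negative integers $B$ and $\ell$. For $O\subseteq\{1,\dots,m\}$, let $a^j_{-O}$ denote the $j$-th column of the matrix obtained from $A$ by deleting the rows with indices in $O$, and let $d_H$ denote the Hamming distance. The task is to decide whether there are a set $O\subseteq\{1,\dots,m\}$ with $|O|\le\ell$, a partition $\{I_1,\dots,I_k\}$ of $\{1,\dots,n\}$ into $k$ non-empty clusters, and centers $c_1,\dots,c_k\in\Sigma^{m-|O|}$ such that $$\sum_{i=1}^{k}\ \sum_{j\in I_i} d_H\bigl(a^j_{-O},c_i\bigr)\le B .$$ There are computable functions $f$ and $g$ and one algorithm that decides every instance $(\Sigma,A,k,B,\ell)$ correctly in time at most $$T=f(k,B,|\Sigma|)\cdot m^{g(k,|\Sigma|)}\cdot n^2 .$$ Here an algorithm is a program for a random access machine with indirect addressing and the unit-cost instructions $+$, truncated $-$, $\times$, integer division and comparison. The input is the list of the numbers $m,n,k,B,\ell,|\Sigma|$, the letters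 of $\Sigma$ in increasing order, and the entries of $A$ row by row. Words have $O(\log(T+M))$ bits, where $M$ is the largest number in the input: during the whole run, all numbers stored are less than $(T+M)^{w}$ for a constant $w$ that does not depend on the instance. -/

import Mathlib

/-! Random access machines with unit-cost instructions, running on words of bounded size. -/

namespace RAM

/-- Instructions. Registers are named by natural numbers `a b c`; `p` is a program line. -/
inductive Instr where
  /-- `reg a := v` -/
  | const (a v : ℕ)
  /-- `reg a := reg b` -/
  | copy (a b : ℕ)
  /-- `reg a := reg b + reg c` -/
  | add (a b c : ℕ)
  /-- `reg a := reg b - reg c`, truncated at `0` -/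
  | sub (a b c : ℕ)
  /-- `reg a := reg b * reg c` -/
  | mul (a b c : ℕ)
  /-- `reg a := ⌊reg b / reg c⌋`, and `0` if `reg c = 0` -/
  | div (a b c : ℕ)
  /-- `reg a := mem (reg b)` -/
  | load (a b : ℕ)
  /-- `mem (reg a) := reg b` -/
  | store (a b : ℕ)
  /-- go to line `p` -/
  | jump (p : ℕ)
  /-- go to line `p` if `reg a < reg b`, else to the next line -/
  | jumpLt (a b p : ℕ)
  /-- halt with the given answer -/
  | halt (answer : Bool)

/-- A program is a finite list of instructions. -/
abbrev Program := List Instr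

/-- Program line, register contents and memory contents of a running machine. -/
structure Config where
  pc : ℕ
  reg : ℕ → ℕ
  mem : ℕ → ℕ

/-- A machine is running or has halted with an answer. -/
inductive State where
  | running (c : Config)
  | halted (answer : Bool)

namespace Config

/-- Write `v` into register `a` and go to the next line. -/
def setReg (c : Config) (a v : ℕ) : Config :=
  ⟨c.pc + 1, Function.update c.reg a v, c.mem⟩

/-- Write `v` into memory cell `i` and go to the next line. -/
def setMem (c : Config) (i v : ℕ) : Config :=
  ⟨c.pc + 1, c.reg, Function.update c.mem i v⟩

/-- Go to line `p`. -/
def goto (c : Config) (p : ℕ) : Config :=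
  ⟨p, c.reg, c.mem⟩

end Config

/-- The effect of one instruction. -/
def exec (c : Config) : Instr → State
  | .const a v => .running (c.setReg a v)
  | .copy a b => .running (c.setReg a (c.reg b))
  | .add a b d => .running (c.setReg a (c.reg b + c.reg d))
  | .sub a b d => .running (c.setReg a (c.reg b - c.reg d))
  | .mul a b d => .running (c.setReg a (c.reg b * c.reg d))
  | .div a b d => .running (c.setReg a (c.reg b / c.reg d))
  | .load a b => .running (c.setReg a (c.mem (c.reg b)))
  | .store a b => .running (c.setMem (c.reg a) (c.reg b))
  | .jump p => .running (c.goto p)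
  | .jumpLt a b p => .running (c.goto (if c.reg a < c.reg b then p else c.pc + 1))
  | .halt answer => .halted answer

/-- One step of the program `P`. A machine whose program line does not exist is stuck: it stays
in the same configuration forever and never answers. -/
def step (P : Program) : State → State
  | .running c =>
    match P[c.pc]? with
    | some i => exec c i
    | none => .running c
  | .halted answer => .halted answer

/-- The initial state: the input is written into the memory cells `0, 1, 2, …`; all the other
memory cells and all registers are `0`. -/
def init (x : List ℕ) : State :=
  .running ⟨0, fun _ => 0, fun i => x.getD i 0⟩

/-- The state after `t` steps on the input `x`. -/
def run (P : Program) (x : List ℕ) (t : ℕ) : State :=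
  (step P)^[t] (init x)

/-- On the input `x`, the program `P` halts after at most `T` steps, it answers `true` exactly if
`answer` holds, and all registers and memory cells hold numbers below `W` throughout the run. -/
def Decides (P : Program) (x : List ℕ) (T W : ℕ) (answer : Prop) : Prop :=
  (∃ t ≤ T, ∃ b : Bool, run P x t = .halted b ∧ (b = true ↔ answer)) ∧
  ∀ (t : ℕ) (c : Config), run P x t = .running c → ∀ i : ℕ, c.reg i < W ∧ c.mem i < W

end RAM

namespace FeatureSelection

/-- `I₀, …, I_{k-1}` are non-empty, pairwise disjoint and cover the index set of the columns. -/
def IsPartition {n k : ℕ} (I : Fin k → Finset (Fin n)) : Prop :=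
  (∀ i, (I i).Nonempty) ∧ (∀ i i', i ≠ i' → Disjoint (I i) (I i')) ∧ ∀ j, ∃ i, j ∈ I i

/-- The yes-instances: after deleting a set `O` of at most `l` rows, the columns of the matrix have
a partition into `k` clusters, with centers over the same alphabet `S`, of total Hamming cost
at most `B`. -/
def IsYes {m n : ℕ} (S : Finset ℕ) (A : Matrix (Fin m) (Fin n) S) (k B l : ℕ) : Prop :=
  ∃ O : Finset (Fin m), O.card ≤ l ∧
    ∃ I : Fin k → Finset (Fin n), IsPartition I ∧
      ∃ c : Fin k → ({r : Fin m // r ∉ O} → S),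
        ∑ i : Fin k, ∑ j ∈ I i, hammingDist (fun r : {r : Fin m // r ∉ O} => A r.1 j) (c i) ≤ B

/-- The input as a list of numbers: `m, n, k, B, l, |S|`, then the letters of the alphabet in
increasing order, then the entries of the matrix row by row. -/
def encode {m n : ℕ} (S : Finset ℕ) (A : Matrix (Fin m) (Fin n) S) (k B l : ℕ) : List ℕ :=
  [m, n, k, B, l, S.card] ++ S.sort (· ≤ ·) ++
    (List.finRange m).flatMap fun i => (List.finRange n).map fun j => (A i j : ℕ)

/-- The largest number in a list. -/
def maxEntry (x : List ℕ) : ℕ := x.foldr max 0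

end FeatureSelection

/-!
Feature Selection is decided by a random access machine whose running time is, for fixed `k`, `B`
and alphabet, polynomial in the number `m` of rows and quadratic in the number `n` of columns.

If `n < k` there is no partition into `k` non-empty clusters. Otherwise non-emptiness is no
restriction (`isYes_iff`), and a solution is a labelling of the columns by `k` labels together with
a set of at least `m - l` rows and, for each of these rows, a *pattern*: the letters that the row
assigns to the labels. There are only `K = s ^ k` patterns over an alphabet of `s` letters. Given
the labelling, the best rows and patterns are found greedily (`Accepts`), so it suffices to find a
labelling.

For every pattern, guess the row of the pattern with the smallest cost in a solution, its
*representative*; there are at most `m ^ K` possibilities. If the representatives had no errors, a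
column could be labelled by the first label that agrees with its entries in the representative
rows. There are two kinds of columns for which this fails. Columns that match no label contain an
error of a representative, hence there are at most `B` of them, and their labels are guessed. The
other columns with a wrong label, whose correction improves the cost, are not visible, and at most
`B` columns are of this kind. For such a column, at least half of the rows of some pattern differ
from their representative (`exists_guess`).

The hidden columns are found by a depth-first search through sequences of at most `B` columns. Each
of `B` slots stands for an unknown row of a pattern whose representative has an error; by
minimality such a row has an error itself, so `B` slots suffice. It is guessed with which columns
of the sequence a slot is incident, that is, in which columns it differs from the representative of
its pattern. A sequence is admissible if every slot can be filled by a row that differs from its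
representative in at most `B` columns, and in the prescribed ones. Give a slot of a pattern with
`c` rows the weight `θ = 2 / c`; then the slots that are incident with a fixed column have total
weight at least one, and all the weights add up to at most `2 * K`. By the inequality of arithmetic
and geometric means (`sum_weight_le`), the product of the numbers of fillers raised to the powers
`θ` increases at most by the factor `B` on passing to all the extensions of a sequence by one
column. Hence the search takes at most `(n + 1) * (B + 1) ^ B * m ^ (2 * K)` steps
(`search_subtree`, `weight_zero_le`). All remaining guesses are made among a number of
possibilities that depends on `k`, `B` and `s` only.

The machine program is compiled from structured commands over arithmetic expressions with bounded
sums. The compiler is verified once and for all (`Cmd.comp_run`), the running time is bounded by a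
monomial whose exponents are computed from the text of the program (`Cmd.cost_le`), and an
expression of bounded degree in bounded variables has bounded intermediate values (`Exp.eval_lt`).
-/

namespace RAM

/-! ### Arithmetic expressions with bounded sums -/

/-- The arithmetic instructions that expressions may use. -/
inductive BinOp where
  | add
  | sub
  | mul
  | div

/-- The function computed by an arithmetic instruction. -/
def BinOp.eval : BinOp → ℕ → ℕ → ℕ
  | .add, x, y => x + y
  | .sub, x, y => x - y
  | .mul, x, y => x * y
  | .div, x, y => x / y

/-- The machine instruction of an arithmetic operation. -/
def BinOp.instr : BinOp → ℕ → ℕ → ℕ → Instr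
  | .add => .add
  | .sub => .sub
  | .mul => .mul
  | .div => .div

/-- Expressions over the registers and the memory. `sum x i b` is the sum of `b` over all values
of the register `x` that are smaller than the contents of the register `i`. -/
inductive Exp where
  | lit (v : ℕ)
  | var (i : ℕ)
  | mem (a : Exp)
  | bin (op : BinOp) (a b : Exp)
  | sum (x i : ℕ) (b : Exp)

namespace Exp

/-- The value of an expression for the register contents `ρ` and the memory contents `M`. -/
def eval : Exp → (ℕ → ℕ) → (ℕ → ℕ) → ℕ
  | lit v, _, _ => v
  | var i, ρ, _ => ρ i
  | mem a, ρ, M => M (a.eval ρ M)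
  | bin op a b, ρ, M => op.eval (a.eval ρ M) (b.eval ρ M)
  | sum x i b, ρ, M => ∑ v ∈ Finset.range (ρ i), b.eval (Function.update ρ x v) M

/-- Well-formed expressions. Registers below `32` are the variables of a program, the registers
from `32` to `63` serve as summation indices, and the list `bs` holds the summation indices in
scope. All registers from `64` on are scratch space. -/
def wf : Exp → List ℕ → Bool
  | lit v, _ => decide (v < 16)
  | var i, bs => decide (i < 32) || decide (i ∈ bs)
  | mem a, bs => a.wf bs
  | bin _ a b, bs => a.wf bs && b.wf bs
  | sum x i b, bs => decide (i < 32) && decide (32 ≤ x) && decide (x < 64) && !decide (x ∈ bs)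
      && b.wf (x :: bs)

/-- An exponent `d` such that all intermediate values are below `V ^ d` if the variables and the
memory cells are below `V`. -/
def deg : Exp → ℕ
  | lit _ => 1
  | var _ => 1
  | mem a => a.deg + 1
  | bin _ a b => a.deg + b.deg + 1
  | sum _ _ b => b.deg + 1

/-- The number of steps taken by the compiled expression. -/
def cost : Exp → (ℕ → ℕ) → ℕ
  | lit _, _ => 1
  | var _, _ => 1
  | mem a, ρ => a.cost ρ + 1
  | bin _ a b, ρ => a.cost ρ + b.cost ρ + 1
  | sum _ i b, ρ => ρ i * (b.cost ρ + 5) + 4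

/-- Machine code that puts the value of an expression into the register `t`, for a code block that
starts at line `pos`. Only summation indices and registers from `t` on are changed. -/
def comp : Exp → ℕ → ℕ → List Instr
  | lit v, t, _ => [.const t v]
  | var i, t, _ => [.copy t i]
  | mem a, t, pos => a.comp t pos ++ [.load t t]
  | bin op a b, t, pos =>
    a.comp t pos ++ (b.comp (t + 1) (pos + (a.comp t pos).length) ++ [op.instr t t (t + 1)])
  | sum x i b, t, pos =>
    [.const t 0, .const x 0, .jumpLt x i (pos + 4),
      .jump (pos + 4 + ((b.comp (t + 1) (pos + 4)).length + 4))] ++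
    (b.comp (t + 1) (pos + 4) ++
      [.add t t (t + 1), .const (t + 1) 1, .add x x (t + 1), .jump (pos + 2)])

theorem eval_congr {M : ℕ → ℕ} (e : Exp) : ∀ {bs : List ℕ} {ρ ρ' : ℕ → ℕ}, e.wf bs = true →
    (∀ r, r < 32 ∨ r ∈ bs → ρ r = ρ' r) → e.eval ρ M = e.eval ρ' M := by
  induction e with
  | lit v => intros; rfl
  | var i =>
    intro bs ρ ρ' hwf h
    simp only [wf, Bool.or_eq_true, decide_eq_true_eq] at hwf
    exact h i hwf
  | mem a ih =>
    intro bs ρ ρ' hwf h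
    simp only [eval, ih hwf h]
  | bin op a b iha ihb =>
    intro bs ρ ρ' hwf h
    simp only [wf, Bool.and_eq_true] at hwf
    simp only [eval, iha hwf.1 h, ihb hwf.2 h]
  | sum x i b ih =>
    intro bs ρ ρ' hwf h
    simp only [wf, Bool.and_eq_true, decide_eq_true_eq] at hwf
    simp only [eval, h i (Or.inl hwf.1.1.1.1)]
    refine Finset.sum_congr rfl fun v _ => ih hwf.2 fun r hr => ?_
    by_cases hx : r = x
    · simp [hx]
    · simp only [Function.update_of_ne hx]
      refine h r (hr.imp_right fun hm => ?_)
      exact (List.mem_cons.1 hm).resolve_left hx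

theorem cost_congr (e : Exp) : ∀ {bs : List ℕ} {ρ ρ' : ℕ → ℕ}, e.wf bs = true →
    (∀ r, r < 32 → ρ r = ρ' r) → e.cost ρ = e.cost ρ' := by
  induction e with
  | lit v => intros; rfl
  | var i => intros; rfl
  | mem a ih =>
    intro bs ρ ρ' hwf h
    simp only [cost, ih hwf h]
  | bin op a b iha ihb =>
    intro bs ρ ρ' hwf h
    simp only [wf, Bool.and_eq_true] at hwf
    simp only [cost, iha hwf.1 h, ihb hwf.2 h]
  | sum x i b ih =>
    intro bs ρ ρ' hwf h
    simp only [wf, Bool.and_eq_true, decide_eq_true_eq] at hwf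
    simp only [cost, h i hwf.1.1.1.1, ih hwf.2 h]

theorem _root_.RAM.BinOp.eval_lt {V d₁ d₂ x y : ℕ} (op : BinOp) (hV : 16 ≤ V)
    (hx : x < V ^ d₁) (hy : y < V ^ d₂) : op.eval x y < V ^ (d₁ + d₂ + 1) := by
  have h1 : 1 ≤ V ^ d₁ := Nat.one_le_pow _ _ (by omega)
  have h2 : 1 ≤ V ^ d₂ := Nat.one_le_pow _ _ (by omega)
  have h3 : V ^ d₁ ≤ V ^ d₁ * V ^ d₂ := Nat.le_mul_of_pos_right _ h2
  have h4 : V ^ d₂ ≤ V ^ d₁ * V ^ d₂ := Nat.le_mul_of_pos_left _ h1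
  have h5 : V ^ d₁ * V ^ d₂ * 16 ≤ V ^ (d₁ + d₂ + 1) := by
    rw [pow_succ, pow_add]; gcongr
  cases op with
  | add => simp only [BinOp.eval]; omega
  | sub => simp only [BinOp.eval]; omega
  | mul =>
    have := Nat.mul_le_mul hx.le hy.le
    simp only [BinOp.eval]
    have : 1 ≤ V ^ d₁ * V ^ d₂ := h1.trans h3
    omega
  | div =>
    have := Nat.div_le_self x y
    simp only [BinOp.eval]; omega

theorem eval_lt {V : ℕ} {M : ℕ → ℕ} (hV : 16 ≤ V) (hM : ∀ a, M a < V) (e : Exp) :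
    ∀ {bs : List ℕ} {ρ : ℕ → ℕ}, e.wf bs = true → (∀ r, r < 32 ∨ r ∈ bs → ρ r < V) →
      e.eval ρ M < V ^ e.deg := by
  induction e with
  | lit v =>
    intro bs ρ hwf h
    simp only [wf, decide_eq_true_eq] at hwf
    simp only [eval, deg, pow_one]; omega
  | var i =>
    intro bs ρ hwf h
    simp only [wf, Bool.or_eq_true, decide_eq_true_eq] at hwf
    simpa [eval, deg] using h i hwf
  | mem a ih =>
    intro bs ρ hwf h
    exact (hM _).trans_le (Nat.le_self_pow (by simp [deg]) V)
  | bin op a b iha ihb =>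
    intro bs ρ hwf h
    simp only [wf, Bool.and_eq_true] at hwf
    exact BinOp.eval_lt op hV (iha hwf.1 h) (ihb hwf.2 h)
  | sum x i b ih =>
    intro bs ρ hwf h
    simp only [wf, Bool.and_eq_true, decide_eq_true_eq] at hwf
    have hi : ρ i < V := h i (Or.inl hwf.1.1.1.1)
    have hb : ∀ v ∈ Finset.range (ρ i), b.eval (Function.update ρ x v) M ≤ V ^ b.deg := by
      intro v hv
      refine (ih hwf.2 fun r hr => ?_).le
      by_cases hx : r = x
      · subst hx
        simpa using (Finset.mem_range.1 hv).trans hi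
      · simp only [Function.update_of_ne hx]
        exact h r (hr.imp_right fun hm => (List.mem_cons.1 hm).resolve_left hx)
    have hs := Finset.sum_le_sum hb
    simp only [eval, deg]
    refine hs.trans_lt ?_
    simp only [Finset.sum_const, Finset.card_range, smul_eq_mul]
    rw [pow_succ, mul_comm]
    exact Nat.mul_lt_mul_of_pos_left hi (Nat.pow_pos (by omega))

end Exp

/-! ### Bounded runs of a program -/

/-- All registers and memory cells are below `W`. -/
def Config.Below (W : ℕ) (c : Config) : Prop :=
  ∀ i, c.reg i < W ∧ c.mem i < W

/-- `Run P W N c c'`: the program `P` leads from `c` to `c'` in `N` steps, and all numbers stored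
on the way are below `W`. -/
inductive Run (P : Program) (W : ℕ) : ℕ → Config → Config → Prop
  | refl {c : Config} : c.Below W → Run P W 0 c c
  | head {N : ℕ} {c c' c'' : Config} : c.Below W → RAM.step P (.running c) = .running c' →
      Run P W N c' c'' → Run P W (N + 1) c c''

namespace Run

variable {P : Program} {W : ℕ}

theorem below_right {N : ℕ} {c c' : Config} (h : Run P W N c c') : c'.Below W := by
  induction h <;> assumption

theorem trans {N N' : ℕ} {c c' c'' : Config} (h : Run P W N c c') (h' : Run P W N' c' c'') :
    Run P W (N + N') c c'' := by
  induction h with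
  | refl _ => simpa using h'
  | head hb hs _ ih =>
    rw [Nat.add_right_comm]
    exact .head hb hs (ih h')

theorem single {c c' : Config} {i : Instr} (hi : P[c.pc]? = some i)
    (he : exec c i = .running c') (hc : c.Below W) (hc' : c'.Below W) : Run P W 1 c c' :=
  .head hc (by simp [RAM.step, hi, he]) (.refl hc')

theorem iterate {N : ℕ} {c c' : Config} (h : Run P W N c c') :
    (RAM.step P)^[N] (.running c) = .running c' := by
  induction h with
  | refl _ => rfl
  | head _ hs _ ih => rw [Function.iterate_succ_apply, hs, ih]

theorem below_iterate {N : ℕ} {c c' : Config} (h : Run P W N c c') : ∀ t ≤ N, ∀ d,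
    (RAM.step P)^[t] (.running c) = .running d → d.Below W := by
  induction h with
  | refl hb =>
    intro t ht d hd
    obtain rfl : t = 0 := by omega
    simp only [Function.iterate_zero, id, State.running.injEq] at hd
    exact hd ▸ hb
  | head hb hs _ ih =>
    intro t ht d hd
    cases t with
    | zero =>
      simp only [Function.iterate_zero, id, State.running.injEq] at hd
      exact hd ▸ hb
    | succ t =>
      rw [Function.iterate_succ_apply, hs] at hd
      exact ih t (by omega) d hd

end Run

theorem Config.Below.setReg {W : ℕ} {c : Config} (h : c.Below W) {a v : ℕ} (hv : v < W) :
    (c.setReg a v).Below W := by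
  intro i
  refine ⟨?_, (h i).2⟩
  simp only [Config.setReg, Function.update_apply]
  split_ifs
  · exact hv
  · exact (h i).1

theorem Config.Below.setMem {W : ℕ} {c : Config} (h : c.Below W) {a v : ℕ} (hv : v < W) :
    (c.setMem a v).Below W := by
  intro i
  refine ⟨(h i).1, ?_⟩
  simp only [Config.setMem, Function.update_apply]
  split_ifs
  · exact hv
  · exact (h i).2

theorem Config.Below.goto {W : ℕ} {c : Config} (h : c.Below W) {p : ℕ} : (c.goto p).Below W := h

/-- The code block `code` stands in the program `P` from line `pos` on. -/
def CodeAt (P : Program) (pos : ℕ) (code : List Instr) : Prop :=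
  ∀ i (h : i < code.length), P[pos + i]? = some code[i]

theorem CodeAt.left {P : Program} {pos : ℕ} {l₁ l₂ : List Instr} (h : CodeAt P pos (l₁ ++ l₂)) :
    CodeAt P pos l₁ := fun i hi => by
  rw [h i (by simp; omega), List.getElem_append_left hi]

theorem CodeAt.right {P : Program} {pos : ℕ} {l₁ l₂ : List Instr} (h : CodeAt P pos (l₁ ++ l₂)) :
    CodeAt P (pos + l₁.length) l₂ := fun i hi => by
  have := h (l₁.length + i) (by simp; omega)
  rw [add_assoc, this, List.getElem_append_right (by omega)]
  simp

theorem CodeAt.tail {P : Program} {pos : ℕ} {i : Instr} {l : List Instr}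
    (h : CodeAt P pos (i :: l)) : CodeAt P (pos + 1) l :=
  CodeAt.right (l₁ := [i]) h

theorem CodeAt.head {P : Program} {pos : ℕ} {i : Instr} {l : List Instr}
    (h : CodeAt P pos (i :: l)) : P[pos]? = some i := by
  exact h 0 (Nat.succ_pos _)

theorem exec_instr (c : Config) (op : BinOp) (a b d : ℕ) :
    exec c (op.instr a b d) = .running (c.setReg a (op.eval (c.reg b) (c.reg d))) := by
  cases op <;> rfl

/-- The compiled code of an expression computes its value, in the announced number of steps and
with bounded intermediate values. -/
theorem Exp.comp_run {P : Program} {V W : ℕ} (hV : 16 ≤ V) (hVW : V ≤ W) (e : Exp) :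
    ∀ {bs : List ℕ} {t pos : ℕ} {c : Config}, CodeAt P pos (e.comp t pos) → c.pc = pos →
      64 ≤ t → e.wf bs = true → (∀ x ∈ bs, x < 64) → c.Below W →
      (∀ r, r < 32 ∨ r ∈ bs → c.reg r < V) → (∀ a, c.mem a < V) → V ^ e.deg ≤ W →
      ∃ c', Run P W (e.cost c.reg) c c' ∧ c'.pc = pos + (e.comp t pos).length ∧ c'.mem = c.mem ∧
        c'.reg t = e.eval c.reg c.mem ∧
        ∀ r, (r < 32 ∨ r ∈ bs ∨ (64 ≤ r ∧ r < t)) → c'.reg r = c.reg r := by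
  induction e with
  | lit v =>
    intro bs t pos c hP hpc ht hwf hbs hc hρ hM hW
    simp only [wf, decide_eq_true_eq] at hwf
    refine ⟨c.setReg t v, .single (hpc ▸ hP.head) rfl hc (hc.setReg (by omega)), ?_, rfl, ?_, ?_⟩
    · simp [Config.setReg, comp, hpc]
    · simp [Config.setReg, eval]
    · intro r hr
      have : r ≠ t := by rcases hr with h | h | h; omega; have := hbs r h; omega; omega
      simp [Config.setReg, this]
  | var i =>
    intro bs t pos c hP hpc ht hwf hbs hc hρ hM hW
    refine ⟨c.setReg t (c.reg i), .single (hpc ▸ hP.head) rfl hc (hc.setReg (hc i).1), ?_, rfl,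
      ?_, ?_⟩
    · simp [Config.setReg, comp, hpc]
    · simp [Config.setReg, eval]
    · intro r hr
      have : r ≠ t := by rcases hr with h | h | h; omega; have := hbs r h; omega; omega
      simp [Config.setReg, this]
  | mem a ih =>
    intro bs t pos c hP hpc ht hwf hbs hc hρ hM hW
    obtain ⟨c1, hr1, hp1, hm1, ht1, hk1⟩ := ih (CodeAt.left hP) hpc ht hwf hbs hc hρ hM
      ((Nat.pow_le_pow_right (by omega) (by simp [deg])).trans hW)
    refine ⟨c1.setReg t (c1.mem (c1.reg t)), hr1.trans (.single (hp1 ▸ (CodeAt.right hP).head) rfl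
      hr1.below_right (hr1.below_right.setReg (hr1.below_right _).2)), ?_, ?_, ?_, ?_⟩
    · simp [Config.setReg, comp, hp1, add_assoc]
    · simpa [Config.setReg] using hm1
    · simp [Config.setReg, eval, hm1, ht1]
    · intro r hr
      have : r ≠ t := by rcases hr with h | h | h; omega; have := hbs r h; omega; omega
      simp [Config.setReg, this, hk1 r hr]
  | bin op a b iha ihb =>
    intro bs t pos c hP hpc ht hwf hbs hc hρ hM hW
    have hwf' := hwf
    simp only [wf, Bool.and_eq_true] at hwf
    obtain ⟨c1, hr1, hp1, hm1, ht1, hk1⟩ := iha (CodeAt.left hP) hpc ht hwf.1 hbs hc hρ hM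
      ((Nat.pow_le_pow_right (by omega) (by simp [deg]; omega)).trans hW)
    have hag : ∀ r, r < 32 ∨ r ∈ bs → c1.reg r = c.reg r := fun r hr =>
      hk1 r (hr.imp_right Or.inl)
    obtain ⟨c2, hr2, hp2, hm2, ht2, hk2⟩ := ihb (t := t + 1) (CodeAt.left (CodeAt.right hP)) hp1
      (by omega) hwf.2 hbs hr1.below_right (fun r hr => (hag r hr).symm ▸ hρ r hr)
      (by rwa [hm1]) ((Nat.pow_le_pow_right (by omega) (by simp [deg]; omega)).trans hW)
    have hta : c2.reg t = a.eval c.reg c.mem := by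
      rw [hk2 t (Or.inr (Or.inr ⟨ht, by omega⟩)), ht1]
    have htb : c2.reg (t + 1) = b.eval c.reg c.mem := by
      rw [ht2, hm1]; exact eval_congr b hwf.2 hag
    have hlt := (eval_lt hV hM _ hwf' hρ).trans_le hW
    refine ⟨c2.setReg t (op.eval (c2.reg t) (c2.reg (t + 1))), ?_, ?_, ?_, ?_, ?_⟩
    · have hc1 : b.cost c1.reg = b.cost c.reg :=
        cost_congr b hwf.2 fun r hr => hag r (Or.inl hr)
      have := hr1.trans (hr2.trans (.single (hp2 ▸ (CodeAt.right (CodeAt.right hP)).head)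
        (exec_instr _ _ _ _ _) hr2.below_right (hr2.below_right.setReg (by
          rw [hta, htb]; exact hlt))))
      rwa [hc1, ← add_assoc] at this
    · simp [Config.setReg, comp, hp2, add_assoc]
    · simp [Config.setReg, hm2, hm1]
    · simp [Config.setReg, eval, hta, htb]
    · intro r hr
      have : r ≠ t := by rcases hr with h | h | h; omega; have := hbs r h; omega; omega
      simp only [Config.setReg, ne_eq, this, not_false_eq_true, Function.update_of_ne]
      rw [hk2 r (hr.imp_right (Or.imp_right fun h => ⟨h.1, by omega⟩)), hk1 r hr]
  | sum x i b ih =>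
    intro bs t pos c hP hpc ht hwf hbs hc hρ hM hW
    have hwf' := hwf
    simp only [wf, Bool.and_eq_true, decide_eq_true_eq, Bool.not_eq_true',
      decide_eq_false_iff_not] at hwf
    obtain ⟨⟨⟨⟨hi, hx1⟩, hx2⟩, hx3⟩, hb⟩ := hwf
    have hP2 : CodeAt P (pos + 4) _ := CodeAt.right hP
    have hPb := CodeAt.left hP2
    have hPe := CodeAt.right hP2
    set code := b.comp (t + 1) (pos + 4) with hcode
    have hlt := (eval_lt hV hM _ hwf' hρ).trans_le hW
    have hiV := hρ i (Or.inl hi)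
    have hWb : V ^ b.deg ≤ W := (Nat.pow_le_pow_right (by omega) (by simp [deg])).trans hW
    -- the state at the loop head after `j` rounds
    have loop : ∀ j ≤ c.reg i, ∃ c', Run P W (2 + j * (b.cost c.reg + 5)) c c' ∧ c'.pc = pos + 2 ∧
        c'.mem = c.mem ∧ c'.reg x = j ∧
        c'.reg t = ∑ v ∈ Finset.range j, b.eval (Function.update c.reg x v) c.mem ∧
        ∀ r, (r < 32 ∨ r ∈ bs ∨ (64 ≤ r ∧ r < t)) → c'.reg r = c.reg r := by
      intro j
      induction j with
      | zero =>
        intro _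
        have h1 : (c.setReg t 0).Below W := hc.setReg (by omega)
        have h2 : ((c.setReg t 0).setReg x 0).Below W := h1.setReg (by omega)
        refine ⟨(c.setReg t 0).setReg x 0, ?_, ?_, rfl, ?_, ?_, ?_⟩
        · have r1 : Run P W 1 c (c.setReg t 0) :=
            .single (hpc ▸ (CodeAt.left hP).head) rfl hc h1
          have r2 : Run P W 1 (c.setReg t 0) ((c.setReg t 0).setReg x 0) :=
            .single (by simpa [Config.setReg, hpc] using (CodeAt.left hP).tail.head) rfl h1 h2
          simpa using r1.trans r2
        · simp [Config.setReg, hpc]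
        · simp [Config.setReg]
        · have : t ≠ x := by omega
          simp [Config.setReg, this]
        · intro r hr
          have h1 : r ≠ t := by rcases hr with h | h | h; omega; have := hbs r h; omega; omega
          have h2 : r ≠ x := by
            rcases hr with h | h | h
            · omega
            · rintro rfl; exact hx3 h
            · omega
          simp [Config.setReg, h1, h2]
      | succ j ihj =>
        intro hj
        obtain ⟨c1, hr1, hp1, hm1, hx, hacc, hk1⟩ := ihj (by omega)
        have hci : c1.reg i = c.reg i := hk1 i (Or.inl hi)
        -- jump into the body
        have hr2 : Run P W 1 c1 (c1.goto (pos + 4)) := by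
          refine .single (hp1 ▸ (CodeAt.left hP).tail.tail.head) ?_ hr1.below_right
            hr1.below_right.goto
          simp only [exec, hx, hci, if_pos (show j < c.reg i by omega)]
        have hag : ∀ r, r < 32 ∨ r ∈ (x :: bs) →
            (c1.goto (pos + 4)).reg r = Function.update c.reg x j r := by
          intro r hr
          simp only [Config.goto]
          by_cases hrx : r = x
          · simp [hrx, hx]
          · rw [Function.update_of_ne hrx]
            exact hk1 r (by
              rcases hr with h | h
              · exact Or.inl h
              · exact Or.inr (Or.inl ((List.mem_cons.1 h).resolve_left hrx)))
        obtain ⟨c3, hr3, hp3, hm3, ht3, hk3⟩ := ih (bs := x :: bs) (t := t + 1) (pos := pos + 4)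
          (c := c1.goto (pos + 4)) hPb rfl (by omega) hb
          (by
            intro y hy
            rcases List.mem_cons.1 hy with rfl | h
            · exact hx2
            · exact hbs y h) hr2.below_right
          (by
            intro r hr
            rw [hag r hr]
            by_cases hrx : r = x
            · subst hrx; simp; omega
            · rw [Function.update_of_ne hrx]
              exact hρ r (hr.imp_right fun h => (List.mem_cons.1 h).resolve_left hrx))
          (by simpa [Config.goto, hm1] using hM) hWb
        have hcost : b.cost (c1.goto (pos + 4)).reg = b.cost c.reg :=
          cost_congr b hb fun r hr => by
            rw [hag r (Or.inl hr), Function.update_of_ne (by omega)]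
        have hval : c3.reg (t + 1) = b.eval (Function.update c.reg x j) c.mem := by
          rw [ht3]
          have : (c1.goto (pos + 4)).mem = c.mem := hm1
          rw [this]
          exact eval_congr b hb hag
        have hacc3 : c3.reg t = ∑ v ∈ Finset.range j, b.eval (Function.update c.reg x v) c.mem := by
          rw [hk3 t (Or.inr (Or.inr ⟨ht, by omega⟩))]; exact hacc
        have hx3' : c3.reg x = j := by
          rw [hk3 x (by simp)]; exact hx
        have hsum : c3.reg t + c3.reg (t + 1) =
            ∑ v ∈ Finset.range (j + 1), b.eval (Function.update c.reg x v) c.mem := by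
          rw [Finset.sum_range_succ, hacc3, hval]
        have hb3 := hr3.below_right
        have hslt : c3.reg t + c3.reg (t + 1) < W := by
          rw [hsum]
          refine lt_of_le_of_lt ?_ hlt
          exact Finset.sum_le_sum_of_subset (Finset.range_subset_range.2 hj)
        set c4 := c3.setReg t (c3.reg t + c3.reg (t + 1)) with hc4
        have hb4 : c4.Below W := hb3.setReg hslt
        set c5 := c4.setReg (t + 1) 1 with hc5
        have hb5 : c5.Below W := hb4.setReg (by omega)
        have hx5 : c5.reg x = j := by
          have h1 : x ≠ t := by omega
          have h2 : x ≠ t + 1 := by omega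
          simp [hc5, hc4, Config.setReg, h1, h2, hx3']
        have ho5 : c5.reg (t + 1) = 1 := by simp [hc5, Config.setReg]
        set c6 := c5.setReg x (c5.reg x + c5.reg (t + 1)) with hc6
        have hb6 : c6.Below W := hb5.setReg (by rw [hx5, ho5]; omega)
        have hp4 : c4.pc = pos + 4 + code.length + 1 := by
          simp only [hc4, Config.setReg, hp3]; rfl
        have hp5 : c5.pc = pos + 4 + code.length + 1 + 1 := by simp [hc5, Config.setReg, hp4]
        have hp6 : c6.pc = pos + 4 + code.length + 1 + 1 + 1 := by simp [hc6, Config.setReg, hp5]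
        have r4 : Run P W 1 c3 c4 := .single (by rw [hp3]; exact hPe.head) rfl hb3 hb4
        have r5 : Run P W 1 c4 c5 := .single (by rw [hp4]; exact hPe.tail.head) rfl hb4 hb5
        have r6 : Run P W 1 c5 c6 := .single (by rw [hp5]; exact hPe.tail.tail.head) rfl hb5 hb6
        have r7 : Run P W 1 c6 (c6.goto (pos + 2)) :=
          .single (by rw [hp6]; exact hPe.tail.tail.tail.head) rfl hb6 hb6.goto
        refine ⟨c6.goto (pos + 2), ?_, rfl, ?_, ?_, ?_, ?_⟩
        · have := hr1.trans (hr2.trans (hr3.trans (r4.trans (r5.trans (r6.trans r7)))))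
          rw [hcost] at this
          convert this using 1
          ring
        · simp only [Config.goto, hc6, hc5, hc4, Config.setReg, hm3, hm1]
        · simp [Config.goto, hc6, Config.setReg, hx5, ho5]
        · have h1 : t ≠ x := by omega
          simp [Config.goto, hc6, hc5, hc4, Config.setReg, h1, hsum]
        · intro r hr
          have h1 : r ≠ t := by rcases hr with h | h | h; omega; have := hbs r h; omega; omega
          have h2 : r ≠ x := by
            rcases hr with h | h | h
            · omega
            · rintro rfl; exact hx3 h
            · omega
          have h3 : r ≠ t + 1 := by rcases hr with h | h | h; omega; have := hbs r h; omega; omega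
          simp only [Config.goto, hc6, hc5, hc4, Config.setReg, ne_eq, h1, h2, h3,
            not_false_eq_true, Function.update_of_ne]
          rw [hk3 r (by
            rcases hr with h | h | h
            · exact Or.inl h
            · exact Or.inr (Or.inl (List.mem_cons_of_mem _ h))
            · exact Or.inr (Or.inr ⟨h.1, by omega⟩))]
          exact hk1 r hr
    obtain ⟨c1, hr1, hp1, hm1, hx, hacc, hk1⟩ := loop _ le_rfl
    have hci : c1.reg i = c.reg i := hk1 i (Or.inl hi)
    have r2 : Run P W 1 c1 (c1.goto (pos + 3)) := by
      refine .single (hp1 ▸ (CodeAt.left hP).tail.tail.head) ?_ hr1.below_right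
        hr1.below_right.goto
      simp only [exec, hx, hci, lt_irrefl, if_false, hp1]
    have r3 : Run P W 1 (c1.goto (pos + 3)) ((c1.goto (pos + 3)).goto
        (pos + 4 + (code.length + 4))) :=
      .single (CodeAt.left hP).tail.tail.tail.head rfl r2.below_right r2.below_right.goto
    refine ⟨(c1.goto (pos + 3)).goto (pos + 4 + (code.length + 4)), ?_, ?_, hm1, hacc, hk1⟩
    · have := hr1.trans (r2.trans r3)
      convert this using 1
      simp only [cost]; ring
    · simp only [Config.goto, comp, ← hcode, List.length_append, List.length_cons, List.length_nil]
      omega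

/-! ### Structured commands -/

/-- The contents of the registers and of the memory, without the program line. -/
structure Store where
  reg : ℕ → ℕ
  mem : ℕ → ℕ

/-- Write `v` into the register `x`. -/
def Store.set (σ : Store) (x v : ℕ) : Store := ⟨Function.update σ.reg x v, σ.mem⟩

/-- The program variables and the memory cells are below `V`. -/
def Store.Below (V : ℕ) (σ : Store) : Prop := (∀ r < 32, σ.reg r < V) ∧ ∀ a, σ.mem a < V

theorem Store.Below.set {V : ℕ} {σ : Store} (h : σ.Below V) {x v : ℕ} (hv : v < V) :
    (σ.set x v).Below V := by
  refine ⟨fun r hr => ?_, h.2⟩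
  simp only [Store.set, Function.update_apply]
  split_ifs
  · exact hv
  · exact h.1 r hr

/-- `iterLoop f N σ` applies `f 0`, …, `f (N - 1)` in turn. -/
def iterLoop (f : ℕ → Store → Store) : ℕ → Store → Store
  | 0, σ => σ
  | N + 1, σ => f N (iterLoop f N σ)

/-- Structured commands. `loop x i c` runs `c` once for each value of the register `x` below the
contents of the register `i`. -/
inductive Cmd where
  | set (x : ℕ) (e : Exp)
  | store (a e : Exp)
  | seq (c₁ c₂ : Cmd)
  | ite (e : Exp) (c₁ c₂ : Cmd)
  | loop (x i : ℕ) (c : Cmd)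

namespace Cmd

/-- The effect of a command. -/
def exec : Cmd → Store → Store
  | set x e, σ => σ.set x (e.eval σ.reg σ.mem)
  | store a e, σ =>
    ⟨σ.reg, Function.update σ.mem (a.eval σ.reg σ.mem) (e.eval σ.reg σ.mem)⟩
  | seq c₁ c₂, σ => c₂.exec (c₁.exec σ)
  | ite e c₁ c₂, σ => if 0 < e.eval σ.reg σ.mem then c₁.exec σ else c₂.exec σ
  | loop x i c, σ =>
    (iterLoop (fun j τ => c.exec (τ.set x j)) (σ.reg i) σ).set x (σ.reg i)

/-- The registers to which a command may write. -/
def writes : Cmd → ℕ → Bool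
  | set x _, r => decide (r = x)
  | store _ _, _ => false
  | seq c₁ c₂, r => c₁.writes r || c₂.writes r
  | ite _ c₁ c₂, r => c₁.writes r || c₂.writes r
  | loop x _ c, r => decide (r = x) || c.writes r

/-- Well-formed commands: a loop changes neither its counter nor its limit. -/
def wf : Cmd → Bool
  | set x e => decide (x < 32) && e.wf []
  | store a e => a.wf [] && e.wf []
  | seq c₁ c₂ => c₁.wf && c₂.wf
  | ite e c₁ c₂ => e.wf [] && c₁.wf && c₂.wf
  | loop x i c => decide (x < 32) && decide (i < 32) && decide (i ≠ x) && !c.writes x &&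
      !c.writes i && c.wf

/-- An upper bound for the degrees of all expressions in a command. -/
def deg : Cmd → ℕ
  | set _ e => e.deg
  | store a e => a.deg + e.deg
  | seq c₁ c₂ => c₁.deg + c₂.deg
  | ite e c₁ c₂ => e.deg + c₁.deg + c₂.deg
  | loop _ _ c => c.deg

/-- An upper bound for the number of steps of the compiled command. -/
def cost : Cmd → Store → ℕ
  | set _ e, σ => e.cost σ.reg + 1
  | store a e, σ => a.cost σ.reg + e.cost σ.reg + 1
  | seq c₁ c₂, σ => c₁.cost σ + c₂.cost (c₁.exec σ)
  | ite e c₁ c₂, σ =>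
    e.cost σ.reg + 3 + if 0 < e.eval σ.reg σ.mem then c₁.cost σ else c₂.cost σ
  | loop x i c, σ => 3 + ∑ j ∈ Finset.range (σ.reg i),
      (c.cost ((iterLoop (fun j τ => c.exec (τ.set x j)) j σ).set x j) + 4)

/-- All numbers that a command writes to variables and memory cells are below `V`. -/
def Safe (V : ℕ) : Cmd → Store → Prop
  | set _ e, σ => e.eval σ.reg σ.mem < V
  | store _ e, σ => e.eval σ.reg σ.mem < V
  | seq c₁ c₂, σ => c₁.Safe V σ ∧ c₂.Safe V (c₁.exec σ)
  | ite e c₁ c₂, σ => if 0 < e.eval σ.reg σ.mem then c₁.Safe V σ else c₂.Safe V σ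
  | loop x i c, σ => ∀ j < σ.reg i,
      c.Safe V ((iterLoop (fun j τ => c.exec (τ.set x j)) j σ).set x j)

/-- Machine code for a command, for a code block that starts at line `pos`. -/
def comp : Cmd → ℕ → List Instr
  | set x e, pos => e.comp 64 pos ++ [.copy x 64]
  | store a e, pos =>
    a.comp 64 pos ++ (e.comp 65 (pos + (a.comp 64 pos).length) ++ [.store 64 65])
  | seq c₁ c₂, pos => c₁.comp pos ++ c₂.comp (pos + (c₁.comp pos).length)
  | ite e c₁ c₂, pos =>
    let p₂ := pos + (e.comp 64 pos).length + 2
    let p₁ := p₂ + (c₂.comp p₂).length + 1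
    e.comp 64 pos ++ ([.const 65 0, .jumpLt 65 64 p₁] ++
      (c₂.comp p₂ ++ ([.jump (p₁ + (c₁.comp p₁).length)] ++ c₁.comp p₁)))
  | loop x i c, pos =>
    [.const x 0, .jumpLt x i (pos + 3), .jump (pos + 3 + ((c.comp (pos + 3)).length + 3))] ++
      (c.comp (pos + 3) ++ [.const 64 1, .add x x 64, .jump (pos + 1)])

theorem exec_reg (c : Cmd) : ∀ (σ : Store) {r : ℕ}, c.writes r = false →
    (c.exec σ).reg r = σ.reg r := by
  induction c with
  | set x e =>
    intro σ r h
    simp only [writes, decide_eq_false_iff_not] at h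
    simp [exec, Store.set, h]
  | store a e => intros; rfl
  | seq c₁ c₂ ih₁ ih₂ =>
    intro σ r h
    simp only [writes, Bool.or_eq_false_iff] at h
    simp only [exec, ih₂ _ h.2, ih₁ _ h.1]
  | ite e c₁ c₂ ih₁ ih₂ =>
    intro σ r h
    simp only [writes, Bool.or_eq_false_iff] at h
    simp only [exec]
    split_ifs
    · exact ih₁ _ h.1
    · exact ih₂ _ h.2
  | loop x i c ih =>
    intro σ r h
    simp only [writes, Bool.or_eq_false_iff, decide_eq_false_iff_not] at h
    simp only [exec, Store.set, ne_eq, h.1, not_false_eq_true, Function.update_of_ne]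
    generalize σ.reg i = N
    induction N with
    | zero => rfl
    | succ N ihN => simp only [iterLoop, ih _ h.2, Function.update_of_ne h.1, ihN]

theorem exec_below {V : ℕ} (c : Cmd) : ∀ {σ : Store}, c.wf = true → σ.Below V → c.Safe V σ →
    (c.exec σ).Below V := by
  induction c with
  | set x e => intro σ _ hb hs; exact hb.set hs
  | store a e =>
    intro σ _ hb hs
    refine ⟨hb.1, fun b => ?_⟩
    simp only [exec, Function.update_apply]
    split_ifs
    · exact hs
    · exact hb.2 b
  | seq c₁ c₂ ih₁ ih₂ =>
    intro σ hwf hb hs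
    simp only [wf, Bool.and_eq_true] at hwf
    exact ih₂ hwf.2 (ih₁ hwf.1 hb hs.1) hs.2
  | ite e c₁ c₂ ih₁ ih₂ =>
    intro σ hwf hb hs
    simp only [wf, Bool.and_eq_true] at hwf
    simp only [exec]
    simp only [Safe] at hs
    split_ifs at hs ⊢
    · exact ih₁ hwf.1.2 hb hs
    · exact ih₂ hwf.2 hb hs
  | loop x i c ih =>
    intro σ hwf hb hs
    simp only [wf, Bool.and_eq_true, decide_eq_true_eq] at hwf
    have hi := hb.1 i hwf.1.1.1.1.2
    have key : ∀ j ≤ σ.reg i, (iterLoop (fun j τ => c.exec (τ.set x j)) j σ).Below V := by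
      intro j
      induction j with
      | zero => intro _; exact hb
      | succ j ihj =>
        intro hj
        exact ih hwf.2 ((ihj (by omega)).set (by omega)) (hs j (by omega))
    exact (key _ le_rfl).set hi

/-- The machine holds the variables and the memory of `σ`. -/
def _root_.RAM.Config.Holds (c : Config) (σ : Store) : Prop :=
  (∀ r < 32, c.reg r = σ.reg r) ∧ c.mem = σ.mem

/-- Running an expression from a machine that holds the store `σ`. -/
theorem _root_.RAM.Exp.comp_run_store {P : Program} {V W : ℕ} (hV : 16 ≤ V) (hVW : V ≤ W)
    {e : Exp} {t pos : ℕ} {c : Config} {σ : Store} (hP : CodeAt P pos (e.comp t pos))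
    (hpc : c.pc = pos) (ht : 64 ≤ t) (hwf : e.wf [] = true) (hc : c.Below W) (hσ : c.Holds σ)
    (hb : σ.Below V) (hd : V ^ e.deg ≤ W) :
    ∃ c', Run P W (e.cost σ.reg) c c' ∧ c'.pc = pos + (e.comp t pos).length ∧ c'.Holds σ ∧
      c'.reg t = e.eval σ.reg σ.mem ∧ ∀ r, 64 ≤ r → r < t → c'.reg r = c.reg r := by
  have hag : ∀ r, r < 32 ∨ r ∈ ([] : List ℕ) → c.reg r = σ.reg r := by
    simpa using hσ.1
  obtain ⟨c', hr, hp, hm, hv, hk⟩ := e.comp_run hV hVW hP hpc ht hwf (by simp) hc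
    (by intro r hr; rw [hag r hr]; exact hb.1 r (by simpa using hr)) (by rw [hσ.2]; exact hb.2) hd
  refine ⟨c', ?_, hp, ⟨fun r hr => ?_, hm.trans hσ.2⟩, ?_, fun r h1 h2 => hk r (by omega)⟩
  · rwa [e.cost_congr hwf hσ.1] at hr
  · rw [hk r (Or.inl hr), hσ.1 r hr]
  · rw [hv, hσ.2, e.eval_congr hwf hag]

theorem comp_run {P : Program} {V W : ℕ} (hV : 16 ≤ V) (hVW : V ≤ W) (cmd : Cmd) :
    ∀ {pos : ℕ} {c : Config} {σ : Store}, CodeAt P pos (cmd.comp pos) → c.pc = pos →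
      cmd.wf = true → c.Below W → c.Holds σ → σ.Below V → cmd.Safe V σ → V ^ cmd.deg ≤ W →
      ∃ N ≤ cmd.cost σ, ∃ c', Run P W N c c' ∧ c'.pc = pos + (cmd.comp pos).length ∧
        c'.Holds (cmd.exec σ) := by
  induction cmd with
  | set x e =>
    intro pos c σ hP hpc hwf hc hσ hb hs hd
    simp only [wf, Bool.and_eq_true, decide_eq_true_eq] at hwf
    obtain ⟨c1, hr1, hp1, hh1, hv1, -⟩ := Exp.comp_run_store hV hVW (CodeAt.left hP) hpc le_rfl
      hwf.2 hc hσ hb hd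
    have hb1 := hr1.below_right
    refine ⟨_, le_rfl, c1.setReg x (c1.reg 64), hr1.trans (.single
      (hp1 ▸ (CodeAt.right hP).head) rfl hb1 (hb1.setReg (hb1 64).1)), ?_, ?_, hh1.2⟩
    · simp [Config.setReg, comp, hp1, add_assoc]
    · intro r hr
      simp only [Config.setReg, exec, Store.set, hv1, Function.update_apply, hh1.1 r hr]
  | store a e =>
    intro pos c σ hP hpc hwf hc hσ hb hs hd
    simp only [wf, Bool.and_eq_true] at hwf
    obtain ⟨c1, hr1, hp1, hh1, hv1, -⟩ := Exp.comp_run_store hV hVW (CodeAt.left hP) hpc le_rfl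
      hwf.1 hc hσ hb ((Nat.pow_le_pow_right (by omega) (by simp [deg])).trans hd)
    obtain ⟨c2, hr2, hp2, hh2, hv2, hk2⟩ := Exp.comp_run_store hV hVW
      (CodeAt.left (CodeAt.right hP)) hp1 (by omega : 64 ≤ 65)
      hwf.2 hr1.below_right hh1 hb ((Nat.pow_le_pow_right (by omega) (by simp [deg])).trans hd)
    have hb2 := hr2.below_right
    refine ⟨_, le_rfl, c2.setMem (c2.reg 64) (c2.reg 65), ?_, ?_, hh2.1, ?_⟩
    · have := hr1.trans (hr2.trans (.single (hp2 ▸ (CodeAt.right (CodeAt.right hP)).head) rfl hb2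
        (hb2.setMem (hb2 65).1)))
      simpa only [cost, add_assoc] using this
    · simp [Config.setMem, comp, hp2, add_assoc]
    · simp only [Config.setMem, exec, hv2, hk2 64 le_rfl (by omega), hv1, hh2.2]
  | seq c₁ c₂ ih₁ ih₂ =>
    intro pos c σ hP hpc hwf hc hσ hb hs hd
    simp only [wf, Bool.and_eq_true] at hwf
    obtain ⟨N1, hN1, c1, hr1, hp1, hh1⟩ := ih₁ (CodeAt.left hP) hpc hwf.1 hc hσ hb hs.1
      ((Nat.pow_le_pow_right (by omega) (by simp [deg])).trans hd)
    obtain ⟨N2, hN2, c2, hr2, hp2, hh2⟩ := ih₂ (CodeAt.right hP) hp1 hwf.2 hr1.below_right hh1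
      (exec_below c₁ hwf.1 hb hs.1) hs.2
      ((Nat.pow_le_pow_right (by omega) (by simp [deg])).trans hd)
    refine ⟨_, Nat.add_le_add hN1 hN2, c2, hr1.trans hr2, ?_, hh2⟩
    simp [comp, hp2, add_assoc]
  | ite e c₁ c₂ ih₁ ih₂ =>
    intro pos c σ hP hpc hwf hc hσ hb hs hd
    simp only [wf, Bool.and_eq_true] at hwf
    obtain ⟨c1, hr1, hp1, hh1, hv1, -⟩ := Exp.comp_run_store hV hVW (CodeAt.left hP) hpc le_rfl
      hwf.1.1 hc hσ hb ((Nat.pow_le_pow_right (by omega) (by simp [deg]; omega)).trans hd)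
    have hQ := CodeAt.right hP
    have hQ1 := CodeAt.left hQ
    have hQ2 := CodeAt.right hQ
    have hQ3 := CodeAt.right hQ2
    have hb1 := hr1.below_right
    have hb2 : (c1.setReg 65 0).Below W := hb1.setReg (by omega)
    have r2 : Run P W 1 c1 (c1.setReg 65 0) := .single (hp1 ▸ hQ1.head) rfl hb1 hb2
    have hh2 : (c1.setReg 65 0).Holds σ := by
      refine ⟨fun r hr => ?_, hh1.2⟩
      have : r ≠ 65 := by omega
      simp [Config.setReg, this, hh1.1 r hr]
    simp only [Safe] at hs
    simp only [cost, exec]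
    by_cases h0 : 0 < e.eval σ.reg σ.mem
    · rw [if_pos h0] at hs
      simp only [if_pos h0]
      set p₂ := pos + (e.comp 64 pos).length + 2 with hp₂
      set p₁ := p₂ + (c₂.comp p₂).length + 1 with hp₁
      have r3 : Run P W 1 (c1.setReg 65 0) ((c1.setReg 65 0).goto p₁) := by
        refine .single (i := .jumpLt 65 64 p₁) ?_ ?_ hb2 hb2.goto
        · have := hQ1.tail.head
          simpa [Config.setReg, hp1] using this
        · simp [RAM.exec, Config.setReg, hv1, h0]
      obtain ⟨N4, hN4, c4, hr4, hp4, hh4⟩ := ih₁ (pos := p₁) (c := (c1.setReg 65 0).goto p₁)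
        (CodeAt.right hQ3) rfl hwf.1.2 hb2.goto hh2 hb hs
        ((Nat.pow_le_pow_right (by omega) (by simp [deg]; omega)).trans hd)
      refine ⟨_, ?_, c4, hr1.trans (r2.trans (r3.trans hr4)), ?_, hh4⟩
      · omega
      · rw [hp4]
        simp only [comp, List.length_append, List.length_cons, List.length_nil, ← hp₂, ← hp₁]
        omega
    · rw [if_neg h0] at hs
      simp only [if_neg h0]
      set p₂ := pos + (e.comp 64 pos).length + 2 with hp₂
      set p₁ := p₂ + (c₂.comp p₂).length + 1 with hp₁
      have r3 : Run P W 1 (c1.setReg 65 0) ((c1.setReg 65 0).goto p₂) := by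
        refine .single (i := .jumpLt 65 64 p₁) ?_ ?_ hb2 hb2.goto
        · have := hQ1.tail.head
          simpa [Config.setReg, hp1] using this
        · simp [RAM.exec, Config.setReg, hv1, h0, hp₂, hp1]
      obtain ⟨N4, hN4, c4, hr4, hp4, hh4⟩ := ih₂ (pos := p₂) (c := (c1.setReg 65 0).goto p₂)
        (CodeAt.left hQ2) rfl hwf.2 hb2.goto hh2 hb hs
        ((Nat.pow_le_pow_right (by omega) (by simp [deg])).trans hd)
      have hb4 := hr4.below_right
      have r5 : Run P W 1 c4 (c4.goto (p₁ + (c₁.comp p₁).length)) :=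
        .single (hp4 ▸ (CodeAt.left hQ3).head) rfl hb4 hb4.goto
      refine ⟨_, ?_, _, hr1.trans (r2.trans (r3.trans (hr4.trans r5))), ?_, hh4⟩
      · omega
      · simp only [Config.goto, comp, List.length_append, List.length_cons, List.length_nil,
          ← hp₂, ← hp₁]
        omega
  | loop x i cmd ih =>
    intro pos c σ hP hpc hwf hc hσ hb hs hd
    simp only [wf, Bool.and_eq_true, decide_eq_true_eq, Bool.not_eq_true'] at hwf
    obtain ⟨⟨⟨⟨⟨hx, hi⟩, hix⟩, hwx⟩, hwi⟩, hwf⟩ := hwf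
    have hQ := CodeAt.left hP
    have hP2 : CodeAt P (pos + 3) _ := CodeAt.right hP
    have hPb := CodeAt.left hP2
    have hPe := CodeAt.right hP2
    set code := cmd.comp (pos + 3) with hcode
    set τ : ℕ → Store := fun j => iterLoop (fun j τ => cmd.exec (τ.set x j)) j σ with hτ
    have hτ1 : ∀ j, τ (j + 1) = cmd.exec ((τ j).set x j) := fun j => rfl
    have hτi : ∀ j, (τ j).reg i = σ.reg i := by
      intro j
      induction j with
      | zero => rfl
      | succ j ihj =>
        rw [hτ1, exec_reg _ _ hwi]
        simpa [Store.set, hix] using ihj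
    have hiV : σ.reg i < V := hb.1 i hi
    have hτb : ∀ j ≤ σ.reg i, (τ j).Below V := by
      intro j
      induction j with
      | zero => intro _; exact hb
      | succ j ihj =>
        intro hj
        exact exec_below cmd hwf ((ihj (by omega)).set (by omega)) (hs j (by omega))
    have loop : ∀ j ≤ σ.reg i, ∃ N ≤ 1 + ∑ v ∈ Finset.range j, (cmd.cost ((τ v).set x v) + 4),
        ∃ c', Run P W N c c' ∧ c'.pc = pos + 1 ∧ c'.Holds ((τ j).set x j) := by
      intro j
      induction j with
      | zero =>
        intro _
        refine ⟨1, by simp, c.setReg x 0, .single (hpc ▸ hQ.head) rfl hc (hc.setReg (by omega)),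
          by simp [Config.setReg, hpc], ?_, hσ.2⟩
        intro r hr
        simp only [Config.setReg, Store.set, Function.update_apply, hσ.1 r hr]
        rfl
      | succ j ihj =>
        intro hj
        obtain ⟨N1, hN1, c1, hr1, hp1, hh1⟩ := ihj (by omega)
        have hb1 := hr1.below_right
        have hcx : c1.reg x = j := by rw [hh1.1 x hx]; simp [Store.set]
        have hci : c1.reg i = σ.reg i := by
          rw [hh1.1 i hi]; simp [Store.set, hix, hτi]
        have r2 : Run P W 1 c1 (c1.goto (pos + 3)) := by
          refine .single (hp1 ▸ hQ.tail.head) ?_ hb1 hb1.goto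
          simp only [RAM.exec, hcx, hci, if_pos (show j < σ.reg i by omega)]
        obtain ⟨N3, hN3, c3, hr3, hp3, hh3⟩ := ih (pos := pos + 3) (c := c1.goto (pos + 3))
          (σ := (τ j).set x j) hPb rfl hwf hb1.goto hh1 ((hτb j (by omega)).set (by omega))
          (hs j (by omega)) hd
        have hb3 := hr3.below_right
        have hx3 : c3.reg x = j := by
          rw [hh3.1 x hx, exec_reg _ _ hwx]; simp [Store.set]
        set c4 := c3.setReg 64 1 with hc4
        have hb4 : c4.Below W := hb3.setReg (by omega)
        have hx4 : c4.reg x = j := by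
          have : x ≠ 64 := by omega
          simp [hc4, Config.setReg, this, hx3]
        have ho4 : c4.reg 64 = 1 := by simp [hc4, Config.setReg]
        set c5 := c4.setReg x (c4.reg x + c4.reg 64) with hc5
        have hb5 : c5.Below W := hb4.setReg (by rw [hx4, ho4]; omega)
        have hp4 : c4.pc = pos + 3 + code.length + 1 := by
          simp only [hc4, Config.setReg, hp3]; rfl
        have hp5 : c5.pc = pos + 3 + code.length + 1 + 1 := by simp [hc5, Config.setReg, hp4]
        have r4 : Run P W 1 c3 c4 := .single (by rw [hp3]; exact hPe.head) rfl hb3 hb4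
        have r5 : Run P W 1 c4 c5 := .single (by rw [hp4]; exact hPe.tail.head) rfl hb4 hb5
        have r6 : Run P W 1 c5 (c5.goto (pos + 1)) :=
          .single (by rw [hp5]; exact hPe.tail.tail.head) rfl hb5 hb5.goto
        refine ⟨_, ?_, _, hr1.trans (r2.trans (hr3.trans (r4.trans (r5.trans r6)))), rfl, ?_, ?_⟩
        · rw [Finset.sum_range_succ]
          omega
        · intro r hr
          have h64 : r ≠ 64 := by omega
          simp only [Config.goto, hc5, Config.setReg, Store.set, hx4, ho4, hτ1,
            Function.update_apply]
          split_ifs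
          · rfl
          · simp only [hc4, Config.setReg, Function.update_of_ne h64]
            exact hh3.1 r hr
        · exact hh3.2
    obtain ⟨N1, hN1, c1, hr1, hp1, hh1⟩ := loop _ le_rfl
    have hb1 := hr1.below_right
    have hcx : c1.reg x = σ.reg i := by rw [hh1.1 x hx]; simp [Store.set]
    have hci : c1.reg i = σ.reg i := by
      rw [hh1.1 i hi]; simp [Store.set, hix, hτi]
    have r2 : Run P W 1 c1 (c1.goto (pos + 2)) := by
      refine .single (hp1 ▸ hQ.tail.head) ?_ hb1 hb1.goto
      simp only [RAM.exec, hcx, hci, lt_irrefl, if_false, hp1]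
    have r3 : Run P W 1 (c1.goto (pos + 2)) ((c1.goto (pos + 2)).goto
        (pos + 3 + (code.length + 3))) :=
      .single hQ.tail.tail.head rfl r2.below_right r2.below_right.goto
    refine ⟨_, ?_, _, hr1.trans (r2.trans r3), ?_, hh1⟩
    · simp only [cost]
      simp only [hτ] at hN1
      omega
    · simp only [Config.goto, comp, ← hcode, List.length_append, List.length_cons, List.length_nil]
      omega

end Cmd

/-! ### Monomial bounds for running times -/

/-- The monomial with exponents `d` in the three quantities `b`. -/
def monomial (b d : ℕ × ℕ × ℕ) : ℕ := b.1 ^ d.1 * b.2.1 ^ d.2.1 * b.2.2 ^ d.2.2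

section Monomial

variable {b : ℕ × ℕ × ℕ}

theorem monomial_add (d d' : ℕ × ℕ × ℕ) :
    monomial b (d + d') = monomial b d * monomial b d' := by
  simp only [monomial, Prod.fst_add, Prod.snd_add, pow_add]
  ring

theorem monomial_mono (h1 : 16 ≤ b.1) (h2 : 1 ≤ b.2.1) (h3 : 1 ≤ b.2.2) {d d' : ℕ × ℕ × ℕ}
    (h : d ≤ d') : monomial b d ≤ monomial b d' := by
  obtain ⟨ha, hb, hc⟩ := h
  exact Nat.mul_le_mul (Nat.mul_le_mul (Nat.pow_le_pow_right (by omega) ha)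
    (Nat.pow_le_pow_right h2 hb)) (Nat.pow_le_pow_right h3 hc)

theorem one_le_monomial (h1 : 16 ≤ b.1) (h2 : 1 ≤ b.2.1) (h3 : 1 ≤ b.2.2) (d : ℕ × ℕ × ℕ) :
    1 ≤ monomial b d := by
  have := monomial_mono h1 h2 h3
    (show 0 ≤ d from ⟨Nat.zero_le _, Nat.zero_le _, Nat.zero_le _⟩)
  simpa [monomial] using this

theorem le_monomial_succ (h1 : 16 ≤ b.1) {d : ℕ × ℕ × ℕ} {c : ℕ} (h : c ≤ 16 * monomial b d) :
    c ≤ monomial b (d + (1, 0, 0)) := by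
  rw [monomial_add]
  refine h.trans ?_
  rw [mul_comm]
  exact Nat.mul_le_mul_left _ (by simpa [monomial] using h1)

end Monomial

/-- Exponents of a monomial that bounds the running time of an expression, if the register `i` is
bounded by the monomial with exponents `cls i`. -/
def Exp.costDeg (cls : ℕ → ℕ × ℕ × ℕ) : Exp → ℕ × ℕ × ℕ
  | .lit _ => 0
  | .var _ => 0
  | .mem a => a.costDeg cls + (1, 0, 0)
  | .bin _ a b => a.costDeg cls ⊔ b.costDeg cls + (1, 0, 0)
  | .sum _ i b => cls i + b.costDeg cls + (1, 0, 0)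

/-- All sums in the expression are limited by registers below `20`. -/
def Exp.limited : Exp → Bool
  | .lit _ => true
  | .var _ => true
  | .mem a => a.limited
  | .bin _ a b => a.limited && b.limited
  | .sum _ i b => decide (i < 20) && b.limited

/-- Exponents of a monomial that bounds the running time of a command. -/
def Cmd.costDeg (cls : ℕ → ℕ × ℕ × ℕ) : Cmd → ℕ × ℕ × ℕ
  | .set _ e => e.costDeg cls + (1, 0, 0)
  | .store a e => a.costDeg cls ⊔ e.costDeg cls + (1, 0, 0)
  | .seq c₁ c₂ => c₁.costDeg cls ⊔ c₂.costDeg cls + (1, 0, 0)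
  | .ite e c₁ c₂ => e.costDeg cls ⊔ (c₁.costDeg cls ⊔ c₂.costDeg cls) + (1, 0, 0)
  | .loop _ i c => cls i + c.costDeg cls + (1, 0, 0)

/-- All sums and loops in the command are limited by registers below `20`, and the command does
not change these registers. -/
def Cmd.limited : Cmd → Bool
  | .set x e => decide (20 ≤ x) && e.limited
  | .store a e => a.limited && e.limited
  | .seq c₁ c₂ => c₁.limited && c₂.limited
  | .ite e c₁ c₂ => e.limited && (c₁.limited && c₂.limited)
  | .loop x i c => decide (20 ≤ x) && (decide (i < 20) && c.limited)

theorem Cmd.limited.writes {c : Cmd} (h : c.limited = true) {r : ℕ} (hr : r < 20) :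
    c.writes r = false := by
  induction c with
  | set x e =>
    simp only [Cmd.limited, Bool.and_eq_true, decide_eq_true_eq] at h
    simp only [Cmd.writes, decide_eq_false_iff_not]; omega
  | store a e => rfl
  | seq c₁ c₂ ih₁ ih₂ =>
    simp only [Cmd.limited, Bool.and_eq_true] at h
    simp [Cmd.writes, ih₁ h.1, ih₂ h.2]
  | ite e c₁ c₂ ih₁ ih₂ =>
    simp only [Cmd.limited, Bool.and_eq_true] at h
    simp [Cmd.writes, ih₁ h.2.1, ih₂ h.2.2]
  | loop x i c ih =>
    simp only [Cmd.limited, Bool.and_eq_true, decide_eq_true_eq] at h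
    simp only [Cmd.writes, ih h.2.2, Bool.or_false, decide_eq_false_iff_not]; omega

section CostBound

variable {b : ℕ × ℕ × ℕ} {cls : ℕ → ℕ × ℕ × ℕ} (h1 : 16 ≤ b.1) (h2 : 1 ≤ b.2.1) (h3 : 1 ≤ b.2.2)
include h1 h2 h3

theorem Exp.cost_le {ρ : ℕ → ℕ} (hρ : ∀ r < 20, ρ r ≤ monomial b (cls r)) (e : Exp)
    (he : e.limited = true) : e.cost ρ ≤ monomial b (e.costDeg cls) := by
  have one := one_le_monomial h1 h2 h3
  have mono := fun {d d'} => @monomial_mono b h1 h2 h3 d d'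
  induction e with
  | lit v => exact one _
  | var i => exact one _
  | mem a ih =>
    refine le_monomial_succ h1 ?_
    have := ih he
    have := one (a.costDeg cls)
    simp only [cost]; omega
  | bin op a e iha ihe =>
    simp only [limited, Bool.and_eq_true] at he
    refine le_monomial_succ h1 ?_
    have := (iha he.1).trans (mono (le_sup_left : _ ≤ a.costDeg cls ⊔ e.costDeg cls))
    have := (ihe he.2).trans (mono (le_sup_right : _ ≤ a.costDeg cls ⊔ e.costDeg cls))
    have := one (a.costDeg cls ⊔ e.costDeg cls)
    simp only [cost]; omega
  | sum x i e ih =>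
    simp only [limited, Bool.and_eq_true, decide_eq_true_eq] at he
    refine le_monomial_succ h1 ?_
    have hc := ih he.2
    have hi := hρ i he.1
    have hC := one (e.costDeg cls)
    have hL := one (cls i)
    simp only [cost, monomial_add]
    have := Nat.mul_le_mul hi (show e.cost ρ + 5 ≤ 6 * monomial b (e.costDeg cls) by omega)
    have := Nat.mul_le_mul hL hC
    nlinarith

theorem Cmd.cost_le (c : Cmd) (hc : c.limited = true) : ∀ {σ : Store},
    (∀ r < 20, σ.reg r ≤ monomial b (cls r)) → c.cost σ ≤ monomial b (c.costDeg cls) := by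
  have one := one_le_monomial h1 h2 h3
  have mono := fun {d d'} => @monomial_mono b h1 h2 h3 d d'
  induction c with
  | set x e =>
    intro σ hσ
    simp only [limited, Bool.and_eq_true] at hc
    refine le_monomial_succ h1 ?_
    have := e.cost_le h1 h2 h3 hσ hc.2
    have := one (e.costDeg cls)
    simp only [cost]; omega
  | store a e =>
    intro σ hσ
    simp only [limited, Bool.and_eq_true] at hc
    refine le_monomial_succ h1 ?_
    have := (a.cost_le h1 h2 h3 hσ hc.1).trans
      (mono (le_sup_left : _ ≤ a.costDeg cls ⊔ e.costDeg cls))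
    have := (e.cost_le h1 h2 h3 hσ hc.2).trans
      (mono (le_sup_right : _ ≤ a.costDeg cls ⊔ e.costDeg cls))
    have := one (a.costDeg cls ⊔ e.costDeg cls)
    simp only [cost]; omega
  | seq c₁ c₂ ih₁ ih₂ =>
    intro σ hσ
    simp only [limited, Bool.and_eq_true] at hc
    refine le_monomial_succ h1 ?_
    have := (ih₁ hc.1 hσ).trans (mono (le_sup_left : _ ≤ c₁.costDeg cls ⊔ c₂.costDeg cls))
    have := (ih₂ hc.2 (σ := c₁.exec σ) fun r hr => by
      rw [exec_reg _ _ (limited.writes hc.1 hr)]; exact hσ r hr).trans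
      (mono (le_sup_right : _ ≤ c₁.costDeg cls ⊔ c₂.costDeg cls))
    simp only [cost]; omega
  | ite e c₁ c₂ ih₁ ih₂ =>
    intro σ hσ
    simp only [limited, Bool.and_eq_true] at hc
    refine le_monomial_succ h1 ?_
    set D := e.costDeg cls ⊔ (c₁.costDeg cls ⊔ c₂.costDeg cls)
    have := (e.cost_le h1 h2 h3 hσ hc.1).trans (mono (show e.costDeg cls ≤ D from le_sup_left))
    have := (ih₁ hc.2.1 hσ).trans
      (mono (show c₁.costDeg cls ≤ D from le_sup_left.trans le_sup_right))
    have := (ih₂ hc.2.2 hσ).trans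
      (mono (show c₂.costDeg cls ≤ D from le_sup_right.trans le_sup_right))
    have := one D
    simp only [cost]
    split_ifs <;> omega
  | loop x i c ih =>
    intro σ hσ
    simp only [limited, Bool.and_eq_true, decide_eq_true_eq] at hc
    refine le_monomial_succ h1 ?_
    have hi := hσ i hc.2.1
    have hC := one (c.costDeg cls)
    have hL := one (cls i)
    have hx : ∀ (τ : Store) (j r : ℕ), r < 20 → (τ.set x j).reg r = τ.reg r := by
      intro τ j r hr
      simp only [Store.set]
      rw [Function.update_of_ne (by omega)]
    have key : ∀ j r, r < 20 →
        (iterLoop (fun j τ => c.exec (τ.set x j)) j σ).reg r = σ.reg r := by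
      intro j r hr
      induction j with
      | zero => rfl
      | succ j ihj =>
        rw [iterLoop, exec_reg _ _ (limited.writes hc.2.2 hr), hx _ _ _ hr, ihj]
    have hsum : ∑ j ∈ Finset.range (σ.reg i),
        (c.cost ((iterLoop (fun j τ => c.exec (τ.set x j)) j σ).set x j) + 4) ≤
        σ.reg i * (5 * monomial b (c.costDeg cls)) := by
      have := Finset.sum_le_card_nsmul (Finset.range (σ.reg i)) (fun j =>
        c.cost ((iterLoop (fun j τ => c.exec (τ.set x j)) j σ).set x j) + 4)
        (5 * monomial b (c.costDeg cls)) (by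
          intro j _
          have := ih hc.2.2 (σ := (iterLoop (fun j τ => c.exec (τ.set x j)) j σ).set x j)
            (fun r hr => by rw [hx _ _ _ hr, key _ _ hr]; exact hσ r hr)
          show _ + 4 ≤ _
          omega)
      simpa using this
    simp only [cost, monomial_add]
    have := Nat.mul_le_mul_right (5 * monomial b (c.costDeg cls)) hi
    have := Nat.mul_le_mul hL hC
    nlinarith

end CostBound

end RAM

namespace FeatureSelection

open RAM

/-! ### The program -/

instance : Add Exp := ⟨.bin .add⟩
instance : Sub Exp := ⟨.bin .sub⟩
instance : Mul Exp := ⟨.bin .mul⟩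
instance : Div Exp := ⟨.bin .div⟩

/-- The expression with value `1` if `a ≤ b` and `0` otherwise. -/
def leE (a b : Exp) : Exp := .lit 1 - (a - b)

/-- The expression with value `1` if `a < b` and `0` otherwise. -/
def ltE (a b : Exp) : Exp := .lit 1 - (a + .lit 1 - b)

/-- The expression with value `1` if `a = b` and `0` otherwise. -/
def eqE (a b : Exp) : Exp := .lit 1 - ((a - b) + (b - a))

/-- The expression with value `1` if `a = 0` and `0` otherwise. -/
def notE (a : Exp) : Exp := .lit 1 - a

/-- The expression with value `0` if `a = 0` and `1` otherwise. -/
def posE (a : Exp) : Exp := notE (notE a)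

/-- The remainder of `a` modulo `b`. -/
def modE (a b : Exp) : Exp := a - a / b * b

/-- The name of the register holding the number `m` of rows. The constants of a run are held by the
registers below `20`, the other variables by the registers from `20` on. -/
abbrev rM : ℕ := 0
/-- The register holding the number `n` of columns. -/
abbrev rN : ℕ := 1
/-- The register holding the number `k` of clusters. -/
abbrev rk : ℕ := 2
/-- The register holding the budget `B`. -/
abbrev rB : ℕ := 3
/-- The register holding the size `s` of the alphabet. -/
abbrev rs : ℕ := 5
/-- The register holding the number `K = s ^ k` of row patterns. -/
abbrev rK : ℕ := 6
/-- The register holding the base `h` in which the structure of a solution is guessed. -/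
abbrev rh : ℕ := 7
/-- The register holding the number of digits of a structure guess. -/
abbrev rcnt : ℕ := 8
/-- The register holding the number of structure guesses. -/
abbrev rN1 : ℕ := 9
/-- The register holding the number of guesses of representative rows. -/
abbrev rN2 : ℕ := 10
/-- The register holding the number of steps granted to a tree search. -/
abbrev rfuel : ℕ := 11
/-- The register holding the address of the powers of `h`. -/
abbrev rpowh : ℕ := 12
/-- The register holding the address of the powers of `m`. -/
abbrev rpowm : ℕ := 13
/-- The register holding the address of the sequence of columns of the tree search. -/
abbrev rJ : ℕ := 14
/-- The register holding the address of the table of column labels. -/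
abbrev rlab : ℕ := 15
/-- The register holding `B + 1`. -/
abbrev rB1 : ℕ := 16
/-- The register holding the number of rows to be kept. -/
abbrev rq : ℕ := 17
/-- The register holding the address of the matrix. -/
abbrev rA : ℕ := 18
/-- The register holding the current structure guess. -/
abbrev rU1 : ℕ := 20
/-- The register holding the current guess of representative rows. -/
abbrev rU2 : ℕ := 21
/-- The counter of the loop over the columns. -/
abbrev rj : ℕ := 22
/-- The number of columns so far that match no cluster. -/
abbrev rv : ℕ := 23
/-- The current depth of the tree search. -/
abbrev re : ℕ := 24
/-- The counter of the steps of the tree search. -/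
abbrev rz : ℕ := 25
/-- The register that becomes `1` once a solution is found. -/
abbrev rans : ℕ := 26
/-- A register for short-lived values. -/
abbrev rtmp : ℕ := 27

/-- The digit of the structure guess with number `5 * t + c`. -/
def digE (c : ℕ) (t : Exp) : Exp :=
  modE (.var rU1 / .mem (.var rpowh + (.lit 5 * t + .lit c))) (.var rh)

/-- The representative row of the pattern `p`. -/
def repE (p : Exp) : Exp := modE (.var rU2 / .mem (.var rpowm + p)) (.var rM)

/-- The letter of the pattern `p` for the cluster `i`. -/
def patE (p i : Exp) : Exp := .mem (.lit 6 + modE (digE 0 (p * .var rk + i)) (.var rs))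

/-- The pattern of the slot `x`. -/
def slotE (x : Exp) : Exp := modE (digE 1 x) (.var rK)

/-- The incidence of the `i`-th column of the sequence with the slot `x`. -/
def incE (i x : Exp) : Exp := modE (digE 2 (i * .var rB + x)) (.lit 2)

/-- The matrix entry in row `y` and column `j`. -/
def entE (y j : Exp) : Exp := .mem (.var rA + (y * .var rN + j))

/-- The `i`-th column of the sequence. -/
def seqE (i : Exp) : Exp := .mem (.var rJ + i)

/-- The first cluster whose pattern letters agree with the entries of the representative rows in
the column `j`, or `k` if there is none. -/
def firstE (j : Exp) : Exp :=
  .sum 32 rk (notE (.sum 33 rk (leE (.var 33) (.var 32) *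
    notE (.sum 34 rK (notE (eqE (entE (repE (.var 34)) j) (patE (.var 34) (.var 33))))))))

/-- Whether the sequence of columns up to the current depth, inclusive, is admissible: each slot is
filled by a row near its representative that differs from it in the prescribed columns. -/
def validE : Exp :=
  notE (.sum 32 rB (notE (.sum 33 rM
    (leE (.sum 34 rN (notE (eqE (entE (.var 33) (.var 34))
        (entE (repE (slotE (.var 32))) (.var 34))))) (.var rB) *
      notE (.sum 35 rB (leE (.var 35) (.var re) * (incE (.var 35) (.var 32) *
        eqE (entE (.var 33) (seqE (.var 35)))
          (entE (repE (slotE (.var 32))) (seqE (.var 35))))))))))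

/-- The label of the column `j`: the table entry, unless the column occurs in the sequence. -/
def labelE (j : Exp) : Exp :=
  modE (notE (.sum 36 rB (ltE (.var 36) (.var re) * eqE (seqE (.var 36)) j)) *
      .mem (.var rlab + j) +
    .sum 36 rB (ltE (.var 36) (.var re) * (eqE (seqE (.var 36)) j * digE 3 (.var 36))))
    (.var rk)

/-- Whether the current labelling of the columns has cost at most `B` on sufficiently many rows. -/
def testE : Exp :=
  leE (.sum 32 rB1 (.var rq - .sum 33 rM (posE (.sum 34 rK (leE (.sum 35 rN
    (notE (eqE (entE (.var 33) (.var 35)) (patE (.var 34) (labelE (.var 35)))))) (.var 32))))))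
    (.var rB)

/-- One step of the depth-first search through the admissible sequences. -/
def searchStep : Cmd :=
  .seq (.set rtmp (seqE (.var re)))
    (.ite (ltE (.var rtmp) (.var rN))
      (.ite (ltE (.var re) (.var rB) * (ltE (.var re) (digE 3 (.var rB)) * validE))
        (.seq (.set re (.var re + .lit 1)) (.store (.var rJ + .var re) (.lit 0)))
        (.store (.var rJ + .var re) (.var rtmp + .lit 1)))
      (.seq (.set rans (posE (.var rans + testE)))
        (.seq (.set rtmp (posE (.var re)))
          (.seq (.set re (.var re - .lit 1))
            (.store (.var rJ + .var re) (seqE (.var re) + .var rtmp))))))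

/-- Computes the table entry of the column `rj`. Columns that match no cluster obtain the guessed
labels one after the other. -/
def labelStep : Cmd :=
  .seq (.set rtmp (firstE (.var rj)))
    (.seq (.store (.var rlab + .var rj) (ltE (.var rtmp) (.var rk) * .var rtmp +
        notE (ltE (.var rtmp) (.var rk)) * digE 4 (.var rv)))
      (.set rv (.var rv + notE (ltE (.var rtmp) (.var rk)) * ltE (.var rv) (.var rB))))

/-- Processes one guess: computes the table of labels and searches the tree. -/
def tryGuess : Cmd :=
  .seq (.set rv (.lit 0))
    (.seq (.loop rj rN labelStep)
      (.seq (.set re (.lit 0))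
        (.seq (.store (.var rJ + .lit 0) (.lit 0))
          (.loop rz rfuel searchStep))))

/-- Tries all guesses. -/
def tryAll : Cmd := .loop rU1 rN1 (.loop rU2 rN2 tryGuess)

/-- The register `i` is bounded by `X ^ α * Y ^ β * n ^ γ` where `(α, β, γ) = limitDeg i`. -/
def limitDeg : ℕ → ℕ × ℕ × ℕ
  | 0 => (0, 1, 0)
  | 1 => (0, 0, 1)
  | 10 => (0, 1, 0)
  | 11 => (1, 2, 1)
  | 12 => (1, 1, 1)
  | 13 => (1, 1, 1)
  | 14 => (1, 1, 1)
  | 15 => (1, 1, 1)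
  | 17 => (0, 1, 0)
  | _ => (1, 0, 0)

theorem tryAll_limited : tryAll.limited = true := by decide +kernel
/-- The running time of the search is quadratic in the number of columns: one factor `n` is due to
the number of steps of the tree search, the other one to the work for a single step. -/
theorem tryAll_costDeg : (tryAll.costDeg limitDeg).2.2 ≤ 2 := by decide +kernel

open Finset

/-! ### The tree search on admissible sequences of columns -/

/-- The parameters of an instance, with rows, columns and clusters numbered from `0`: the numbers
`m` of rows, `n` of columns, `k` of clusters and `q` of rows to be kept, the budget `B`, the number
`K` of row patterns, and the matrix. -/
structure Inst where
  m : ℕ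
  n : ℕ
  k : ℕ
  B : ℕ
  q : ℕ
  K : ℕ
  ent : ℕ → ℕ → ℕ

/-- A guess of the structure of a solution: representative rows and letters of the patterns, the
pattern of each slot, the incidences between the columns of a sequence and the slots, the labels
of the columns of the sequence, the labels of the columns that match no cluster, and the length of
the sequence. -/
structure Guess where
  rep : ℕ → ℕ
  pat : ℕ → ℕ → ℕ
  slot : ℕ → ℕ
  inc : ℕ → ℕ → ℕ
  lab : ℕ → ℕ
  vis : ℕ → ℕ
  depth : ℕ

variable (I : Inst) (G : Guess)

/-- The number of columns in which the row `y` differs from `v`. -/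
def Inst.mis (y : ℕ) (v : ℕ → ℕ) : ℕ := #{j ∈ range I.n | I.ent y j ≠ v j}

/-- The rows that can fill the slot `x`: rows near the representative of the slot that differ from
it in the prescribed columns. -/
def fillers (e : ℕ) (J : ℕ → ℕ) (x : ℕ) : Finset ℕ :=
  {y ∈ range I.m | I.mis y (I.ent (G.rep (G.slot x))) ≤ I.B ∧
    ∀ i < e, G.inc i x ≠ 0 → I.ent y (J i) ≠ I.ent (G.rep (G.slot x)) (J i)}

/-- The sequence `J 0, …, J (e - 1)` is admissible if every slot can be filled. -/
def Admissible (e : ℕ) (J : ℕ → ℕ) : Prop := ∀ x < I.B, (fillers I G e J x).Nonempty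

open scoped Classical in
/-- One step of the depth-first search. The last entry `J e` of a state `(e, J)` runs through all
the columns; the value `n` marks the end of the search below the sequence `J 0, …, J (e - 1)`. -/
noncomputable def searchNext (st : ℕ × (ℕ → ℕ)) : ℕ × (ℕ → ℕ) :=
  if st.2 st.1 < I.n then
    if st.1 < I.B ∧ st.1 < G.depth ∧ Admissible I G (st.1 + 1) st.2 then
      (st.1 + 1, Function.update st.2 (st.1 + 1) 0)
    else (st.1, Function.update st.2 st.1 (st.2 st.1 + 1))
  else (st.1 - 1,
    Function.update st.2 (st.1 - 1) (st.2 (st.1 - 1) + if 0 < st.1 then 1 else 0))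

variable {I G}

theorem fillers_congr {e : ℕ} {J J' : ℕ → ℕ} (h : ∀ i < e, J i = J' i) (x : ℕ) :
    fillers I G e J x = fillers I G e J' x := by
  unfold fillers
  refine filter_congr fun y _ => and_congr_right fun _ => forall₂_congr fun i hi => ?_
  rw [h i hi]

theorem Admissible.congr {e : ℕ} {J J' : ℕ → ℕ} (h : ∀ i < e, J i = J' i)
    (ha : Admissible I G e J) : Admissible I G e J' := fun x hx => by
  rw [← fillers_congr h]; exact ha x hx

theorem Admissible.mono {e e' : ℕ} {J : ℕ → ℕ} (h : e ≤ e') (ha : Admissible I G e' J) :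
    Admissible I G e J := fun x hx => by
  obtain ⟨y, hy⟩ := ha x hx
  simp only [fillers, mem_filter] at hy
  refine ⟨y, ?_⟩
  simp only [fillers, mem_filter]
  exact ⟨hy.1, hy.2.1, fun i hi => hy.2.2 i (by omega)⟩

variable (I G) in
/-- The weight of a sequence: the product of the numbers of fillers of the slots `x`, each raised
to the power `θ x`. It bounds the size of the search tree. -/
noncomputable def weight (θ : ℕ → ℝ) (e : ℕ) (J : ℕ → ℕ) : ℝ :=
  ∏ x ∈ range I.B, (#(fillers I G e J x) : ℝ) ^ θ x

variable {θ : ℕ → ℝ}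

theorem weight_congr {e : ℕ} {J J' : ℕ → ℕ} (h : ∀ i < e, J i = J' i) :
    weight I G θ e J = weight I G θ e J' := by
  unfold weight
  exact prod_congr rfl fun x _ => by rw [fillers_congr h]

theorem weight_nonneg (e : ℕ) (J : ℕ → ℕ) : 0 ≤ weight I G θ e J :=
  prod_nonneg fun _ _ => Real.rpow_nonneg (Nat.cast_nonneg _) _

theorem one_le_weight (hθ : ∀ x, 0 ≤ θ x) {e : ℕ} {J : ℕ → ℕ} (ha : Admissible I G e J) :
    1 ≤ weight I G θ e J := by
  unfold weight
  refine one_le_prod fun x hx => ?_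
  refine Real.one_le_rpow ?_ (hθ x)
  exact_mod_cast (ha x (mem_range.1 hx)).card_pos

theorem fillers_succ_of_inc {e c x : ℕ} {J : ℕ → ℕ} (hx : G.inc e x ≠ 0) :
    fillers I G (e + 1) (Function.update J e c) x =
      {y ∈ fillers I G e J x | I.ent y c ≠ I.ent (G.rep (G.slot x)) c} := by
  ext y
  simp only [fillers, mem_filter, and_assoc]
  refine and_congr_right fun _ => and_congr_right fun _ => ?_
  constructor
  · intro h
    refine ⟨fun i hi hix => ?_, ?_⟩
    · have := h i (by omega) hix
      rwa [Function.update_of_ne (by omega)] at this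
    · simpa using h e (by omega) hx
  · rintro ⟨h1, h2⟩ i hi hix
    by_cases hie : i = e
    · subst hie; simpa using h2
    · rw [Function.update_of_ne hie]
      exact h1 i (by omega) hix

theorem fillers_succ_of_not_inc {e c x : ℕ} {J : ℕ → ℕ} (hx : G.inc e x = 0) :
    fillers I G (e + 1) (Function.update J e c) x = fillers I G e J x := by
  ext y
  simp only [fillers, mem_filter]
  refine and_congr_right fun _ => and_congr_right fun _ => ?_
  constructor
  · intro h i hi hix
    have := h i (by omega) hix
    rwa [Function.update_of_ne (by omega)] at this
  · intro h i hi hix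
    by_cases hie : i = e
    · subst hie; exact absurd hx hix
    · rw [Function.update_of_ne hie]
      exact h i (by omega) hix

/-- The weights of the extensions of an admissible sequence by one column add up to at most `B`
times the weight of the sequence, if the slots that are incident with the new column have weights
`θ` of sum at least one. For a fixed column, the weight decreases by a product of powers of the
ratios by which the numbers of fillers decrease, and by the inequality of arithmetic and geometric
means this is at most an average of these ratios. A filler differs from its representative in at
most `B` columns, so that for each slot the ratios add up to at most `B` over all columns. -/
theorem sum_weight_le (hθ : ∀ x, 0 ≤ θ x) {e : ℕ} {J : ℕ → ℕ} (ha : Admissible I G e J)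
    (hcover : 1 ≤ ∑ x ∈ range I.B with G.inc e x ≠ 0, θ x) :
    ∑ c ∈ range I.n, weight I G θ (e + 1) (Function.update J e c) ≤ I.B * weight I G θ e J := by
  set F : Finset ℕ := {x ∈ range I.B | G.inc e x ≠ 0} with hF
  set Θ := ∑ x ∈ F, θ x with hΘ
  have hΘ0 : 0 < Θ := by linarith
  set ρ : ℕ → ℕ → ℝ := fun x c => (#(fillers I G (e + 1) (Function.update J e c) x) : ℝ) /
    #(fillers I G e J x) with hρ
  have hpos : ∀ x ∈ range I.B, (0 : ℝ) < #(fillers I G e J x) := fun x hx => by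
    exact_mod_cast (ha x (mem_range.1 hx)).card_pos
  have hρ0 : ∀ x c, 0 ≤ ρ x c := fun x c => by positivity
  have hρ1 : ∀ x ∈ F, ∀ c, ρ x c ≤ 1 := fun x hx c => by
    obtain ⟨hx1, hx2⟩ := mem_filter.1 hx
    refine (div_le_one (hpos x hx1)).2 ?_
    rw [fillers_succ_of_inc hx2]
    exact_mod_cast card_filter_le _ _
  have hstep : ∀ c, weight I G θ (e + 1) (Function.update J e c) ≤
      (∑ x ∈ F, θ x / Θ * ρ x c) * weight I G θ e J := by
    intro c
    have h1 : weight I G θ (e + 1) (Function.update J e c) =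
        (∏ x ∈ range I.B, ρ x c ^ θ x) * weight I G θ e J := by
      unfold weight
      rw [← prod_mul_distrib]
      refine prod_congr rfl fun x hx => ?_
      rw [← Real.mul_rpow (hρ0 x c) (Nat.cast_nonneg _), hρ,
        div_mul_cancel₀ _ (hpos x hx).ne']
    have h2 : ∏ x ∈ range I.B, ρ x c ^ θ x = ∏ x ∈ F, ρ x c ^ θ x := by
      rw [hF, prod_filter]
      refine prod_congr rfl fun x hx => ?_
      split_ifs with h
      · rfl
      · rw [not_not] at h
        simp only [hρ]
        rw [fillers_succ_of_not_inc h, div_self (hpos x hx).ne', Real.one_rpow]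
    have h3 : ∏ x ∈ F, ρ x c ^ θ x ≤ ∏ x ∈ F, ρ x c ^ (θ x / Θ) := by
      refine prod_le_prod (fun x _ => Real.rpow_nonneg (hρ0 x c) _) fun x hx => ?_
      rcases (hρ0 x c).eq_or_lt with h | h
      · rw [← h]
        rcases (hθ x).eq_or_lt with h' | h'
        · simp [← h']
        · rw [Real.zero_rpow h'.ne', Real.zero_rpow (div_pos h' hΘ0).ne']
      · exact Real.rpow_le_rpow_of_exponent_ge h (hρ1 x hx c) (div_le_self (hθ x) hcover)
    have h4 := Real.geom_mean_le_arith_mean_weighted F (fun x => θ x / Θ) (fun x => ρ x c)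
      (fun x _ => div_nonneg (hθ x) hΘ0.le) (by rw [← sum_div, div_self hΘ0.ne'])
      (fun x _ => hρ0 x c)
    rw [h1, h2]
    exact mul_le_mul_of_nonneg_right (h3.trans h4) (weight_nonneg _ _)
  have hsum : ∀ x ∈ F, ∑ c ∈ range I.n, ρ x c ≤ I.B := by
    intro x hx
    obtain ⟨hx1, hx2⟩ := mem_filter.1 hx
    simp only [hρ]
    rw [← sum_div, div_le_iff₀ (hpos x hx1)]
    have hcount : ∑ c ∈ range I.n, #(fillers I G (e + 1) (Function.update J e c) x) ≤
        I.B * #(fillers I G e J x) := by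
      calc ∑ c ∈ range I.n, #(fillers I G (e + 1) (Function.update J e c) x)
          = ∑ c ∈ range I.n, ∑ y ∈ fillers I G e J x,
              if I.ent y c ≠ I.ent (G.rep (G.slot x)) c then 1 else 0 := by
            refine sum_congr rfl fun c _ => ?_
            rw [fillers_succ_of_inc hx2, card_filter]
        _ = ∑ y ∈ fillers I G e J x, I.mis y (I.ent (G.rep (G.slot x))) := by
            rw [sum_comm]
            refine sum_congr rfl fun y _ => ?_
            rw [Inst.mis, card_filter]
        _ ≤ ∑ y ∈ fillers I G e J x, I.B :=
            sum_le_sum fun y hy => (mem_filter.1 hy).2.1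
        _ = I.B * #(fillers I G e J x) := by rw [sum_const, smul_eq_mul, mul_comm]
    exact_mod_cast hcount
  calc ∑ c ∈ range I.n, weight I G θ (e + 1) (Function.update J e c)
      ≤ ∑ c ∈ range I.n, (∑ x ∈ F, θ x / Θ * ρ x c) * weight I G θ e J :=
        sum_le_sum fun c _ => hstep c
    _ = (∑ x ∈ F, θ x / Θ * ∑ c ∈ range I.n, ρ x c) * weight I G θ e J := by
        rw [← sum_mul, sum_comm]
        simp_rw [mul_sum]
    _ ≤ (∑ x ∈ F, θ x / Θ * I.B) * weight I G θ e J := by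
        refine mul_le_mul_of_nonneg_right (sum_le_sum fun x hx => ?_) (weight_nonneg _ _)
        exact mul_le_mul_of_nonneg_left (hsum x hx) (div_nonneg (hθ x) hΘ0.le)
    _ = I.B * weight I G θ e J := by
        rw [← sum_mul, ← sum_div, div_self hΘ0.ne', one_mul]

/-- The search below an admissible sequence ends after a number of steps that is bounded in terms of
the weight of the sequence, and it visits all admissible extensions. -/
theorem search_subtree (hθ : ∀ x, 0 ≤ θ x)
    (hcover : ∀ e < G.depth, 1 ≤ ∑ x ∈ range I.B with G.inc e x ≠ 0, θ x) (hd : G.depth ≤ I.B)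
    (r : ℕ) : ∀ (e : ℕ) (J : ℕ → ℕ), e + r = G.depth → J e = 0 → Admissible I G e J →
      ∃ N : ℕ, (N : ℝ) + 1 ≤ (I.n + 1) * (I.B + 1) ^ r * weight I G θ e J ∧
        (∃ J', (searchNext I G)^[N] (e, J) = (e, J') ∧ J' e = I.n ∧ ∀ i < e, J' i = J i) ∧
        ∀ (d : ℕ) (T : ℕ → ℕ), e ≤ d → d ≤ G.depth → (∀ i < e, T i = J i) → (∀ i < d, T i < I.n) →
          Admissible I G d T → ∃ t ≤ N, ∃ J', (searchNext I G)^[t] (e, J) = (d, J') ∧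
            J' d = I.n ∧ ∀ i < d, J' i = T i := by
  induction r with
  | zero =>
    intro e J her hJ ha
    have key : ∀ c ≤ I.n, ∃ J', (searchNext I G)^[c] (e, J) = (e, J') ∧ J' e = c ∧
        ∀ i < e, J' i = J i := by
      intro c
      induction c with
      | zero => intro _; exact ⟨J, rfl, hJ, fun _ _ => rfl⟩
      | succ c ih =>
        intro hc
        obtain ⟨J', h1, h2, h3⟩ := ih (by omega)
        refine ⟨Function.update J' e (c + 1), ?_, by simp, fun i hi => ?_⟩
        · rw [Function.iterate_succ_apply', h1, searchNext]
          have : ¬ (e < I.B ∧ e < G.depth ∧ Admissible I G (e + 1) J') := by omega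
          simp only [h2, if_pos (show c < I.n by omega), if_neg this]
        · rw [Function.update_of_ne (by omega)]; exact h3 i hi
    obtain ⟨J', h1, h2, h3⟩ := key _ le_rfl
    refine ⟨I.n, ?_, ⟨J', h1, h2, h3⟩, ?_⟩
    · have := one_le_weight hθ ha
      have hn : (0 : ℝ) ≤ I.n := Nat.cast_nonneg _
      rw [pow_zero, mul_one]
      nlinarith
    · intro d T hed hdd hT _ _
      obtain rfl : d = e := by omega
      exact ⟨_, le_rfl, J', h1, h2, fun i hi => by rw [h3 i hi, hT i hi]⟩
  | succ r ih =>
    intro e J her hJ ha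
    set C : ℝ := (I.n + 1) * (I.B + 1) ^ r with hC
    have hC0 : 0 ≤ C := by positivity
    have key : ∀ c ≤ I.n, ∃ N : ℕ,
        (N : ℝ) ≤ c + C * ∑ v ∈ range c, weight I G θ (e + 1) (Function.update J e v) ∧
        (∃ J', (searchNext I G)^[N] (e, J) = (e, J') ∧ J' e = c ∧ ∀ i < e, J' i = J i) ∧
        ∀ (d : ℕ) (T : ℕ → ℕ), e < d → d ≤ G.depth → (∀ i < e, T i = J i) → T e < c →
          (∀ i < d, T i < I.n) → Admissible I G d T →
          ∃ t ≤ N, ∃ J', (searchNext I G)^[t] (e, J) = (d, J') ∧ J' d = I.n ∧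
            ∀ i < d, J' i = T i := by
      intro c
      induction c with
      | zero =>
        intro _
        exact ⟨0, by simp, ⟨J, rfl, hJ, fun _ _ => rfl⟩, fun d T _ _ _ h => absurd h (by omega)⟩
      | succ c ihc =>
        intro hc
        obtain ⟨N, hN, ⟨J', h1, h2, h3⟩, hvisit⟩ := ihc (by omega)
        have hJ' : ∀ i < e + 1, J' i = Function.update J e c i := by
          intro i hi
          by_cases hie : i = e
          · subst hie; simp [h2]
          · rw [Function.update_of_ne hie]; exact h3 i (by omega)
        have hw : 0 ≤ weight I G θ (e + 1) (Function.update J e c) := weight_nonneg _ _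
        by_cases hadm : Admissible I G (e + 1) J'
        · -- the child is searched: one step down, the subtree, and one step up
          obtain ⟨N', hN', ⟨J'', g1, g2, g3⟩, gvisit⟩ := ih (e + 1) (Function.update J' (e + 1) 0)
            (by omega) (by simp) (hadm.congr fun i hi => by
              rw [Function.update_of_ne (by omega)])
          have hcongr : ∀ i < e + 1, Function.update J' (e + 1) 0 i = Function.update J e c i :=
            fun i hi => by rw [Function.update_of_ne (by omega)]; exact hJ' i hi
          rw [weight_congr hcongr] at hN'
          have hdown : searchNext I G (e, J') = (e + 1, Function.update J' (e + 1) 0) := by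
            have hcond : e < I.B ∧ e < G.depth ∧ Admissible I G (e + 1) J' :=
              ⟨by omega, by omega, hadm⟩
            rw [searchNext]
            simp only [h2, if_pos (show c < I.n by omega), if_pos hcond]
          have hup : searchNext I G (e + 1, J'') = (e, Function.update J'' e (J'' e + 1)) := by
            rw [searchNext]
            simp [g2]
          have hJ''e : J'' e = c := by
            rw [g3 e (by omega), hcongr e (by omega)]; simp
          have hreach : (searchNext I G)^[N + 1] (e, J) =
              (e + 1, Function.update J' (e + 1) 0) := by
            rw [Function.iterate_succ_apply', h1, hdown]
          refine ⟨N + 1 + N' + 1, ?_, ⟨Function.update J'' e (c + 1), ?_, by simp, ?_⟩, ?_⟩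
          · rw [sum_range_succ]
            push_cast
            rw [mul_add]
            linarith
          · rw [Function.iterate_succ_apply', add_comm (N + 1) N', Function.iterate_add_apply,
              hreach, g1, hup, hJ''e]
          · intro i hi
            rw [Function.update_of_ne (by omega), g3 i (by omega), hcongr i (by omega),
              Function.update_of_ne (by omega)]
          · intro d T hed hdd hT hTe hTn hTa
            by_cases hTc : T e < c
            · obtain ⟨t, ht, h⟩ := hvisit d T hed hdd hT hTc hTn hTa
              exact ⟨t, by omega, h⟩
            · have hTc' : T e = c := by omega
              obtain ⟨t, ht, J3, k1, k2, k3⟩ := gvisit d T (by omega) hdd (fun i hi => by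
                rw [hcongr i hi]
                by_cases hie : i = e
                · subst hie; simp [hTc']
                · rw [Function.update_of_ne hie]; exact hT i (by omega)) hTn hTa
              refine ⟨t + (N + 1), by omega, J3, ?_, k2, k3⟩
              rw [Function.iterate_add_apply, hreach, k1]
        · refine ⟨N + 1, ?_, ⟨Function.update J' e (c + 1), ?_, by simp, ?_⟩, ?_⟩
          · rw [sum_range_succ]
            push_cast
            have := mul_nonneg hC0 hw
            rw [mul_add]
            linarith
          · rw [Function.iterate_succ_apply', h1, searchNext]
            simp only [h2, if_pos (show c < I.n by omega), hadm, and_false, if_false]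
          · intro i hi
            rw [Function.update_of_ne (by omega)]; exact h3 i hi
          · intro d T hed hdd hT hTe hTn hTa
            by_cases hTc : T e < c
            · obtain ⟨t, ht, h⟩ := hvisit d T hed hdd hT hTc hTn hTa
              exact ⟨t, by omega, h⟩
            · refine absurd ((hTa.mono hed).congr fun i hi => ?_) hadm
              rw [hJ' i hi]
              by_cases hie : i = e
              · subst hie; simp; omega
              · rw [Function.update_of_ne hie]; exact hT i (by omega)
    obtain ⟨N, hN, ⟨J', h1, h2, h3⟩, hvisit⟩ := key _ le_rfl
    refine ⟨N, ?_, ⟨J', h1, h2, h3⟩, ?_⟩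
    · have hw := one_le_weight hθ ha
      have hs := mul_le_mul_of_nonneg_left (sum_weight_le hθ ha (hcover e (by omega))) hC0
      have hn : (0 : ℝ) ≤ I.n := Nat.cast_nonneg _
      have hp : (1 : ℝ) ≤ (I.B + 1) ^ r :=
        one_le_pow₀ (by have : (0 : ℝ) ≤ I.B := Nat.cast_nonneg _; linarith)
      have h4 : (I.n + 1 : ℝ) ≤ C := by rw [hC]; nlinarith
      have h5 : (I.n + 1 : ℝ) ≤ C * weight I G θ e J := by nlinarith
      have h6 : ((I.n : ℝ) + 1) * (I.B + 1) ^ (r + 1) = C * (I.B + 1) := by rw [hC]; ring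
      rw [h6]
      nlinarith
    · intro d T hed hdd hT hTn hTa
      rcases hed.eq_or_lt with rfl | hlt
      · exact ⟨_, le_rfl, J', h1, h2, fun i hi => by rw [h3 i hi, hT i hi]⟩
      · exact hvisit d T hlt hdd hT (hTn e hlt) hTn hTa

/-! ### The labelling given by a guess and its acceptance -/

section Labelling

variable (I : Inst) (G : Guess)

/-- The pattern letters of the cluster `i` agree with the entries of the representative rows in
the column `j`. -/
def Matches (i j : ℕ) : Prop := ∀ p < I.K, I.ent (G.rep p) j = G.pat p i

open scoped Classical in
/-- The first cluster that matches the column `j`, or `k` if there is none. -/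
noncomputable def firstMatch (j : ℕ) : ℕ :=
  #{i ∈ range I.k | ∀ i' < I.k, i' ≤ i → ¬ Matches I G i' j}

/-- The number of columns before `j` that match no cluster, capped at `B`. -/
noncomputable def rank : ℕ → ℕ
  | 0 => 0
  | j + 1 => rank j + if firstMatch I G j < I.k then 0 else if rank j < I.B then 1 else 0

/-- The label of a column according to the representative rows, with guessed labels for the
columns that match no cluster. -/
noncomputable def baseLabel (j : ℕ) : ℕ :=
  if firstMatch I G j < I.k then firstMatch I G j else G.vis (rank I G j)

open scoped Classical in
/-- The label of a column after the corrections given by the sequence `J 0, …, J (e - 1)`. -/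
noncomputable def label (e : ℕ) (J lb : ℕ → ℕ) (j : ℕ) : ℕ :=
  if ∃ i < e, J i = j then (∑ i ∈ range e with J i = j, G.lab i) % I.k else lb j % I.k

/-- The labelling has cost at most `B` on some set of `q` rows. The summand for `t` is the number
of rows of cost greater than `t` among the `q` rows of the smallest costs. -/
def Accepts (e : ℕ) (J lb : ℕ → ℕ) : Prop :=
  ∑ t ∈ range (I.B + 1),
    (I.q - #{y ∈ range I.m | ∃ p < I.K, I.mis y (fun j => G.pat p (label I G e J lb j)) ≤ t}) ≤ I.B

/-- There are a labelling of the columns, a set of at least `q` rows and, for each of these rows,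
letters for all the labels such that the total cost is at most `B`. Labels may remain unused. -/
def Clusterable (S : Finset ℕ) : Prop :=
  ∃ L : ℕ → ℕ, (∀ j, L j < I.k) ∧ ∃ Q ⊆ range I.m, I.q ≤ #Q ∧ ∃ φ : ℕ → ℕ → ℕ,
    (∀ y i, φ y i ∈ S) ∧ ∑ y ∈ Q, I.mis y (fun j => φ y (L j)) ≤ I.B

variable {I G}

theorem firstMatch_spec {j : ℕ} (h : firstMatch I G j < I.k) :
    Matches I G (firstMatch I G j) j := by
  classical
  by_cases hex : ∃ i, i < I.k ∧ Matches I G i j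
  · have hfind := Nat.find_spec hex
    have : firstMatch I G j = Nat.find hex := by
      have hset : ({i ∈ range I.k | ∀ i' < I.k, i' ≤ i → ¬ Matches I G i' j} : Finset ℕ) =
          range (Nat.find hex) := by
        ext i
        simp only [mem_filter, mem_range]
        constructor
        · rintro ⟨_, h2⟩
          by_contra hlt
          exact h2 _ hfind.1 (by omega) hfind.2
        · intro hi
          exact ⟨hi.trans hfind.1, fun i' h1 h2 h3 => Nat.find_min hex (by omega) ⟨h1, h3⟩⟩
      rw [firstMatch, hset, card_range]
    rw [this]
    exact hfind.2
  · push Not at hex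
    have : firstMatch I G j = I.k := by
      rw [firstMatch, filter_true_of_mem fun i _ i' h _ => hex i' h, card_range]
    omega

theorem not_matches_of_firstMatch {j : ℕ} (h : ¬ firstMatch I G j < I.k) {i : ℕ} (hi : i < I.k) :
    ¬ Matches I G i j := by
  classical
  intro hm
  apply h
  rw [firstMatch]
  refine (card_lt_card (t := range I.k) ?_).trans_eq (card_range _)
  refine (filter_ssubset).2 ⟨i, mem_range.2 hi, fun hall => hall i hi le_rfl hm⟩

theorem rank_eq (j : ℕ) : rank I G j = min I.B (#{i ∈ range j | ¬ firstMatch I G i < I.k}) := by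
  induction j with
  | zero => simp [rank]
  | succ j ih =>
    rw [rank, range_add_one, filter_insert]
    by_cases h : firstMatch I G j < I.k
    · simp [h, ih]
    · rw [if_neg h, if_pos h, card_insert_of_notMem (by simp), ih]
      split_ifs <;> omega

theorem label_lt (hk : 1 ≤ I.k) (e : ℕ) (J lb : ℕ → ℕ) (j : ℕ) : label I G e J lb j < I.k := by
  unfold label
  split_ifs <;> exact Nat.mod_lt _ hk

theorem label_congr {e : ℕ} {J J' lb lb' : ℕ → ℕ} (hJ : ∀ i < e, J i = J' i) {j : ℕ}
    (hlb : lb j = lb' j) : label I G e J lb j = label I G e J' lb' j := by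
  classical
  unfold label
  have h1 : (∃ i < e, J i = j) ↔ ∃ i < e, J' i = j :=
    exists_congr fun i => and_congr_right fun hi => by rw [hJ i hi]
  have h2 : ({i ∈ range e | J i = j} : Finset ℕ) = {i ∈ range e | J' i = j} :=
    filter_congr fun i hi => by rw [hJ i (mem_range.1 hi)]
  rw [h2, hlb]
  simp only [h1]

theorem Inst.mis_congr {y : ℕ} {v v' : ℕ → ℕ} (h : ∀ j < I.n, v j = v' j) :
    I.mis y v = I.mis y v' := by
  unfold mis
  rw [filter_congr fun j hj => by rw [h j (mem_range.1 hj)]]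

theorem Accepts.congr {e : ℕ} {J J' lb lb' : ℕ → ℕ} (hJ : ∀ i < e, J i = J' i)
    (hlb : ∀ j < I.n, lb j = lb' j) (h : Accepts I G e J lb) : Accepts I G e J' lb' := by
  unfold Accepts at h ⊢
  convert h using 7 with t _ y
  refine and_congr_right fun _ => ?_
  rw [I.mis_congr fun j hj => ?_]
  rw [label_congr hJ (hlb j hj)]

theorem Inst.mis_self (y : ℕ) : I.mis y (I.ent y) = 0 := by simp [mis]

theorem Inst.mis_le_add (y y' : ℕ) (v : ℕ → ℕ) :
    I.mis y (I.ent y') ≤ I.mis y v + I.mis y' v := by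
  unfold mis
  refine (card_le_card fun j hj => ?_).trans (card_union_le _ _)
  simp only [mem_filter, mem_union] at hj ⊢
  by_contra hcon
  push Not at hcon
  exact hj.2 ((hcon.1 hj.1).trans (hcon.2 hj.1).symm)

/-- Every finite set has a subset of given size that consists of elements of smallest cost. -/
theorem exists_smallest (c : ℕ → ℕ) (X : Finset ℕ) (q : ℕ) (hq : q ≤ #X) :
    ∃ Q ⊆ X, #Q = q ∧ ∀ y ∈ Q, ∀ y' ∈ X \ Q, c y ≤ c y' := by
  induction q with
  | zero => exact ⟨∅, by simp, by simp, by simp⟩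
  | succ q ih =>
    obtain ⟨Q, hQX, hQ, hmin⟩ := ih (by omega)
    have hne : (X \ Q).Nonempty := by
      rw [← card_pos, card_sdiff_of_subset hQX]; omega
    obtain ⟨z, hz, hzmin⟩ := exists_min_image (X \ Q) c hne
    have hz' := mem_sdiff.1 hz
    refine ⟨insert z Q, insert_subset hz'.1 hQX, by rw [card_insert_of_notMem hz'.2, hQ], ?_⟩
    intro y hy y' hy'
    have hy'2 : y' ∈ X \ Q := by
      simp only [mem_sdiff, mem_insert, not_or] at hy' ⊢
      exact ⟨hy'.1, hy'.2.2⟩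
    rcases mem_insert.1 hy with rfl | h
    · exact hzmin y' hy'2
    · exact hmin y h y' hy'2

theorem sum_card_lt (Q : Finset ℕ) (c : ℕ → ℕ) (b : ℕ) :
    ∑ t ∈ range b, #{y ∈ Q | t < c y} = ∑ y ∈ Q, min b (c y) := by
  simp_rw [card_filter]
  rw [sum_comm]
  refine sum_congr rfl fun y _ => ?_
  rw [← card_filter]
  have : ({t ∈ range b | t < c y} : Finset ℕ) = range (min b (c y)) := by
    ext t; simp
  rw [this, card_range]

/-- An accepted labelling is a solution, whatever the guess was. -/
theorem Accepts.clusterable {S : Finset ℕ} (hk : 1 ≤ I.k) (hK : 1 ≤ I.K) (hq : I.q ≤ I.m)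
    (hpat : ∀ p i, i < I.k → p < I.K → G.pat p i ∈ S) (hS : S.Nonempty)
    {e : ℕ} {J lb : ℕ → ℕ} (h : Accepts I G e J lb) : Clusterable I S := by
  classical
  obtain ⟨s₀, hs₀⟩ := hS
  set L := label I G e J lb with hL
  have hLk : ∀ j, L j < I.k := label_lt hk e J lb
  have hp : ∀ y, ∃ p < I.K, ∀ p' < I.K, I.mis y (fun j => G.pat p (L j)) ≤
      I.mis y (fun j => G.pat p' (L j)) := by
    intro y
    obtain ⟨p, hp, hmin⟩ := exists_min_image (range I.K)
      (fun p => I.mis y (fun j => G.pat p (L j))) ⟨0, mem_range.2 hK⟩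
    exact ⟨p, mem_range.1 hp, fun p' hp' => hmin p' (mem_range.2 hp')⟩
  choose p hpK hpmin using hp
  set c : ℕ → ℕ := fun y => I.mis y (fun j => G.pat (p y) (L j)) with hc
  have hex : ∀ y t, (∃ p < I.K, I.mis y (fun j => G.pat p (L j)) ≤ t) ↔ c y ≤ t := fun y t =>
    ⟨fun ⟨p', h1, h2⟩ => (hpmin y p' h1).trans h2, fun h => ⟨p y, hpK y, h⟩⟩
  unfold Accepts at h
  simp only [← hL, hex] at h
  obtain ⟨Q, hQX, hQ, hmin⟩ := exists_smallest c (range I.m) I.q (by simpa using hq)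
  have hle : ∀ t, #{y ∈ Q | t < c y} ≤ I.q - #{y ∈ range I.m | c y ≤ t} := by
    intro t
    rcases ({y ∈ Q | t < c y} : Finset ℕ).eq_empty_or_nonempty with h0 | ⟨z, hz⟩
    · simp [h0]
    · obtain ⟨hz1, hz2⟩ := mem_filter.1 hz
      have hsub : ({y ∈ range I.m | c y ≤ t} : Finset ℕ) ⊆ {y ∈ Q | ¬ t < c y} := by
        intro y hy
        obtain ⟨hy1, hy2⟩ := mem_filter.1 hy
        refine mem_filter.2 ⟨?_, by omega⟩
        by_contra hyQ
        have := hmin z hz1 y (mem_sdiff.2 ⟨hy1, hyQ⟩)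
        omega
      have h1 := card_le_card hsub
      have h2 := card_filter_add_card_filter_not (s := Q) (fun y => t < c y)
      omega
  have hsum : ∑ y ∈ Q, min (I.B + 1) (c y) ≤ I.B := by
    rw [← sum_card_lt]
    exact (sum_le_sum fun t _ => hle t).trans h
  have hcB : ∀ y ∈ Q, min (I.B + 1) (c y) = c y := by
    intro y hy
    have := (single_le_sum (f := fun y => min (I.B + 1) (c y)) (fun _ _ => Nat.zero_le _) hy).trans
      hsum
    omega
  refine ⟨L, hLk, Q, hQX, hQ.ge, fun y i => if i < I.k then G.pat (p y) i else s₀, ?_, ?_⟩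
  · intro y i
    dsimp only
    split_ifs with hi
    · exact hpat _ _ hi (hpK y)
    · exact hs₀
  · refine le_trans (sum_le_sum fun y hy => ?_) hsum
    rw [hcB y hy, hc]
    exact (I.mis_congr fun j _ => by simp [hLk]).le

end Labelling

/-! ### The guess belonging to a solution -/

theorem exists_surjection {α : Type*} (P : Finset α) (hP : P.Nonempty) {K : ℕ} (hK : #P ≤ K) :
    ∃ π : ℕ → α, (∀ p, π p ∈ P) ∧ ∀ a ∈ P, ∃ p < K, π p = a := by
  classical
  obtain ⟨a₀, ha₀⟩ := hP
  refine ⟨fun p => if h : p < #P then (P.equivFin.symm ⟨p, h⟩ : α) else a₀, fun p => ?_, ?_⟩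
  · dsimp only
    split_ifs
    · exact Subtype.property _
    · exact ha₀
  · intro a ha
    refine ⟨P.equivFin ⟨a, ha⟩, (Fin.is_lt _).trans_le hK, ?_⟩
    simp

theorem exists_enumeration (X : Finset ℕ) :
    ∃ f : ℕ → ℕ, (range #X).image f = X ∧ Set.InjOn f (range #X) := by
  classical
  rcases X.eq_empty_or_nonempty with rfl | hX
  · exact ⟨id, by simp, by simp⟩
  · obtain ⟨f, h1, h2⟩ := exists_surjection X hX le_rfl
    have him : (range #X).image f = X := by
      ext a
      simp only [mem_image, mem_range]
      exact ⟨fun ⟨p, _, h⟩ => h ▸ h1 p, h2 a⟩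
    exact ⟨f, him, card_image_iff.1 (by rw [him, card_range])⟩

/-- Every solution gives rise to a guess that is accepted. The representative of a pattern is a row
of the pattern with the smallest cost among the rows that are kept; the sequence consists of the
columns for which the label of the solution is strictly better than the one given by the
representatives. For such a column, at least half of the rows of some pattern differ from the
representative of the pattern. The slots stand for the rows of the patterns for which
the representative has positive cost, and a slot for a row of a pattern with `c` rows has weight
`2 / c`. -/
theorem exists_guess (I : Inst) (S : Finset ℕ) (hK : I.K = #S ^ I.k) (hm : 1 ≤ I.m)
    (hS : S.Nonempty) (hk : 1 ≤ I.k) (h : Clusterable I S) :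
    ∃ (G : Guess) (θ : ℕ → ℝ) (T : ℕ → ℕ), (∀ p, G.rep p < I.m) ∧ (∀ p i, G.pat p i ∈ S) ∧
      (∀ x, G.slot x < I.K) ∧ (∀ i x, G.inc i x < 2) ∧ (∀ i, G.lab i < I.k) ∧
      (∀ t, G.vis t < I.k) ∧ G.depth ≤ I.B ∧ (∀ x, 0 ≤ θ x) ∧
      (∀ e < G.depth, 1 ≤ ∑ x ∈ range I.B with G.inc e x ≠ 0, θ x) ∧
      ∑ x ∈ range I.B, θ x ≤ 2 * I.K ∧ (∀ i < G.depth, T i < I.n) ∧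
      Admissible I G G.depth T ∧ Accepts I G G.depth T (baseLabel I G) := by
  classical
  have hK1 : 1 ≤ I.K := hK ▸ Nat.one_le_pow _ _ hS.card_pos
  obtain ⟨L, hL, Q, hQm, hqQ, φ₀, hφ₀, hcost₀⟩ := h
  obtain ⟨s₀, hs₀⟩ := hS
  rcases Nat.eq_zero_or_pos I.q with hq0 | hq
  · refine ⟨⟨fun _ => 0, fun _ _ => s₀, fun _ => 0, fun _ _ => 0, fun _ => 0, fun _ => 0, 0⟩,
      fun _ => 0, fun _ => 0, fun _ => hm, fun _ _ => hs₀, fun _ => hK1, fun _ _ => by simp,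
      fun _ => hk, fun _ => hk, Nat.zero_le _, fun _ => le_rfl, fun e he => absurd he (by simp),
      by simp, fun i hi => absurd hi (by simp), fun x _ => ⟨0, ?_⟩, ?_⟩
    · simp only [fillers, mem_filter, mem_range]
      exact ⟨hm, by rw [I.mis_self]; exact Nat.zero_le _, fun i hi => absurd hi (by simp)⟩
    · simp [Accepts, hq0]
  -- Letters of labels from `k` on are made equal, so that there are at most `K` patterns.
  set φ : ℕ → ℕ → ℕ := fun y i => if i < I.k then φ₀ y i else s₀ with hφdef
  have hφ : ∀ y i, φ y i ∈ S := by
    intro y i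
    simp only [hφdef]
    split_ifs
    · exact hφ₀ y i
    · exact hs₀
  set d : ℕ → ℕ := fun y => I.mis y (fun j => φ y (L j)) with hd
  have hcost : ∑ y ∈ Q, d y ≤ I.B := by
    refine le_trans (sum_le_sum fun y _ => ?_) hcost₀
    exact (I.mis_congr fun j _ => by simp [hφdef, hL]).le
  clear hcost₀
  set P : Finset (ℕ → ℕ) := Q.image φ with hP
  have hQne : Q.Nonempty := card_pos.1 (by omega)
  have hPne : P.Nonempty := hQne.image φ
  have hPK : #P ≤ I.K := by
    have hsub : P ⊆ (Fintype.piFinset fun _ : Fin I.k => S).image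
        (fun f i => if h : i < I.k then f ⟨i, h⟩ else s₀) := by
      intro a ha
      obtain ⟨y, _, rfl⟩ := mem_image.1 ha
      refine mem_image.2 ⟨fun i => φ₀ y i, by simp [Fintype.mem_piFinset, hφ₀], ?_⟩
      funext i
      simp [hφdef]
    refine (card_le_card hsub).trans (card_image_le.trans ?_)
    simp [Fintype.card_piFinset, hK]
  obtain ⟨π, hπP, hπsurj⟩ := exists_surjection P hPne hPK
  have hι : ∀ a, ∃ p, p < I.K ∧ (a ∈ P → π p = a) := by
    intro a
    by_cases ha : a ∈ P
    · obtain ⟨p, hp, h⟩ := hπsurj a ha; exact ⟨p, hp, fun _ => h⟩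
    · exact ⟨0, hK1, fun h => absurd h ha⟩
  choose ι hιK hι using hι
  have hφP : ∀ y ∈ Q, φ y ∈ P := fun y hy => mem_image_of_mem φ hy
  have hr : ∀ a, ∃ r, a ∈ P → r ∈ Q ∧ φ r = a ∧ ∀ y ∈ Q, φ y = a → d r ≤ d y := by
    intro a
    by_cases ha : a ∈ P
    · obtain ⟨y, hy, hya⟩ := mem_image.1 ha
      obtain ⟨r, hr, hmin⟩ := exists_min_image {y ∈ Q | φ y = a} d ⟨y, mem_filter.2 ⟨hy, hya⟩⟩
      obtain ⟨h1, h2⟩ := mem_filter.1 hr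
      exact ⟨r, fun _ => ⟨h1, h2, fun y hy hya => hmin y (mem_filter.2 ⟨hy, hya⟩)⟩⟩
    · exact ⟨0, fun h => absurd h ha⟩
  choose r hr using hr
  have hrinj : Set.InjOn r P := fun a ha b hb hab => by
    rw [← (hr a ha).2.1, ← (hr b hb).2.1, hab]
  set G₀ : Guess := ⟨fun p => r (π p), π, fun _ => 0, fun _ _ => 0, fun _ => 0, fun _ => 0, 0⟩
    with hG₀
  have hmatch : ∀ {i j}, Matches I G₀ i j ↔ ∀ a ∈ P, I.ent (r a) j = a i := by
    intro i j
    refine ⟨fun h a ha => ?_, fun h p _ => h (π p) (hπP p)⟩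
    obtain ⟨p, hp, rfl⟩ := hπsurj a ha
    exact h p hp
  set F : ℕ → ℕ := firstMatch I G₀ with hF
  -- the columns in which some representative has a mismatch
  set Bad : Finset ℕ := {j ∈ range I.n | ∃ a ∈ P, I.ent (r a) j ≠ a (L j)} with hBad
  have hBadB : #Bad ≤ I.B := by
    have h1 : Bad ⊆ P.biUnion fun a => {j ∈ range I.n | I.ent (r a) j ≠ a (L j)} := by
      intro j hj
      obtain ⟨hj1, a, ha, hj2⟩ := mem_filter.1 hj
      exact mem_biUnion.2 ⟨a, ha, mem_filter.2 ⟨hj1, hj2⟩⟩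
    calc #Bad ≤ ∑ a ∈ P, #{j ∈ range I.n | I.ent (r a) j ≠ a (L j)} :=
          (card_le_card h1).trans card_biUnion_le
      _ = ∑ a ∈ P, d (r a) := sum_congr rfl fun a ha => by
          simp only [hd, Inst.mis, (hr a ha).2.1]
      _ = ∑ y ∈ P.image r, d y := (sum_image hrinj).symm
      _ ≤ ∑ y ∈ Q, d y := sum_le_sum_of_subset fun y hy => by
          obtain ⟨a, ha, rfl⟩ := mem_image.1 hy; exact (hr a ha).1
      _ ≤ I.B := hcost
  have hvisBad : ∀ j < I.n, ¬ F j < I.k → j ∈ Bad := by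
    intro j hj hF
    have := not_matches_of_firstMatch hF (hL j)
    rw [hmatch] at this
    push Not at this
    exact mem_filter.2 ⟨mem_range.2 hj, this⟩
  set col : ℕ → ℕ → ℕ := fun j i => #{y ∈ Q | I.ent y j ≠ φ y i} with hcol
  have hcolsum : ∀ M : ℕ → ℕ, ∑ y ∈ Q, I.mis y (fun j => φ y (M j)) =
      ∑ j ∈ range I.n, col j (M j) := by
    intro M
    simp only [Inst.mis, hcol, card_filter]
    exact sum_comm
  have hcolP : ∀ j i, col j i = ∑ a ∈ P, #{y ∈ Q | φ y = a ∧ I.ent y j ≠ a i} := by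
    intro j i
    simp only [hcol]
    rw [card_eq_sum_card_fiberwise (f := φ) (t := P) fun y hy => hφP y (mem_filter.1 hy).1]
    refine sum_congr rfl fun a _ => ?_
    rw [filter_filter]
    congr 1
    refine filter_congr fun y _ => ⟨fun ⟨h1, h2⟩ => ⟨h2, h2 ▸ h1⟩, fun ⟨h1, h2⟩ => ⟨h1 ▸ h2, h1⟩⟩
  -- the columns whose label has to be corrected
  set Hid : Finset ℕ := {j ∈ range I.n | F j < I.k ∧ col j (L j) < col j (F j)} with hHid
  have hmaj : ∀ j, ∃ a, j ∈ Hid → a ∈ P ∧ I.ent (r a) j ≠ a (L j) ∧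
      #{y ∈ Q | φ y = a} ≤ 2 * #{y ∈ Q | φ y = a ∧ I.ent y j ≠ I.ent (r a) j} := by
    intro j
    by_cases hj : j ∈ Hid
    · obtain ⟨hjn, hjk, hjc⟩ := mem_filter.1 hj
      rw [hcolP, hcolP] at hjc
      obtain ⟨a, ha, hlt⟩ := exists_lt_of_sum_lt hjc
      have hent : I.ent (r a) j = a (F j) := hmatch.1 (firstMatch_spec hjk) a ha
      have hne : a (F j) ≠ a (L j) := fun he => by rw [he] at hlt; exact lt_irrefl _ hlt
      refine ⟨a, fun _ => ⟨ha, hent ▸ hne, ?_⟩⟩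
      rw [hent]
      -- rows that agree with the representative disagree with the solution
      have h1 : ({y ∈ Q | φ y = a} : Finset ℕ) ⊆ {y ∈ Q | φ y = a ∧ I.ent y j ≠ a (F j)} ∪
          {y ∈ Q | φ y = a ∧ I.ent y j ≠ a (L j)} := by
        intro y hy
        simp only [mem_union, mem_filter] at hy ⊢
        by_cases he : I.ent y j = a (F j)
        · exact Or.inr ⟨hy.1, hy.2, he ▸ hne⟩
        · exact Or.inl ⟨hy.1, hy.2, he⟩
      have h2 := (card_le_card h1).trans (card_union_le _ _)
      omega
    · exact ⟨fun _ => 0, fun h => absurd h hj⟩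
  choose maj hmaj using hmaj
  have hHidB : #Hid ≤ I.B := by
    refine (card_le_card fun j hj => ?_).trans hBadB
    exact mem_filter.2 ⟨(mem_filter.1 hj).1, _, (hmaj j hj).1, (hmaj j hj).2.1⟩
  -- the rows that become slots; each of them costs at least one in the solution
  set Y : Finset ℕ := {y ∈ Q | 1 ≤ d (r (φ y))} with hY
  have hYB : #Y ≤ I.B := by
    calc #Y = ∑ y ∈ Y, 1 := by simp
      _ ≤ ∑ y ∈ Y, d y := sum_le_sum fun y hy => by
          obtain ⟨h1, h2⟩ := mem_filter.1 hy
          exact h2.trans ((hr _ (hφP y h1)).2.2 y h1 rfl)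
      _ ≤ ∑ y ∈ Q, d y := sum_le_sum_of_subset (filter_subset _ _)
      _ ≤ I.B := hcost
  obtain ⟨T, hTim, hTinj⟩ := exists_enumeration Hid
  obtain ⟨ys, hyim, hyinj⟩ := exists_enumeration Y
  have hT : ∀ i < #Hid, T i ∈ Hid := fun i hi => hTim ▸ mem_image_of_mem T (mem_range.2 hi)
  have hys : ∀ x < #Y, ys x ∈ Y := fun x hx => hyim ▸ mem_image_of_mem ys (mem_range.2 hx)
  set Inc : ℕ → ℕ → Prop := fun j y => φ y = maj j ∧ I.ent y j ≠ I.ent (r (φ y)) j with hInc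
  set G : Guess := ⟨fun p => r (π p), π, fun x => ι (φ (ys x)),
    fun i x => if x < #Y ∧ Inc (T i) (ys x) then 1 else 0, fun i => L (T i),
    fun t => L (Nat.nth (fun j => ¬ F j < I.k) t), #Hid⟩ with hG
  have hrep : ∀ x < #Y, G.rep (G.slot x) = r (φ (ys x)) := by
    intro x hx
    simp only [hG]
    rw [hι _ (hφP _ (mem_filter.1 (hys x hx)).1)]
  have hinc : ∀ i x, G.inc i x ≠ 0 ↔ x < #Y ∧ Inc (T i) (ys x) := fun i x =>
    ite_ne_right_iff.trans (and_iff_left one_ne_zero)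
  set g : ℕ → ℝ := fun y => 2 / #{y' ∈ Q | φ y' = φ y} with hg
  have hg0 : ∀ y, 0 ≤ g y := fun y => div_nonneg zero_le_two (Nat.cast_nonneg _)
  set θ : ℕ → ℝ := fun x => if x < #Y then g (ys x) else 0 with hθ
  have hθ0 : ∀ x, 0 ≤ θ x := fun x => by
    simp only [hθ]; split_ifs
    · exact hg0 _
    · exact le_rfl
  refine ⟨G, θ, T, ?_, ?_, ?_, ?_, fun i => hL _, fun t => hL _, hHidB, hθ0, ?_, ?_, ?_, ?_, ?_⟩
  · exact fun p => mem_range.1 (hQm (hr _ (hπP p)).1)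
  · intro p i
    obtain ⟨y, _, hy⟩ := mem_image.1 (hπP p)
    show π p i ∈ S
    rw [← hy]
    exact hφ y i
  · exact fun x => hιK _
  · intro i x
    show (if _ then 1 else 0) < 2
    split_ifs
    · exact Nat.one_lt_two
    · exact Nat.two_pos
  · -- the slots incident with a column have total weight at least one
    intro e he
    have hj := hT e he
    obtain ⟨haP, hane, ha2⟩ := hmaj _ hj
    set a := maj (T e) with ha
    have hjn := (mem_filter.1 hj).1
    have h1 : ∑ x ∈ range #Y, (if Inc (T e) (ys x) then g (ys x) else 0) ≤
        ∑ x ∈ range I.B with G.inc e x ≠ 0, θ x := by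
      rw [sum_filter]
      refine le_trans (sum_le_sum fun x hx => ?_)
        (sum_le_sum_of_subset_of_nonneg (range_subset_range.2 hYB) fun x _ _ => ?_)
      · have hx' := mem_range.1 hx
        by_cases hI : Inc (T e) (ys x)
        · rw [if_pos hI, if_pos ((hinc e x).2 ⟨hx', hI⟩)]
          exact (if_pos hx').ge
        · rw [if_neg hI]
          split_ifs
          · exact hθ0 x
          · exact le_rfl
      · split_ifs
        · exact hθ0 x
        · exact le_rfl
    refine le_trans ?_ h1
    rw [← sum_image (f := fun y => if Inc (T e) y then g y else 0) hyinj, hyim, ← sum_filter]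
    have h2 : ({y ∈ Y | Inc (T e) y} : Finset ℕ) =
        {y ∈ Q | φ y = a ∧ I.ent y (T e) ≠ I.ent (r a) (T e)} := by
      ext y
      simp only [hY, hInc, mem_filter]
      constructor
      · rintro ⟨⟨h1, _⟩, h3, h4⟩
        rw [h3] at h4
        exact ⟨h1, h3, h4⟩
      · rintro ⟨h1, h3, h4⟩
        refine ⟨⟨h1, ?_⟩, h3, by rw [h3]; exact h4⟩
        rw [h3]
        refine card_pos.2 ⟨T e, mem_filter.2 ⟨hjn, ?_⟩⟩
        rw [(hr a haP).2.1]
        exact hane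
    rw [h2]
    have h3 : ∀ y ∈ ({y ∈ Q | φ y = a ∧ I.ent y (T e) ≠ I.ent (r a) (T e)} : Finset ℕ),
        g y = 2 / #{y' ∈ Q | φ y' = a} := fun y hy => by
      simp only [hg, (mem_filter.1 hy).2.1]
    have hpos : (0 : ℝ) < #{y' ∈ Q | φ y' = a} := by
      exact_mod_cast card_pos.2 ⟨r a, mem_filter.2 ⟨(hr a haP).1, (hr a haP).2.1⟩⟩
    rw [sum_congr rfl h3, sum_const, nsmul_eq_mul, ← mul_div_assoc, le_div_iff₀ hpos, one_mul]
    have : (#{y ∈ Q | φ y = a} : ℝ) ≤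
        2 * #{y ∈ Q | φ y = a ∧ I.ent y (T e) ≠ I.ent (r a) (T e)} := by exact_mod_cast ha2
    linarith
  · -- the weights of the slots of one pattern add up to at most two
    calc ∑ x ∈ range I.B, θ x = ∑ x ∈ range #Y, g (ys x) := by
          rw [← sum_subset (range_subset_range.2 hYB) fun x _ hx => by
            exact if_neg (mt mem_range.2 hx)]
          exact sum_congr rfl fun x hx => if_pos (mem_range.1 hx)
      _ = ∑ y ∈ Y, g y := by rw [← sum_image (f := g) hyinj, hyim]
      _ ≤ ∑ y ∈ Q, g y :=
          sum_le_sum_of_subset_of_nonneg (filter_subset _ _) fun y _ _ => hg0 y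
      _ = ∑ a ∈ P, ∑ y ∈ Q with φ y = a, g y := (sum_fiberwise_of_maps_to hφP g).symm
      _ = ∑ a ∈ P, 2 := by
          refine sum_congr rfl fun a ha => ?_
          have h3 : ∀ y ∈ ({y ∈ Q | φ y = a} : Finset ℕ), g y = 2 / #{y' ∈ Q | φ y' = a} :=
            fun y hy => by simp only [hg, (mem_filter.1 hy).2]
          have hpos : (0 : ℝ) < #{y' ∈ Q | φ y' = a} := by
            exact_mod_cast card_pos.2 ⟨r a, mem_filter.2 ⟨(hr a ha).1, (hr a ha).2.1⟩⟩
          rw [sum_congr rfl h3, sum_const, nsmul_eq_mul, mul_div_cancel₀ _ hpos.ne']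
      _ ≤ 2 * I.K := by
          rw [sum_const, nsmul_eq_mul, mul_comm]
          have : (#P : ℝ) ≤ I.K := by exact_mod_cast hPK
          linarith
  · exact fun i hi => mem_range.1 (mem_filter.1 (hT i hi)).1
  · intro x hx
    by_cases hxY : x < #Y
    · obtain ⟨h1, -⟩ := mem_filter.1 (hys x hxY)
      obtain ⟨h2, h3, h4⟩ := hr _ (hφP _ h1)
      refine ⟨ys x, mem_filter.2 ⟨hQm h1, ?_, ?_⟩⟩
      · rw [hrep x hxY]
        by_cases heq : ys x = r (φ (ys x))
        · rw [← heq, I.mis_self]; exact Nat.zero_le _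
        · refine (I.mis_le_add _ _ (fun j => φ (ys x) (L j))).trans ?_
          have hdr : I.mis (r (φ (ys x))) (fun j => φ (ys x) (L j)) = d (r (φ (ys x))) := by
            simp only [hd, h3]
          rw [hdr]
          have h5 : ∑ y ∈ {ys x, r (φ (ys x))}, d y ≤ ∑ y ∈ Q, d y :=
            sum_le_sum_of_subset (insert_subset h1 (singleton_subset_iff.2 h2))
          rw [sum_pair heq] at h5
          exact h5.trans hcost
      · intro i hi hix
        rw [hrep x hxY]
        exact ((hinc i x).1 hix).2.2
    · refine ⟨G.rep (G.slot x), mem_filter.2 ⟨hQm (hr _ (hπP _)).1, ?_, ?_⟩⟩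
      · rw [I.mis_self]; exact Nat.zero_le _
      · exact fun i hi hix => absurd ((hinc i x).1 hix).1 hxY
  · -- the final labelling costs at most as much as the solution
    set Lf := label I G G.depth T (baseLabel I G) with hLf
    have hFG : ∀ j, firstMatch I G j = F j := fun j => rfl
    have hLfcol : ∀ j < I.n, col j (Lf j) ≤ col j (L j) := by
      intro j hj
      by_cases hjH : j ∈ Hid
      · have hj' := hjH
        rw [← hTim] at hj'
        obtain ⟨i, hi, hij⟩ := mem_image.1 hj'
        have hsing : ({i' ∈ range G.depth | T i' = j} : Finset ℕ) = {i} := by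
          ext i'
          simp only [mem_filter, mem_singleton]
          exact ⟨fun ⟨h1, h2⟩ => hTinj h1 hi (h2.trans hij.symm), fun h => h ▸ ⟨hi, hij⟩⟩
        have : Lf j = L j := by
          rw [hLf, label, if_pos ⟨i, mem_range.1 hi, hij⟩, hsing, sum_singleton]
          show L (T i) % I.k = L j
          rw [hij, Nat.mod_eq_of_lt (hL j)]
        rw [this]
      · have hno : ¬ ∃ i < G.depth, T i = j := fun ⟨i, hi, hij⟩ => hjH (hij ▸ hT i hi)
        have hlab : Lf j = baseLabel I G j % I.k := by rw [hLf, label, if_neg hno]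
        by_cases hjF : F j < I.k
        · have : Lf j = F j := by
            rw [hlab, baseLabel, hFG, if_pos hjF, Nat.mod_eq_of_lt hjF]
          rw [this]
          by_contra hlt
          exact hjH (mem_filter.2 ⟨mem_range.2 hj, hjF, by omega⟩)
        -- all columns without a match are bad, hence the cap in `rank` is not effective
        · have hcount : #{i ∈ range j | ¬ F i < I.k} < I.B := by
            have hsub : insert j ({i ∈ range j | ¬ F i < I.k} : Finset ℕ) ⊆ Bad := by
              refine insert_subset (hvisBad j hj hjF) fun i hi => ?_
              obtain ⟨h1, h2⟩ := mem_filter.1 hi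
              exact hvisBad i ((mem_range.1 h1).trans hj) h2
            have := (card_le_card hsub).trans hBadB
            rw [card_insert_of_notMem (by simp)] at this
            omega
          have hrank : rank I G j = Nat.count (fun j => ¬ F j < I.k) j := by
            rw [rank_eq, Nat.count_eq_card_filter_range]
            exact min_eq_right hcount.le
          have : Lf j = L j := by
            rw [hlab, baseLabel, hFG, if_neg hjF, hrank]
            show L (Nat.nth (fun j => ¬ F j < I.k) (Nat.count (fun j => ¬ F j < I.k) j)) % I.k = _
            rw [Nat.nth_count hjF, Nat.mod_eq_of_lt (hL j)]
          rw [this]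
    have hfinal : ∑ y ∈ Q, I.mis y (fun j => φ y (Lf j)) ≤ I.B := by
      rw [hcolsum]
      refine le_trans (sum_le_sum fun j hj => hLfcol j (mem_range.1 hj)) ?_
      rw [← hcolsum]
      exact hcost
    set c : ℕ → ℕ := fun y => I.mis y (fun j => φ y (Lf j)) with hc
    have hstep : ∀ t, I.q - #{y ∈ range I.m | ∃ p < I.K,
        I.mis y (fun j => G.pat p (label I G G.depth T (baseLabel I G) j)) ≤ t} ≤
        #{y ∈ Q | t < c y} := by
      intro t
      have h1 : ({y ∈ Q | ¬ t < c y} : Finset ℕ) ⊆ {y ∈ range I.m | ∃ p < I.K,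
          I.mis y (fun j => G.pat p (label I G G.depth T (baseLabel I G) j)) ≤ t} := by
        intro y hy
        obtain ⟨h1, h2⟩ := mem_filter.1 hy
        refine mem_filter.2 ⟨hQm h1, ι (φ y), hιK _, ?_⟩
        show I.mis y (fun j => π (ι (φ y)) (Lf j)) ≤ t
        rw [hι _ (hφP y h1)]
        exact not_lt.1 h2
      have h2 := card_le_card h1
      have h3 := card_filter_add_card_filter_not (s := Q) (fun y => t < c y)
      omega
    unfold Accepts
    refine (sum_le_sum fun t _ => hstep t).trans ?_
    rw [sum_card_lt]
    exact (sum_le_sum fun y _ => min_le_right _ _).trans hfinal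

/-! ### Yes-instances and labellings -/

/-- An instance with rows and columns numbered from `0`. -/
def instOf {m n : ℕ} (S : Finset ℕ) (A : Matrix (Fin m) (Fin n) S) (k B l : ℕ) : Inst where
  m := m
  n := n
  k := k
  B := B
  q := m - l
  K := #S ^ k
  ent y j := if h : y < m ∧ j < n then A ⟨y, h.1⟩ ⟨j, h.2⟩ else 0

/-- A labelling of `n ≥ k` columns by `k` labels factors through a surjective labelling. -/
theorem exists_surjective_factor {n k : ℕ} (hkn : k ≤ n) (L : Fin n → Fin k) :
    ∃ (L' : Fin n → Fin k) (g : Fin k → Fin k), Function.Surjective L' ∧ ∀ j, L j = g (L' j) := by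
  classical
  rcases isEmpty_or_nonempty (Fin n) with hn | hne
  · obtain rfl : n = 0 := by
      by_contra h
      exact hn.false ⟨0, by omega⟩
    obtain rfl : k = 0 := by omega
    exact ⟨L, id, fun i => i.elim0, fun _ => rfl⟩
  · set X₀ : Finset (Fin n) := (univ.image L).image (Function.invFun L) with hX₀
    have hc : #X₀ ≤ k := card_image_le.trans ((card_le_univ _).trans_eq (Fintype.card_fin k))
    obtain ⟨X, hX₀X, hX⟩ := exists_superset_card_eq hc (by simpa using hkn)
    set b : X ≃ Fin k := X.equivFinOfCardEq hX
    have hmem : ∀ j, Function.invFun L (L j) ∈ X := fun j =>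
      hX₀X (mem_image_of_mem _ (mem_image_of_mem _ (mem_univ j)))
    refine ⟨fun j => if h : j ∈ X then b ⟨j, h⟩ else b ⟨_, hmem j⟩, fun i => L (b.symm i), ?_, ?_⟩
    · intro i
      exact ⟨b.symm i, by simp⟩
    · intro j
      dsimp only
      split_ifs with h
      · simp
      · simp only [Equiv.symm_apply_apply]
        exact (Function.invFun_eq ⟨j, rfl⟩).symm

variable {m n : ℕ} {S : Finset ℕ} {A : Matrix (Fin m) (Fin n) S} {k B l : ℕ}

/-- The cost of a labelling `L` with letters `ψ` on the rows outside `O`. -/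
def labellingCost (A : Matrix (Fin m) (Fin n) S) (O : Finset (Fin m)) (L : Fin n → Fin k)
    (ψ : Fin m → Fin k → S) : ℕ :=
  ∑ r ∈ Oᶜ, ∑ j, if A r j ≠ ψ r (L j) then 1 else 0

theorem sum_hammingDist_eq {O : Finset (Fin m)} {L : Fin n → Fin k} {ψ : Fin m → Fin k → S}
    {I : Fin k → Finset (Fin n)} {c : Fin k → ({r : Fin m // r ∉ O} → S)}
    (hI : ∀ i j, j ∈ I i ↔ L j = i) (hc : ∀ i r, c i r = ψ r.1 i) :
    ∑ i : Fin k, ∑ j ∈ I i, hammingDist (fun r : {r : Fin m // r ∉ O} => A r.1 j) (c i) =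
      labellingCost A O L ψ := by
  have h1 : ∀ i j, hammingDist (fun r : {r : Fin m // r ∉ O} => A r.1 j) (c i) =
      ∑ r ∈ Oᶜ, if A r j ≠ ψ r i then 1 else 0 := by
    intro i j
    rw [hammingDist, card_filter, sum_subtype Oᶜ (p := fun r => r ∉ O) (by simp)]
    exact sum_congr rfl fun r _ => by rw [hc]
  have h2 : ∀ i, I i = ({j | L j = i} : Finset (Fin n)) := fun i => by ext j; simp [hI]
  have h3 : ∀ i, ∑ j ∈ I i, hammingDist (fun r : {r : Fin m // r ∉ O} => A r.1 j) (c i) =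
      ∑ j, if L j = i then ∑ r ∈ Oᶜ, if A r j ≠ ψ r i then 1 else 0 else 0 := fun i => by
    rw [h2, sum_filter]
    exact sum_congr rfl fun j _ => if_congr Iff.rfl (h1 i j) rfl
  rw [sum_congr rfl fun i _ => h3 i]
  rw [sum_comm, labellingCost, sum_comm (s := Oᶜ)]
  refine sum_congr rfl fun j _ => ?_
  rw [sum_ite_eq]
  exact if_pos (mem_univ _)

/-- Clusters may be assumed to be nonempty if there are at least `k` columns, because splitting a
cluster does not increase the cost. -/
theorem isYes_iff_labellingCost (hS : S.Nonempty) :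
    IsYes S A k B l ↔ k ≤ n ∧ ∃ (O : Finset (Fin m)) (L : Fin n → Fin k) (ψ : Fin m → Fin k → S),
      #O ≤ l ∧ labellingCost A O L ψ ≤ B := by
  classical
  constructor
  · rintro ⟨O, hO, I, ⟨hne, hdis, hcov⟩, c, hcost⟩
    choose L hL using hcov
    have hI : ∀ i j, j ∈ I i ↔ L j = i := by
      intro i j
      refine ⟨fun h => ?_, fun h => h ▸ hL j⟩
      by_contra hcon
      exact disjoint_left.1 (hdis _ _ hcon) (hL j) h
    refine ⟨?_, O, L, fun r i => if h : r ∉ O then c i ⟨r, h⟩ else ⟨_, hS.choose_spec⟩, hO, ?_⟩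
    · choose j hj using hne
      have hinj : Function.Injective j := fun i i' h => by
        rw [← (hI i _).1 (hj i), ← (hI i' _).1 (hj i'), h]
      simpa using Fintype.card_le_of_injective j hinj
    · rwa [← sum_hammingDist_eq hI fun i r => by rw [dif_pos r.2]]
  · rintro ⟨hkn, O, L, ψ, hO, hcost⟩
    obtain ⟨L', g, hsurj, hfac⟩ := exists_surjective_factor hkn L
    refine ⟨O, hO, fun i => {j | L' j = i}, ⟨?_, ?_, ?_⟩, fun i r => ψ r.1 (g i), ?_⟩
    · intro i
      obtain ⟨j, hj⟩ := hsurj i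
      exact ⟨j, by simpa using hj⟩
    · intro i i' h
      rw [disjoint_left]
      intro j hj hj'
      simp only [mem_filter, mem_univ, true_and] at hj hj'
      exact h (hj.symm.trans hj')
    · exact fun j => ⟨L' j, by simp⟩
    · rw [sum_hammingDist_eq (L := L') (ψ := fun r i => ψ r (g i)) (by simp) fun i r => rfl]
      simpa only [labellingCost, hfac] using hcost

theorem mis_instOf (r : Fin m) (v : ℕ → ℕ) :
    (instOf S A k B l).mis r v = ∑ j : Fin n, if (A r j : ℕ) ≠ v j then 1 else 0 := by
  rw [Inst.mis, card_filter]
  show ∑ j ∈ range n, _ = _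
  rw [sum_range]
  refine sum_congr rfl fun j _ => ?_
  simp [instOf]

/-- The clusters may be empty in `Clusterable`: labels can be split as long as there are at least
`k` columns. -/
theorem isYes_iff (hS : S.Nonempty) (hk : 1 ≤ k) :
    IsYes S A k B l ↔ k ≤ n ∧ Clusterable (instOf S A k B l) S := by
  classical
  rw [isYes_iff_labellingCost hS]
  refine and_congr_right fun _ => ⟨?_, ?_⟩
  · rintro ⟨O, L, ψ, hO, hcost⟩
    refine ⟨fun j => if h : j < n then L ⟨j, h⟩ else 0, ?_, Oᶜ.map Fin.valEmbedding, ?_, ?_,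
      fun y i => if h : y < m ∧ i < k then ψ ⟨y, h.1⟩ ⟨i, h.2⟩ else hS.choose, ?_, ?_⟩
    · intro j
      dsimp only
      split_ifs
      · exact Fin.is_lt _
      · exact hk
    · intro y hy
      obtain ⟨r, _, rfl⟩ := mem_map.1 hy
      exact mem_range.2 r.is_lt
    · rw [card_map, card_compl, Fintype.card_fin]
      show m - l ≤ m - #O
      omega
    · intro y i
      dsimp only
      split_ifs
      · exact Subtype.property _
      · exact hS.choose_spec
    · rw [sum_map]
      refine le_of_eq_of_le (sum_congr rfl fun r _ => ?_) hcost
      rw [Fin.valEmbedding_apply, mis_instOf]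
      refine sum_congr rfl fun j _ => if_congr ?_ rfl rfl
      rw [ne_eq, ne_eq, Subtype.ext_iff]
      simp only [Fin.is_lt, and_self, dite_true, Fin.eta]
  · rintro ⟨L, hL, Q, hQ, hq, φ, hφ, hcost⟩
    refine ⟨({r | (r : ℕ) ∉ Q} : Finset (Fin m)), fun j => ⟨L j, hL j⟩,
      fun r i => ⟨φ r i, hφ r i⟩, ?_, ?_⟩
    · have h1 : (({r : Fin m | (r : ℕ) ∉ Q} : Finset (Fin m))ᶜ).map Fin.valEmbedding = Q := by
        ext y
        simp only [compl_filter, not_not, mem_map, mem_filter, mem_univ, true_and,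
          Fin.valEmbedding_apply]
        exact ⟨fun ⟨r, h1, h2⟩ => h2 ▸ h1, fun h => ⟨⟨y, mem_range.1 (hQ h)⟩, h, rfl⟩⟩
      have h2 : #(({r : Fin m | (r : ℕ) ∉ Q} : Finset (Fin m))ᶜ) = #Q := by
        rw [← card_map Fin.valEmbedding, h1]
      rw [card_compl, Fintype.card_fin] at h2
      have h3 := card_le_univ ({r : Fin m | (r : ℕ) ∉ Q} : Finset (Fin m))
      rw [Fintype.card_fin] at h3
      have h4 : m - l ≤ #Q := hq
      omega
    · refine le_trans (le_of_eq ?_) hcost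
      rw [labellingCost, compl_filter]
      simp only [not_not]
      have h1 : ({r : Fin m | (r : ℕ) ∈ Q} : Finset (Fin m)).map Fin.valEmbedding = Q := by
        ext y
        simp only [mem_map, mem_filter, mem_univ, true_and, Fin.valEmbedding_apply]
        exact ⟨fun ⟨r, h1, h2⟩ => h2 ▸ h1, fun h => ⟨⟨y, mem_range.1 (hQ h)⟩, h, rfl⟩⟩
      conv_rhs => rw [← h1]
      rw [sum_map]
      refine sum_congr rfl fun r _ => ?_
      rw [Fin.valEmbedding_apply, mis_instOf]
      refine sum_congr rfl fun j _ => if_congr ?_ rfl rfl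
      rw [ne_eq, ne_eq, Subtype.ext_iff]

/-! ### Values of the expressions of the program -/

section Eval

variable {ρ M : ℕ → ℕ} {a b : Exp}

theorem eval_add : (a + b).eval ρ M = a.eval ρ M + b.eval ρ M := rfl
theorem eval_sub : (a - b).eval ρ M = a.eval ρ M - b.eval ρ M := rfl
theorem eval_mul : (a * b).eval ρ M = a.eval ρ M * b.eval ρ M := rfl
theorem eval_div : (a / b).eval ρ M = a.eval ρ M / b.eval ρ M := rfl
theorem eval_lit {v : ℕ} : (Exp.lit v).eval ρ M = v := rfl
theorem eval_var {i : ℕ} : (Exp.var i).eval ρ M = ρ i := rfl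
theorem eval_mem : (Exp.mem a).eval ρ M = M (a.eval ρ M) := rfl
theorem eval_sum {x i : ℕ} : (Exp.sum x i b).eval ρ M =
    ∑ v ∈ range (ρ i), b.eval (Function.update ρ x v) M := rfl

theorem eval_leE : (leE a b).eval ρ M = if a.eval ρ M ≤ b.eval ρ M then 1 else 0 := by
  simp only [leE, eval_sub, eval_lit]; split_ifs <;> omega

theorem eval_ltE : (ltE a b).eval ρ M = if a.eval ρ M < b.eval ρ M then 1 else 0 := by
  simp only [ltE, eval_sub, eval_add, eval_lit]; split_ifs <;> omega

theorem eval_eqE : (eqE a b).eval ρ M = if a.eval ρ M = b.eval ρ M then 1 else 0 := by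
  simp only [eqE, eval_sub, eval_add, eval_lit]; split_ifs <;> omega

theorem eval_notE : (notE a).eval ρ M = if a.eval ρ M = 0 then 1 else 0 := by
  simp only [notE, eval_sub, eval_lit]; split_ifs <;> omega

theorem eval_posE : (posE a).eval ρ M = if a.eval ρ M = 0 then 0 else 1 := by
  simp only [posE, eval_notE]; split_ifs <;> omega

theorem eval_modE : (modE a b).eval ρ M = a.eval ρ M % b.eval ρ M := by
  simp only [modE, eval_sub, eval_mul, eval_div]
  rw [Nat.mod_eq_sub_mul_div, mul_comm]

theorem sum_ne_zero_iff_exists {N : ℕ} {f : ℕ → ℕ} :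
    ∑ v ∈ range N, f v ≠ 0 ↔ ∃ v < N, f v ≠ 0 := by
  simp [Finset.sum_eq_zero_iff]

end Eval

/-- The number of digits of each kind in a structure guess. -/
def Inst.digits (I : Inst) : ℕ := I.K * I.k + I.B * I.B + I.B + 1

/-- The base of the digits of a structure guess, for an alphabet of size `s`. -/
def Inst.base (I : Inst) (s : ℕ) : ℕ := I.K + I.k + s + I.B + 2

/-- The digit number `5 * t + c` of `U` in base `h`. -/
def digit (h U c t : ℕ) : ℕ := U / h ^ (5 * t + c) % h

/-- The guess with the structure digits `U₁` and the representative rows `U₂`. -/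
def guessOf (I : Inst) (s : ℕ) (letter : ℕ → ℕ) (U₁ U₂ : ℕ) : Guess where
  rep p := U₂ / I.m ^ p % I.m
  pat p i := letter (digit (I.base s) U₁ 0 (p * I.k + i) % s)
  slot x := digit (I.base s) U₁ 1 x % I.K
  inc i x := digit (I.base s) U₁ 2 (i * I.B + x) % 2
  lab i := digit (I.base s) U₁ 3 i
  vis t := digit (I.base s) U₁ 4 t
  depth := digit (I.base s) U₁ 3 I.B

/-- The number of structure guesses. -/
def Inst.guesses (I : Inst) (s : ℕ) : ℕ := I.base s ^ (5 * I.digits)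

/-- The registers below `20` hold the parameters of the instance `I` with an alphabet of `s`
letters, and the memory below the address in `rJ` holds the letters, the matrix and the tables of
powers. -/
structure Holds (I : Inst) (s : ℕ) (letter : ℕ → ℕ) (σ : Store) : Prop where
  reg_m : σ.reg rM = I.m
  reg_n : σ.reg rN = I.n
  reg_k : σ.reg rk = I.k
  reg_B : σ.reg rB = I.B
  reg_s : σ.reg rs = s
  reg_K : σ.reg rK = I.K
  reg_h : σ.reg rh = I.base s
  reg_B1 : σ.reg rB1 = I.B + 1
  reg_q : σ.reg rq = I.q
  reg_N1 : σ.reg rN1 = I.guesses s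
  reg_N2 : σ.reg rN2 = I.m ^ I.K
  reg_fuel : σ.reg rfuel = I.guesses s * I.m ^ I.K * I.m ^ I.K * I.n
  reg_A : σ.reg rA = 6 + s
  reg_powh : σ.reg rpowh = 6 + s + I.m * I.n
  reg_powm : σ.reg rpowm = 6 + s + I.m * I.n + 5 * I.digits
  reg_J : σ.reg rJ = 6 + s + I.m * I.n + 5 * I.digits + I.K
  reg_lab : σ.reg rlab = σ.reg rJ + I.B + 1
  mem_letter : ∀ i < s, σ.mem (6 + i) = letter i
  mem_ent : ∀ y < I.m, ∀ j < I.n, σ.mem (6 + s + (y * I.n + j)) = I.ent y j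
  mem_powh : ∀ t < 5 * I.digits, σ.mem (6 + s + I.m * I.n + t) = I.base s ^ t
  mem_powm : ∀ p < I.K, σ.mem (6 + s + I.m * I.n + 5 * I.digits + p) = I.m ^ p

section Holds

variable {I : Inst} {s : ℕ} {letter : ℕ → ℕ} {σ : Store}

theorem index_lt {M N y j : ℕ} (hy : y < M) (hj : j < N) : y * N + j < M * N := by
  calc y * N + j < y * N + N := by omega
    _ = (y + 1) * N := by ring
    _ ≤ M * N := Nat.mul_le_mul_right _ hy

theorem Holds.of_eq (h : Holds I s letter σ) {σ' : Store} (hr : ∀ r < 20, σ'.reg r = σ.reg r)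
    (hm : ∀ a < σ.reg rJ, σ'.mem a = σ.mem a) : Holds I s letter σ' := by
  have hJ := h.reg_J
  constructor
  · rw [hr _ (by decide), h.reg_m]
  · rw [hr _ (by decide), h.reg_n]
  · rw [hr _ (by decide), h.reg_k]
  · rw [hr _ (by decide), h.reg_B]
  · rw [hr _ (by decide), h.reg_s]
  · rw [hr _ (by decide), h.reg_K]
  · rw [hr _ (by decide), h.reg_h]
  · rw [hr _ (by decide), h.reg_B1]
  · rw [hr _ (by decide), h.reg_q]
  · rw [hr _ (by decide), h.reg_N1]
  · rw [hr _ (by decide), h.reg_N2]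
  · rw [hr _ (by decide), h.reg_fuel]
  · rw [hr _ (by decide), h.reg_A]
  · rw [hr _ (by decide), h.reg_powh]
  · rw [hr _ (by decide), h.reg_powm]
  · rw [hr _ (by decide), h.reg_J]
  · rw [hr _ (by decide), hr _ (by decide), h.reg_lab]
  · intro i hi
    rw [hm _ (by omega), h.mem_letter i hi]
  · intro y hy j hj
    have := index_lt hy hj
    rw [hm _ (by omega), h.mem_ent y hy j hj]
  · intro t ht
    rw [hm _ (by omega), h.mem_powh t ht]
  · intro p hp
    rw [hm _ (by omega), h.mem_powm p hp]

variable (hσ : Holds I s letter σ) {ρ : ℕ → ℕ} (hρ : ∀ r < 32, ρ r = σ.reg r)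
include hσ hρ

theorem Holds.eval_digE {c : ℕ} (hc : c < 5) {t : Exp} (ht : t.eval ρ σ.mem < I.digits) :
    (digE c t).eval ρ σ.mem = digit (I.base s) (σ.reg rU1) c (t.eval ρ σ.mem) := by
  simp only [digE, eval_modE, eval_div, eval_mem, eval_add, eval_mul, eval_var, eval_lit, digit]
  rw [hρ _ (by decide), hρ _ (by decide), hρ _ (by decide), hσ.reg_h, hσ.reg_powh,
    hσ.mem_powh _ (by omega)]

theorem Holds.eval_repE {p : Exp} (hp : p.eval ρ σ.mem < I.K) :
    (repE p).eval ρ σ.mem =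
      (guessOf I s letter (σ.reg rU1) (σ.reg rU2)).rep (p.eval ρ σ.mem) := by
  simp only [repE, eval_modE, eval_div, eval_mem, eval_add, eval_var, guessOf]
  rw [hρ _ (by decide), hρ _ (by decide), hρ _ (by decide), hσ.reg_m, hσ.reg_powm, hσ.mem_powm _ hp]

theorem Holds.eval_patE (hs : 1 ≤ s) {p i : Exp} (hp : p.eval ρ σ.mem < I.K)
    (hi : i.eval ρ σ.mem < I.k) : (patE p i).eval ρ σ.mem =
      (guessOf I s letter (σ.reg rU1) (σ.reg rU2)).pat (p.eval ρ σ.mem) (i.eval ρ σ.mem) := by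
  have hlt := index_lt hp hi
  have he : (p * Exp.var rk + i).eval ρ σ.mem =
      p.eval ρ σ.mem * I.k + i.eval ρ σ.mem := by
    simp only [eval_add, eval_mul, eval_var]
    rw [hρ _ (by decide), hσ.reg_k]
  simp only [patE, eval_mem, eval_add (a := Exp.lit 6), eval_modE, eval_lit, eval_var, guessOf]
  rw [hσ.eval_digE hρ (by decide) (by rw [he, Inst.digits]; omega), he, hρ _ (by decide), hσ.reg_s,
    hσ.mem_letter _ (Nat.mod_lt _ hs)]

theorem Holds.eval_slotE {x : Exp} (hx : x.eval ρ σ.mem < I.B) : (slotE x).eval ρ σ.mem =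
      (guessOf I s letter (σ.reg rU1) (σ.reg rU2)).slot (x.eval ρ σ.mem) := by
  simp only [slotE, eval_modE, eval_var, guessOf]
  rw [hσ.eval_digE hρ (by decide) (by rw [Inst.digits]; omega), hρ _ (by decide), hσ.reg_K]

theorem Holds.eval_incE {i x : Exp} (hi : i.eval ρ σ.mem < I.B) (hx : x.eval ρ σ.mem < I.B) :
    (incE i x).eval ρ σ.mem = (guessOf I s letter (σ.reg rU1) (σ.reg rU2)).inc
      (i.eval ρ σ.mem) (x.eval ρ σ.mem) := by
  have hlt := index_lt hi hx
  have he : (i * Exp.var rB + x).eval ρ σ.mem =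
      i.eval ρ σ.mem * I.B + x.eval ρ σ.mem := by
    simp only [eval_add, eval_mul, eval_var]
    rw [hρ _ (by decide), hσ.reg_B]
  simp only [incE, eval_modE, eval_lit, guessOf]
  rw [hσ.eval_digE hρ (by decide) (by rw [he, Inst.digits]; omega), he]

theorem Holds.eval_entE {y j : Exp} (hy : y.eval ρ σ.mem < I.m) (hj : j.eval ρ σ.mem < I.n) :
    (entE y j).eval ρ σ.mem = I.ent (y.eval ρ σ.mem) (j.eval ρ σ.mem) := by
  simp only [entE, eval_mem, eval_add, eval_mul, eval_var]
  rw [hρ _ (by decide), hρ _ (by decide), hσ.reg_A, hσ.reg_n, hσ.mem_ent _ hy _ hj]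

omit hσ in
theorem agree_update {x v : ℕ} (hx : 32 ≤ x) : ∀ r < 32, Function.update ρ x v r = σ.reg r :=
  fun r hr => by rw [Function.update_of_ne (by omega), hρ r hr]

end Holds

theorem guessOf_rep_lt {I : Inst} {s : ℕ} {letter : ℕ → ℕ} {U₁ U₂ : ℕ} (hm : 1 ≤ I.m) (p : ℕ) :
    (guessOf I s letter U₁ U₂).rep p < I.m := Nat.mod_lt _ hm

theorem guessOf_slot_lt {I : Inst} {s : ℕ} {letter : ℕ → ℕ} {U₁ U₂ : ℕ} (hK : 1 ≤ I.K) (x : ℕ) :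
    (guessOf I s letter U₁ U₂).slot x < I.K := Nat.mod_lt _ hK

section Model

variable {I : Inst} {s : ℕ} {letter : ℕ → ℕ} {σ : Store} (hσ : Holds I s letter σ)
  (hm : 1 ≤ I.m) (hK : 1 ≤ I.K) (hs : 1 ≤ s)
include hσ hm

include hs in
theorem Holds.eval_firstE (hj : σ.reg rj < I.n) : (firstE (.var rj)).eval σ.reg σ.mem =
    firstMatch I (guessOf I s letter (σ.reg rU1) (σ.reg rU2)) (σ.reg rj) := by
  classical
  rw [firstE, eval_sum, hσ.reg_k, firstMatch, card_filter]
  refine sum_congr rfl fun i _ => ?_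
  rw [eval_notE]
  refine if_congr ?_ rfl rfl
  rw [eval_sum, Finset.sum_eq_zero_iff, Function.update_of_ne (by decide), hσ.reg_k]
  simp only [mem_range]
  refine forall₂_congr fun i' hi' => ?_
  rw [eval_mul, eval_leE, eval_notE, mul_eq_zero, eval_var, eval_var, Function.update_self,
    Function.update_of_ne (by decide), Function.update_self]
  simp only [ite_eq_right_iff, one_ne_zero, imp_false]
  rw [← imp_iff_not_or]
  refine imp_congr_right fun _ => not_congr ?_
  rw [eval_sum, Finset.sum_eq_zero_iff]
  simp only [mem_range, eval_notE, eval_eqE]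
  have e1 : Function.update (Function.update σ.reg 32 i) 33 i' 6 = I.K := by
    rw [Function.update_of_ne (by decide), Function.update_of_ne (by decide), hσ.reg_K]
  rw [e1, Matches]
  refine forall₂_congr fun p hp => ?_
  have hag : ∀ r < 32, Function.update (Function.update (Function.update σ.reg 32 i) 33 i') 34 p r =
      σ.reg r :=
    agree_update (agree_update (agree_update (fun _ _ => rfl) le_rfl) (by decide)) (by decide)
  have e2 : (Exp.var 34).eval
      (Function.update (Function.update (Function.update σ.reg 32 i) 33 i') 34 p) σ.mem = p := by
    simp [eval_var]
  have e3 : (Exp.var 33).eval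
      (Function.update (Function.update (Function.update σ.reg 32 i) 33 i') 34 p) σ.mem = i' := by
    simp [eval_var]
  have e4 : (Exp.var rj).eval
      (Function.update (Function.update (Function.update σ.reg 32 i) 33 i') 34 p) σ.mem =
        σ.reg rj := hag _ (by decide)
  have e5 := hσ.eval_repE hag (p := .var 34) (by rw [e2]; exact hp)
  rw [hσ.eval_entE hag (by rw [e5]; exact guessOf_rep_lt hm _) (by rw [e4]; exact hj),
    hσ.eval_patE hag hs (by rw [e2]; exact hp) (by rw [e3]; exact hi'), e5, e2, e3, e4]
  simp

include hK in
theorem Holds.eval_validE {e : ℕ} {J : ℕ → ℕ} (he : σ.reg re = e) (heB : e < I.B)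
    (hJ : ∀ i ≤ I.B, σ.mem (σ.reg rJ + i) = J i) (hJn : ∀ i ≤ e, J i < I.n) :
    validE.eval σ.reg σ.mem ≠ 0 ↔
      Admissible I (guessOf I s letter (σ.reg rU1) (σ.reg rU2)) (e + 1) J := by
  classical
  set G := guessOf I s letter (σ.reg rU1) (σ.reg rU2) with hG
  have hnot : ∀ {a : Exp} {ρ M : ℕ → ℕ}, (notE a).eval ρ M ≠ 0 ↔ a.eval ρ M = 0 := by
    intro a ρ M; rw [eval_notE]; simp
  have hnot' : ∀ {a : Exp} {ρ M : ℕ → ℕ}, (notE a).eval ρ M = 0 ↔ a.eval ρ M ≠ 0 := by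
    intro a ρ M; rw [eval_notE]; simp
  rw [validE, hnot, eval_sum, Finset.sum_eq_zero_iff, hσ.reg_B]
  simp only [mem_range, hnot', eval_sum (x := 33), sum_ne_zero_iff_exists]
  refine forall₂_congr fun x hx => ?_
  have hag1 : ∀ r < 32, Function.update σ.reg 32 x r = σ.reg r :=
    agree_update (fun _ _ => rfl) le_rfl
  rw [hag1 _ (by decide), hσ.reg_m, Finset.Nonempty]
  refine exists_congr fun y => ?_
  simp only [fillers, mem_filter, mem_range]
  refine and_congr_right fun hy => ?_
  have hag2 : ∀ r < 32, Function.update (Function.update σ.reg 32 x) 33 y r = σ.reg r :=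
    agree_update hag1 (by decide)
  rw [eval_mul, mul_ne_zero_iff]
  -- the representative of the slot
  have hrep : ∀ ρ : ℕ → ℕ, (∀ r < 32, ρ r = σ.reg r) → ρ 32 = x →
      (repE (slotE (.var 32))).eval ρ σ.mem = G.rep (G.slot x) := by
    intro ρ hρ h32
    have e1 := hσ.eval_slotE hρ (x := .var 32) (by rw [eval_var, h32]; exact hx)
    rw [eval_var, h32] at e1
    rw [hσ.eval_repE hρ (by rw [e1]; exact guessOf_slot_lt hK _), e1]
  refine and_congr ?_ ?_
  · rw [eval_leE]
    simp only [ne_eq, ite_eq_right_iff, one_ne_zero, imp_false, not_not]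
    rw [eval_var, hag2 _ (by decide), hσ.reg_B, eval_sum, hag2 _ (by decide), hσ.reg_n, Inst.mis,
      card_filter]
    refine iff_of_eq (congrArg (· ≤ I.B) (sum_congr rfl fun j hj => ?_))
    have hj' := mem_range.1 hj
    have hag3 : ∀ r < 32, Function.update (Function.update (Function.update σ.reg 32 x) 33 y) 34 j r
        = σ.reg r := agree_update hag2 (by decide)
    have e1 := hrep _ hag3 (by simp)
    rw [eval_notE, eval_eqE,
      hσ.eval_entE hag3 (by simpa [eval_var] using hy) (by simpa [eval_var] using hj'),
      hσ.eval_entE hag3 (by rw [e1]; exact guessOf_rep_lt hm _) (by simpa [eval_var] using hj'), e1]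
    simp [eval_var]
  · rw [hnot, eval_sum, Finset.sum_eq_zero_iff, hag2 _ (by decide), hσ.reg_B]
    simp only [mem_range]
    have hiff : (∀ i < e + 1, G.inc i x ≠ 0 →
        I.ent y (J i) ≠ I.ent (G.rep (G.slot x)) (J i)) ↔ ∀ i < I.B, i ≤ e → G.inc i x ≠ 0 →
        I.ent y (J i) ≠ I.ent (G.rep (G.slot x)) (J i) :=
      ⟨fun h i _ hi => h i (by omega), fun h i hi => h i (by omega) (by omega)⟩
    rw [hiff]
    refine forall₂_congr fun i hi => ?_
    have hag3 : ∀ r < 32, Function.update (Function.update (Function.update σ.reg 32 x) 33 y) 35 i r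
        = σ.reg r := agree_update hag2 (by decide)
    rw [eval_mul, eval_mul, eval_leE, eval_var, eval_var, Function.update_self, hag3 _ (by decide),
      he]
    by_cases hie : i ≤ e
    · have e1 := hrep _ hag3 (by simp)
      have e2 : (seqE (.var 35)).eval
          (Function.update (Function.update (Function.update σ.reg 32 x) 33 y) 35 i) σ.mem = J i := by
        rw [seqE, eval_mem, eval_add, eval_var, eval_var, Function.update_self, hag3 _ (by decide),
          hJ i (by omega)]
      rw [eval_eqE, hσ.eval_incE hag3 (by simpa [eval_var] using hi) (by simpa [eval_var] using hx),
        hσ.eval_entE hag3 (by simpa [eval_var] using hy) (by rw [e2]; exact hJn i hie),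
        hσ.eval_entE hag3 (by rw [e1]; exact guessOf_rep_lt hm _) (by rw [e2]; exact hJn i hie),
        e1, e2]
      simp only [eval_var, Function.update_self, hie, if_true, one_mul, mul_eq_zero,
        ite_eq_right_iff, one_ne_zero, imp_false, forall_const,
        Function.update_of_ne (show (32 : ℕ) ≠ 35 by decide),
        Function.update_of_ne (show (32 : ℕ) ≠ 33 by decide),
        Function.update_of_ne (show (33 : ℕ) ≠ 35 by decide)]
      exact ⟨fun h hne => h.resolve_left hne, fun h => or_iff_not_imp_left.2 h⟩
    · simp [hie]

omit hm in
theorem Holds.eval_labelE {e : ℕ} {J lb : ℕ → ℕ} (he : σ.reg re = e) (heB : e ≤ I.B)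
    (hJ : ∀ i ≤ I.B, σ.mem (σ.reg rJ + i) = J i) (hlb : ∀ j < I.n, σ.mem (σ.reg rlab + j) = lb j)
    {ρ : ℕ → ℕ} (hρ : ∀ r < 32, ρ r = σ.reg r) (hj : ρ 35 < I.n) :
    (labelE (.var 35)).eval ρ σ.mem =
      label I (guessOf I s letter (σ.reg rU1) (σ.reg rU2)) e J lb (ρ 35) := by
  classical
  set j := ρ 35 with hj35
  have hag : ∀ i, ∀ r < 32, Function.update ρ 36 i r = σ.reg r := fun i =>
    agree_update hρ (by decide)
  have hseq : ∀ i ≤ I.B, (seqE (.var 36)).eval (Function.update ρ 36 i) σ.mem = J i := by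
    intro i hi
    rw [seqE, eval_mem, eval_add, eval_var, eval_var, Function.update_self, hag i _ (by decide),
      hJ i hi]
  have hj' : ∀ i, Function.update ρ 36 i 35 = j := fun i => by
    rw [Function.update_of_ne (by decide)]
  have h1 : (Exp.sum 36 rB (ltE (.var 36) (.var re) * eqE (seqE (.var 36)) (.var 35))).eval ρ
      σ.mem = #{i ∈ range e | J i = j} := by
    rw [eval_sum, hρ _ (by decide), hσ.reg_B, card_filter]
    rw [← sum_subset (range_subset_range.2 heB)]
    · refine sum_congr rfl fun i hi => ?_
      have hi' := mem_range.1 hi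
      rw [eval_mul, eval_ltE, eval_eqE, hseq i (by omega), eval_var, eval_var, eval_var,
        Function.update_self, hag i _ (by decide), he, if_pos hi', one_mul, hj']
    · intro i _ hi
      rw [eval_mul, eval_ltE, eval_var, eval_var, Function.update_self, hag i _ (by decide), he,
        if_neg (fun h => hi (mem_range.2 h)), zero_mul]
  have h2 : (Exp.sum 36 rB (ltE (.var 36) (.var re) *
      (eqE (seqE (.var 36)) (.var 35) * digE 3 (.var 36)))).eval ρ σ.mem =
      ∑ i ∈ range e with J i = j, (guessOf I s letter (σ.reg rU1) (σ.reg rU2)).lab i := by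
    rw [eval_sum, hρ _ (by decide), hσ.reg_B, sum_filter]
    rw [← sum_subset (range_subset_range.2 heB)]
    · refine sum_congr rfl fun i hi => ?_
      have hi' := mem_range.1 hi
      rw [eval_mul, eval_mul, eval_ltE, eval_eqE, hseq i (by omega), eval_var, eval_var, eval_var,
        Function.update_self, hag i _ (by decide), he, if_pos hi', one_mul, hj',
        hσ.eval_digE (hag i) (by decide) (by
          rw [eval_var, Function.update_self, Inst.digits]; omega), eval_var, Function.update_self]
      split_ifs
      · rw [one_mul]; rfl
      · rw [zero_mul]
    · intro i _ hi
      rw [eval_mul, eval_ltE, eval_var, eval_var, Function.update_self, hag i _ (by decide), he,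
        if_neg (fun h => hi (mem_range.2 h)), zero_mul]
  rw [labelE, eval_modE, eval_add, eval_mul, eval_notE, h1, h2, eval_mem, eval_add, eval_var,
    eval_var, eval_var, hρ rlab (by decide), hρ rk (by decide), hσ.reg_k, ← hj35, hlb j hj, label]
  by_cases hex : ∃ i < e, J i = j
  · obtain ⟨i, hi, hij⟩ := hex
    have hne : #{i ∈ range e | J i = j} ≠ 0 :=
      card_ne_zero_of_mem (mem_filter.2 ⟨mem_range.2 hi, hij⟩)
    rw [if_neg hne, if_pos ⟨i, hi, hij⟩, zero_mul, zero_add]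
  · have hemp : ({i ∈ range e | J i = j} : Finset ℕ) = ∅ :=
      filter_eq_empty_iff.2 fun i hi hij => hex ⟨i, mem_range.1 hi, hij⟩
    rw [if_neg hex, hemp]
    simp

omit hm in
include hs in
theorem Holds.eval_testE (hk : 1 ≤ I.k) {e : ℕ} {J lb : ℕ → ℕ} (he : σ.reg re = e)
    (heB : e ≤ I.B) (hJ : ∀ i ≤ I.B, σ.mem (σ.reg rJ + i) = J i)
    (hlb : ∀ j < I.n, σ.mem (σ.reg rlab + j) = lb j) :
    testE.eval σ.reg σ.mem ≠ 0 ↔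
      Accepts I (guessOf I s letter (σ.reg rU1) (σ.reg rU2)) e J lb := by
  classical
  set G := guessOf I s letter (σ.reg rU1) (σ.reg rU2) with hG
  rw [testE, eval_leE, eval_sum, eval_var, hσ.reg_B, hσ.reg_B1, Accepts]
  simp only [ne_eq, ite_eq_right_iff, one_ne_zero, imp_false, not_not]
  refine iff_of_eq (congrArg (· ≤ I.B) (sum_congr rfl fun t _ => ?_))
  have hag1 : ∀ r < 32, Function.update σ.reg 32 t r = σ.reg r :=
    agree_update (fun _ _ => rfl) le_rfl
  rw [eval_sub, eval_var, hag1 _ (by decide), hσ.reg_q, eval_sum, hag1 _ (by decide), hσ.reg_m,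
    card_filter]
  congr 1
  refine sum_congr rfl fun y hy => ?_
  have hy' := mem_range.1 hy
  have hag2 : ∀ r < 32, Function.update (Function.update σ.reg 32 t) 33 y r = σ.reg r :=
    agree_update hag1 (by decide)
  rw [eval_posE, ← ite_not]
  refine if_congr ?_ rfl rfl
  rw [← ne_eq, eval_sum, sum_ne_zero_iff_exists, hag2 _ (by decide), hσ.reg_K]
  refine exists_congr fun p => and_congr_right fun hp => ?_
  have hag3 : ∀ r < 32, Function.update (Function.update (Function.update σ.reg 32 t) 33 y) 34 p r
      = σ.reg r := agree_update hag2 (by decide)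
  rw [eval_leE]
  simp only [ne_eq, ite_eq_right_iff, one_ne_zero, imp_false, not_not]
  rw [eval_var, eval_sum, hag3 _ (by decide), hσ.reg_n, Inst.mis, card_filter]
  refine iff_of_eq ?_
  congr 1
  refine sum_congr rfl fun j hj => ?_
  have hj' := mem_range.1 hj
  set ρ := Function.update (Function.update (Function.update (Function.update σ.reg 32 t) 33 y)
    34 p) 35 j with hρ
  have hag4 : ∀ r < 32, ρ r = σ.reg r := agree_update hag3 (by decide)
  have e1 := hσ.eval_labelE he heB hJ hlb hag4 (by simpa [hρ] using hj')
  have hj35 : ρ 35 = j := by simp [hρ]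
  have hy33 : ρ 33 = y := by simp [hρ]
  have hp34 : ρ 34 = p := by simp [hρ]
  rw [hj35] at e1
  rw [eval_notE, eval_eqE, hσ.eval_entE hag4 (by rw [eval_var, hy33]; exact hy')
    (by rw [eval_var, hj35]; exact hj'), hσ.eval_patE hag4 hs (by rw [eval_var, hp34]; exact hp)
    (by rw [e1]; exact label_lt hk _ _ _ _), e1, eval_var, eval_var, eval_var, hj35, hy33, hp34]
  rw [← hG]
  split_ifs <;> simp_all

end Model

end FeatureSelection

namespace RAM

theorem Store.set_self (σ : Store) (x v : ℕ) : (σ.set x v).reg x = v := Function.update_self _ _ _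

theorem Store.set_of_ne (σ : Store) {r x : ℕ} (h : r ≠ x) (v : ℕ) :
    (σ.set x v).reg r = σ.reg r := Function.update_of_ne h _ _

/-- An invariant of a loop: it holds after the loop, and the loop is safe if its body is safe
whenever the invariant holds. -/
theorem Cmd.loop_spec {V x i : ℕ} {c : Cmd} {σ : Store} (p : ℕ → Store → Prop) (h0 : p 0 σ)
    (hs : ∀ j < σ.reg i, ∀ τ, p j τ → c.Safe V (τ.set x j) ∧ p (j + 1) (c.exec (τ.set x j))) :
    (Cmd.loop x i c).Safe V σ ∧
      ∃ τ, p (σ.reg i) τ ∧ (Cmd.loop x i c).exec σ = τ.set x (σ.reg i) := by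
  have key : ∀ j ≤ σ.reg i, p j (iterLoop (fun j τ => c.exec (τ.set x j)) j σ) := by
    intro j
    induction j with
    | zero => intro _; exact h0
    | succ j ih => intro hj; exact (hs j (by omega) _ (ih (by omega))).2
  exact ⟨fun j hj => (hs j hj _ (key j hj.le)).1, _, key _ le_rfl, rfl⟩

end RAM

namespace FeatureSelection

open Finset RAM

/-! ### Correctness of the search -/

/-- The store during the tree search: it holds the state `st` of the search and the table `lb` of
labels. -/
structure InSearch (I : Inst) (s : ℕ) (letter : ℕ → ℕ) (U₁ U₂ : ℕ) (lb : ℕ → ℕ)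
    (st : ℕ × (ℕ → ℕ)) (σ : Store) : Prop where
  holds : Holds I s letter σ
  reg_U₁ : σ.reg rU1 = U₁
  reg_U₂ : σ.reg rU2 = U₂
  reg_e : σ.reg re = st.1
  mem_J : ∀ i ≤ I.B, σ.mem (σ.reg rJ + i) = st.2 i
  mem_lab : ∀ j < I.n, σ.mem (σ.reg rlab + j) = lb j
  le_B : st.1 ≤ I.B
  lt_n : ∀ i < st.1, st.2 i < I.n
  le_n : st.2 st.1 ≤ I.n

section Search

variable {I : Inst} {s : ℕ} {letter : ℕ → ℕ} {U₁ U₂ : ℕ} {lb : ℕ → ℕ} {st : ℕ × (ℕ → ℕ)}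
  {σ σ' : Store}

theorem InSearch.of_reg (h : InSearch I s letter U₁ U₂ lb st σ)
    (hr : ∀ r < 25, σ'.reg r = σ.reg r) (hm : σ'.mem = σ.mem) :
    InSearch I s letter U₁ U₂ lb st σ' where
  holds := h.holds.of_eq (fun r hr' => hr r (by omega)) fun _ _ => by rw [hm]
  reg_U₁ := by rw [hr _ (by decide), h.reg_U₁]
  reg_U₂ := by rw [hr _ (by decide), h.reg_U₂]
  reg_e := by rw [hr _ (by decide), h.reg_e]
  mem_J i hi := by rw [hm, hr _ (by decide), h.mem_J i hi]
  mem_lab j hj := by rw [hm, hr _ (by decide), h.mem_lab j hj]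
  le_B := h.le_B
  lt_n := h.lt_n
  le_n := h.le_n

theorem InSearch.update (h : InSearch I s letter U₁ U₂ lb st σ) {d v : ℕ}
    (hr : ∀ r < 24, σ'.reg r = σ.reg r) (he : σ'.reg re = d)
    (hm : σ'.mem = Function.update σ.mem (σ.reg rJ + d) v) (hd : d ≤ I.B)
    (hlt : ∀ i < d, st.2 i < I.n) (hv : v ≤ I.n) :
    InSearch I s letter U₁ U₂ lb (d, Function.update st.2 d v) σ' where
  holds := h.holds.of_eq (fun r hr' => hr r (by omega)) fun a ha => by
    rw [hm, Function.update_of_ne (by omega)]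
  reg_U₁ := by rw [hr _ (by decide), h.reg_U₁]
  reg_U₂ := by rw [hr _ (by decide), h.reg_U₂]
  reg_e := he
  mem_J i hi := by
    change σ'.mem _ = Function.update st.2 d v i
    rw [hm, hr _ (by decide)]
    by_cases hid : i = d
    · subst hid; simp
    · rw [Function.update_of_ne (by omega), Function.update_of_ne hid, h.mem_J i hi]
  mem_lab j hj := by
    have := h.holds.reg_lab
    rw [hm, hr _ (by decide), Function.update_of_ne (by omega), h.mem_lab j hj]
  le_B := hd
  lt_n i hi := by
    have : i < d := hi
    simp only [Function.update_of_ne this.ne]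
    exact hlt i hi
  le_n := by simpa using hv

/-- A step of the program performs a step of `searchNext`. Whenever the columns at the current depth
are exhausted, the labelling that belongs to the current sequence is tested. -/
theorem searchStep_spec (hm : 1 ≤ I.m) (hK : 1 ≤ I.K) (hs : 1 ≤ s) (hk : 1 ≤ I.k) {V : ℕ}
    (hVn : I.n < V) (hVB : I.B < V) (hV : 1 < V) (h : InSearch I s letter U₁ U₂ lb st σ) :
    searchStep.Safe V σ ∧
    InSearch I s letter U₁ U₂ lb (searchNext I (guessOf I s letter U₁ U₂) st)
      (searchStep.exec σ) ∧
    ((searchStep.exec σ).reg rans ≠ 0 ↔ σ.reg rans ≠ 0 ∨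
      ¬ st.2 st.1 < I.n ∧ Accepts I (guessOf I s letter U₁ U₂) st.1 st.2 lb) := by
  obtain ⟨e, J⟩ := st
  have hseq : (seqE (.var re)).eval σ.reg σ.mem = J e := by
    rw [seqE, eval_mem, eval_add, eval_var, eval_var, h.reg_e, h.mem_J _ h.le_B]
  set σ₁ := σ.set rtmp (J e) with hσ₁
  have hr₁ : ∀ r, r ≠ 27 → σ₁.reg r = σ.reg r := fun r hr => Function.update_of_ne hr _ _
  have h₁ : InSearch I s letter U₁ U₂ lb (e, J) σ₁ := h.of_reg (fun r hr => hr₁ r (by omega)) rfl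
  have htmp : σ₁.reg rtmp = J e := by simp only [hσ₁, Store.set, Function.update_self]
  have hle : J e ≤ I.n := h.le_n
  have heB : e ≤ I.B := h.le_B
  simp only [searchStep, Cmd.exec, Cmd.Safe, hseq, ← hσ₁]
  rw [eval_ltE, eval_var, eval_var, htmp, h₁.holds.reg_n]
  by_cases hJ : J e < I.n
  · simp only [zero_lt_one, if_true, hJ, not_true_eq_false, false_and, or_false]
    have hdig : I.B < I.digits := by rw [Inst.digits]; omega
    have hcond : 0 < (ltE (.var re) (.var rB) * (ltE (.var re) (digE 3 (.var rB)) *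
        validE)).eval σ₁.reg σ₁.mem ↔ e < I.B ∧ e < (guessOf I s letter U₁ U₂).depth ∧
          Admissible I (guessOf I s letter U₁ U₂) (e + 1) J := by
      rw [eval_mul, eval_mul, eval_ltE, eval_ltE, Nat.pos_iff_ne_zero, mul_ne_zero_iff,
        mul_ne_zero_iff, h₁.holds.eval_digE (fun _ _ => rfl) (by decide)
          (by rw [eval_var, h₁.holds.reg_B]; exact hdig),
        eval_var, eval_var, h₁.holds.reg_B, h₁.reg_e, h₁.reg_U₁]
      simp only [ne_eq, ite_eq_right_iff, one_ne_zero, imp_false, not_not]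
      refine and_congr_right fun hlt => and_congr_right fun _ => ?_
      have := h₁.holds.eval_validE hm hK h₁.reg_e hlt h₁.mem_J (fun i hi => by
        rcases Nat.lt_or_ge i e with h' | h'
        · exact h.lt_n i h'
        · obtain rfl : i = e := by omega
          exact hJ)
      rw [h₁.reg_U₁, h₁.reg_U₂] at this
      exact this
    simp only [searchNext, hJ, if_true]
    by_cases hc : e < I.B ∧ e < (guessOf I s letter U₁ U₂).depth ∧
        Admissible I (guessOf I s letter U₁ U₂) (e + 1) J
    · simp only [if_pos hc, if_pos (hcond.2 hc), eval_add, eval_lit, eval_var]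
      have h1 : σ₁.reg re = e := h₁.reg_e
      refine ⟨⟨by omega, by omega, by omega⟩, ?_, ?_⟩
      · refine h.update (fun r hr => ?_) ?_ ?_ hc.1 ?_ (by omega)
        · simp only [Store.set]
          rw [Function.update_of_ne (show r ≠ 24 by omega), hr₁ r (by omega)]
        · simp only [Store.set, Function.update_self, h1]
        · simp only [Store.set, Function.update_self, h1]
          rw [Function.update_of_ne (by decide), hr₁ rJ (by decide)]
          rfl
        · intro i hi
          rcases Nat.lt_or_ge i e with h' | h'
          · exact h.lt_n i h'
          · obtain rfl : i = e := by omega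
            exact hJ
      · simp only [Store.set]
        rw [Function.update_of_ne (by decide), hr₁ rans (by decide)]
    · simp only [if_neg hc, if_neg (fun h' => hc (hcond.1 h')), eval_add, eval_lit, eval_var, htmp]
      refine ⟨⟨by omega, by omega⟩, ?_, ?_⟩
      · refine h.update (fun r hr => hr₁ r (by omega)) h₁.reg_e ?_ heB h.lt_n (by omega)
        rw [hr₁ rJ (by decide), h₁.reg_e]
        rfl
      · rw [hr₁ rans (by decide)]
  · simp only [if_neg hJ, lt_irrefl, if_false, searchNext]
    have htest := h₁.holds.eval_testE hs hk h₁.reg_e heB h₁.mem_J h₁.mem_lab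
    rw [h₁.reg_U₁, h₁.reg_U₂] at htest
    set w := (posE (.var rans + testE)).eval σ₁.reg σ₁.mem with hw
    have hwans : w ≠ 0 ↔ σ.reg rans ≠ 0 ∨ Accepts I (guessOf I s letter U₁ U₂) e J lb := by
      rw [hw, eval_posE, eval_add, eval_var, hr₁ rans (by decide), ← htest]
      by_cases h1 : σ.reg rans = 0 <;> simp [h1]
    have hw1 : w ≤ 1 := by
      rw [hw, eval_posE]; split_ifs <;> omega
    set σ₂ := σ₁.set rans w with hσ₂
    have hr₂ : ∀ r, r ≠ 26 → σ₂.reg r = σ₁.reg r := fun r hr => Function.update_of_ne hr _ _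
    have hpos : (posE (.var re)).eval σ₂.reg σ₂.mem = if 0 < e then 1 else 0 := by
      rw [eval_posE, eval_var, hr₂ re (by decide), h₁.reg_e]
      split_ifs <;> omega
    rw [hpos]
    set w' := if 0 < e then 1 else 0 with hw'
    have hw'1 : w' ≤ 1 := by rw [hw']; split_ifs <;> omega
    have hsub : (.var re - .lit 1 : Exp).eval (σ₂.set rtmp w').reg (σ₂.set rtmp w').mem =
        e - 1 := by
      rw [eval_sub, eval_var, eval_lit]
      simp only [Store.set]
      rw [Function.update_of_ne (by decide), hr₂ re (by decide), h₁.reg_e]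
    rw [hsub]
    set σ₃ := (σ₂.set rtmp w').set re (e - 1) with hσ₃
    have hr₃ : ∀ r, r ≠ 24 → r ≠ 26 → r ≠ 27 → σ₃.reg r = σ.reg r := by
      intro r a b c
      simp only [hσ₃, Store.set]
      rw [Function.update_of_ne a, Function.update_of_ne c, hr₂ r b, hr₁ r c]
    have he₃ : σ₃.reg re = e - 1 := by simp only [hσ₃, Store.set, Function.update_self]
    have ht₃ : σ₃.reg rtmp = w' := by
      simp only [hσ₃, Store.set]
      rw [Function.update_of_ne (by decide), Function.update_self]
    have hm₃ : σ₃.mem = σ.mem := rfl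
    have hval : (seqE (.var re) + .var rtmp).eval σ₃.reg σ₃.mem = J (e - 1) + w' := by
      rw [eval_add, seqE, eval_mem, eval_add, eval_var, eval_var, eval_var, he₃, ht₃,
        hr₃ rJ (by decide) (by decide) (by decide), hm₃, h.mem_J _ (by omega)]
    have hadr : (.var rJ + .var re : Exp).eval σ₃.reg σ₃.mem = σ.reg rJ + (e - 1) := by
      rw [eval_add, eval_var, eval_var, he₃, hr₃ rJ (by decide) (by decide) (by decide)]
    rw [hval, hadr]
    have hle' : J (e - 1) + w' ≤ I.n := by
      rw [hw']
      split_ifs with h0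
      · exact h.lt_n (e - 1) (show e - 1 < e by omega)
      · obtain rfl : e = 0 := by omega
        exact hle
    refine ⟨⟨by omega, by omega, by omega, by omega, by omega⟩, ?_, ?_⟩
    · refine h.update (fun r hr => hr₃ r (by omega) (by omega) (by omega)) he₃ rfl (by omega) ?_
        hle'
      intro i hi
      exact h.lt_n i (show i < e by omega)
    · rw [and_iff_right hJ, ← hwans]
      simp only [hσ₃, Store.set]
      rw [Function.update_of_ne (by decide), Function.update_of_ne (by decide), hσ₂]
      simp only [Store.set, Function.update_self]

theorem searchLoop_spec (hm : 1 ≤ I.m) (hK : 1 ≤ I.K) (hs : 1 ≤ s) (hk : 1 ≤ I.k) {V : ℕ}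
    (hVn : I.n < V) (hVB : I.B < V) (hV : 1 < V) (h : InSearch I s letter U₁ U₂ lb st σ) :
    (Cmd.loop rz rfuel searchStep).Safe V σ ∧
    InSearch I s letter U₁ U₂ lb ((searchNext I (guessOf I s letter U₁ U₂))^[σ.reg rfuel] st)
      ((Cmd.loop rz rfuel searchStep).exec σ) ∧
    (((Cmd.loop rz rfuel searchStep).exec σ).reg rans ≠ 0 ↔ σ.reg rans ≠ 0 ∨
      ∃ t < σ.reg rfuel, ∃ d J, (searchNext I (guessOf I s letter U₁ U₂))^[t] st = (d, J) ∧
        ¬ J d < I.n ∧ Accepts I (guessOf I s letter U₁ U₂) d J lb) := by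
  set F := searchNext I (guessOf I s letter U₁ U₂) with hF
  obtain ⟨h1, τ, ⟨h2, h3⟩, h4⟩ := Cmd.loop_spec (V := V) (x := rz) (i := rfuel) (c := searchStep)
    (σ := σ) (fun N τ => InSearch I s letter U₁ U₂ lb (F^[N] st) τ ∧
      (τ.reg rans ≠ 0 ↔ σ.reg rans ≠ 0 ∨ ∃ t < N, ∃ d J, F^[t] st = (d, J) ∧
        ¬ J d < I.n ∧ Accepts I (guessOf I s letter U₁ U₂) d J lb)) ⟨h, by simp⟩ (by
      rintro N - τ ⟨h1, h2⟩
      have h3 : InSearch I s letter U₁ U₂ lb (F^[N] st) (τ.set rz N) :=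
        h1.of_reg (fun r hr => Function.update_of_ne (show r ≠ 25 by omega) _ _) rfl
      obtain ⟨g1, g2, g3⟩ := searchStep_spec hm hK hs hk hVn hVB hV h3
      refine ⟨g1, by rw [Function.iterate_succ_apply']; exact g2, ?_⟩
      have hans : (τ.set rz N).reg rans = τ.reg rans := Store.set_of_ne _ (by decide) _
      rw [g3, hans, h2, or_assoc]
      refine or_congr_right ⟨?_, ?_⟩
      · rintro (⟨t, ht, h'⟩ | h')
        · exact ⟨t, by omega, h'⟩
        · exact ⟨N, by omega, _, _, rfl, h'⟩
      · rintro ⟨t, ht, d, J, h', h''⟩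
        rcases Nat.lt_or_ge t N with hlt | hge
        · exact Or.inl ⟨t, hlt, d, J, h', h''⟩
        · obtain rfl : t = N := by omega
          right
          rw [h']
          exact h'')
  refine ⟨h1, ?_, ?_⟩
  · rw [h4]
    exact h2.of_reg (fun r hr => Function.update_of_ne (show r ≠ 25 by omega) _ _) rfl
  · rw [h4, ← h3]
    simp only [Store.set]
    rw [Function.update_of_ne (by decide)]

/-- The store during the computation of the table of labels, before the column `j` is treated. -/
structure InLabels (I : Inst) (s : ℕ) (letter : ℕ → ℕ) (U₁ U₂ : ℕ) (j : ℕ) (σ : Store) :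
    Prop where
  holds : Holds I s letter σ
  reg_U₁ : σ.reg rU1 = U₁
  reg_U₂ : σ.reg rU2 = U₂
  reg_v : σ.reg rv = rank I (guessOf I s letter U₁ U₂) j
  mem_lab : ∀ j' < j, σ.mem (σ.reg rlab + j') = baseLabel I (guessOf I s letter U₁ U₂) j'

theorem digit_lt {h : ℕ} (hh : 0 < h) (U c t : ℕ) : digit h U c t < h := Nat.mod_lt _ hh

theorem rank_le (I : Inst) (G : Guess) (j : ℕ) : rank I G j ≤ I.B := by
  rw [rank_eq]; exact min_le_left _ _

theorem firstMatch_le (I : Inst) (G : Guess) (j : ℕ) : firstMatch I G j ≤ I.k := by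
  classical
  rw [firstMatch]
  exact (card_filter_le _ _).trans (card_range _).le

theorem labelStep_spec (hm : 1 ≤ I.m) (hs : 1 ≤ s) {V j : ℕ} (hV : I.base s < V)
    (hj : j < I.n) (h : InLabels I s letter U₁ U₂ j σ) (hσj : σ.reg rj = j) :
    labelStep.Safe V σ ∧ InLabels I s letter U₁ U₂ (j + 1) (labelStep.exec σ) ∧
      (labelStep.exec σ).reg rans = σ.reg rans := by
  set G := guessOf I s letter U₁ U₂ with hG
  have hfirst : (firstE (.var rj)).eval σ.reg σ.mem = firstMatch I G j := by
    rw [h.holds.eval_firstE hm hs (by rw [hσj]; exact hj), h.reg_U₁, h.reg_U₂, hσj]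
  set F := firstMatch I G j with hF
  have hFk : F ≤ I.k := firstMatch_le _ _ _
  have hrB : rank I G j ≤ I.B := rank_le _ _ _
  have hbase : I.k + I.B + 2 ≤ I.base s := by rw [Inst.base]; omega
  simp only [labelStep, Cmd.exec, Cmd.Safe, hfirst]
  set σ₁ := σ.set rtmp F with hσ₁
  have hr₁ : ∀ r, r ≠ 27 → σ₁.reg r = σ.reg r := fun r hr => Function.update_of_ne hr _ _
  have htmp : σ₁.reg rtmp = F := by simp only [hσ₁, Store.set, Function.update_self]
  have hm₁ : σ₁.mem = σ.mem := rfl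
  have hh₁ : Holds I s letter σ₁ := h.holds.of_eq (fun r hr => hr₁ r (by omega)) fun _ _ => rfl
  have hv₁ : σ₁.reg rv = rank I G j := by rw [hr₁ _ (by decide), h.reg_v]
  have hdig : (digE 4 (.var rv)).eval σ₁.reg σ₁.mem = G.vis (rank I G j) := by
    rw [hh₁.eval_digE (fun _ _ => rfl) (by decide)
      (by rw [eval_var, hv₁, Inst.digits]; omega), eval_var, hv₁, hr₁ rU1 (by decide), h.reg_U₁, hG]
    rfl
  have hlab : (ltE (.var rtmp) (.var rk) * .var rtmp +
      notE (ltE (.var rtmp) (.var rk)) * digE 4 (.var rv)).eval σ₁.reg σ₁.mem =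
        baseLabel I G j := by
    rw [eval_add, eval_mul, eval_mul, eval_notE, eval_ltE, eval_var, eval_var, hdig, htmp,
      hh₁.reg_k, baseLabel, ← hF]
    split_ifs <;> simp_all
  have hlabV : baseLabel I G j < V := by
    rw [baseLabel]
    split_ifs
    · omega
    · exact (digit_lt (by omega) _ _ _).trans hV
  rw [hlab]
  have hadr : (.var rlab + .var rj : Exp).eval σ₁.reg σ₁.mem = σ.reg rlab + j := by
    rw [eval_add, eval_var, eval_var, hr₁ _ (by decide), hr₁ _ (by decide), hσj]
  rw [hadr]
  have hrank : (.var rv + notE (ltE (.var rtmp) (.var rk)) * ltE (.var rv) (.var rB) : Exp).eval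
      σ₁.reg (Function.update σ₁.mem (σ.reg rlab + j) (baseLabel I G j)) = rank I G (j + 1) := by
    rw [eval_add, eval_mul, eval_notE, eval_ltE, eval_ltE, eval_var, eval_var, eval_var, eval_var,
      htmp, hv₁, hh₁.reg_k, hh₁.reg_B, rank, ← hF]
    split_ifs <;> simp_all
  rw [hrank]
  have hrB' : rank I G (j + 1) ≤ I.B := rank_le _ _ _
  refine ⟨⟨by omega, hlabV, by omega⟩, ?_, ?_⟩
  · have hr₂ : ∀ r, r ≠ 23 → r ≠ 27 → Function.update σ₁.reg rv (rank I G (j + 1)) r = σ.reg r :=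
      fun r a b => by rw [Function.update_of_ne a, hr₁ r b]
    constructor
    · refine h.holds.of_eq (fun r hr => hr₂ r (by omega) (by omega)) fun a ha => ?_
      have := h.holds.reg_lab
      simp only [Store.set]
      rw [Function.update_of_ne (by omega), hm₁]
    · exact (hr₂ _ (by decide) (by decide)).trans h.reg_U₁
    · exact (hr₂ _ (by decide) (by decide)).trans h.reg_U₂
    · exact Store.set_self _ _ _
    · intro j' hj'
      simp only [Store.set]
      rw [hr₂ _ (by decide) (by decide)]
      by_cases hjj : j' = j
      · rw [hjj, Function.update_self]
      · rw [Function.update_of_ne (by omega), hm₁, h.mem_lab j' (by omega)]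
  · simp only [Store.set]
    rw [Function.update_of_ne (by decide), hr₁ _ (by decide)]

theorem labelLoop_spec (hm : 1 ≤ I.m) (hs : 1 ≤ s) {V : ℕ} (hV : I.base s < V)
    (h : InLabels I s letter U₁ U₂ 0 σ) : (Cmd.loop rj rN labelStep).Safe V σ ∧
      InLabels I s letter U₁ U₂ I.n ((Cmd.loop rj rN labelStep).exec σ) ∧
      ((Cmd.loop rj rN labelStep).exec σ).reg rans = σ.reg rans := by
  have hset : ∀ {τ : Store} {j v : ℕ}, InLabels I s letter U₁ U₂ j τ →
      InLabels I s letter U₁ U₂ j (τ.set rj v) := by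
    intro τ j v h
    have hr : ∀ r, r ≠ 22 → (τ.set rj v).reg r = τ.reg r := fun r hr =>
      Function.update_of_ne hr _ _
    exact ⟨h.holds.of_eq (fun r hr' => hr r (by omega)) fun _ _ => rfl,
      (hr _ (by decide)).trans h.reg_U₁, (hr _ (by decide)).trans h.reg_U₂,
      (hr _ (by decide)).trans h.reg_v, fun j' hj' => by
        rw [hr _ (by decide)]; exact h.mem_lab j' hj'⟩
  have hn := h.holds.reg_n
  obtain ⟨h1, τ, ⟨h2, h3⟩, h4⟩ := Cmd.loop_spec (V := V) (x := rj) (i := rN) (c := labelStep)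
    (σ := σ) (fun j τ => InLabels I s letter U₁ U₂ j τ ∧ τ.reg rans = σ.reg rans) ⟨h, rfl⟩ (by
      rintro j hj τ ⟨g1, g2⟩
      obtain ⟨a, b, c⟩ := labelStep_spec hm hs hV (hn ▸ hj) (hset (v := j) g1)
        (Store.set_self _ _ _)
      exact ⟨a, b, c.trans ((Store.set_of_ne _ (by decide) _).trans g2)⟩)
  rw [h4, hn]
  rw [hn] at h2
  exact ⟨h1, hset h2, (Store.set_of_ne _ (by decide) _).trans h3⟩

/-- Whatever the initial contents of the sequence are, the search finds a solution within the
given number of steps. -/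
def Succeeds (I : Inst) (G : Guess) (fuel : ℕ) : Prop :=
  ∀ J₀ : ℕ → ℕ, J₀ 0 = 0 → ∃ t < fuel, ∃ d J, (searchNext I G)^[t] (0, J₀) = (d, J) ∧
    ¬ J d < I.n ∧ Accepts I G d J (baseLabel I G)

/-- The number of steps granted to a tree search. -/
def Inst.fuel (I : Inst) (s : ℕ) : ℕ := I.guesses s * I.m ^ I.K * I.m ^ I.K * I.n

theorem tryGuess_spec (hm : 1 ≤ I.m) (hK : 1 ≤ I.K) (hs : 1 ≤ s) (hk : 1 ≤ I.k) {V : ℕ}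
    (hVn : I.n < V) (hV : I.base s < V) (h : Holds I s letter σ) :
    tryGuess.Safe V σ ∧ Holds I s letter (tryGuess.exec σ) ∧
    ((tryGuess.exec σ).reg rans ≠ 0 → σ.reg rans ≠ 0 ∨ ∃ d J lb,
      Accepts I (guessOf I s letter (σ.reg rU1) (σ.reg rU2)) d J lb) ∧
    (σ.reg rans ≠ 0 ∨ Succeeds I (guessOf I s letter (σ.reg rU1) (σ.reg rU2)) (I.fuel s) →
      (tryGuess.exec σ).reg rans ≠ 0) := by
  set U₁ := σ.reg rU1 with hU₁
  set U₂ := σ.reg rU2 with hU₂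
  set G := guessOf I s letter U₁ U₂ with hG
  have hbase : I.B + 2 ≤ I.base s := by rw [Inst.base]; omega
  set σ₁ := σ.set rv 0 with hσ₁
  have hr₁ : ∀ r, r ≠ 23 → σ₁.reg r = σ.reg r := fun r hr => Function.update_of_ne hr _ _
  have h₁ : InLabels I s letter U₁ U₂ 0 σ₁ := ⟨h.of_eq (fun r hr => hr₁ r (by omega))
    fun _ _ => rfl, hr₁ _ (by decide), hr₁ _ (by decide), Store.set_self _ _ _,
    fun _ h => absurd h (Nat.not_lt_zero _)⟩
  obtain ⟨s₁, h₂, a₁⟩ := labelLoop_spec hm hs hV h₁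
  set σ₂ := (Cmd.loop rj rN labelStep).exec σ₁ with hσ₂
  set σ₃ := σ₂.set re 0 with hσ₃
  have hr₃ : ∀ r, r ≠ 24 → σ₃.reg r = σ₂.reg r := fun r hr => Function.update_of_ne hr _ _
  have hadr : (.var rJ + .lit 0 : Exp).eval σ₃.reg σ₃.mem = σ₂.reg rJ := by
    rw [eval_add, eval_var, eval_lit, hr₃ _ (by decide), add_zero]
  set σ₄ : Store := ⟨σ₃.reg, Function.update σ₃.mem (σ₂.reg rJ) 0⟩ with hσ₄
  set J₀ : ℕ → ℕ := fun i => σ₄.mem (σ₂.reg rJ + i) with hJ₀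
  have hJ₀0 : J₀ 0 = 0 := by simp only [hJ₀, hσ₄, add_zero, Function.update_self]
  have hlabJ := h₂.holds.reg_lab
  have h₄ : InSearch I s letter U₁ U₂ (baseLabel I G) (0, J₀) σ₄ := by
    constructor
    · refine h₂.holds.of_eq (fun r hr => hr₃ r (by omega)) fun a ha => ?_
      simp only [hσ₄]
      rw [Function.update_of_ne (by omega)]
      rfl
    · exact (hr₃ _ (by decide)).trans h₂.reg_U₁
    · exact (hr₃ _ (by decide)).trans h₂.reg_U₂
    · simp only [hσ₄, hσ₃, Store.set, Function.update_self]
    · intro i _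
      rw [show σ₄.reg rJ = σ₂.reg rJ from hr₃ rJ (by decide)]
    · intro j hj
      rw [show σ₄.reg rlab = σ₂.reg rlab from hr₃ rlab (by decide)]
      simp only [hσ₄]
      rw [Function.update_of_ne (by omega)]
      exact h₂.mem_lab j hj
    · exact Nat.zero_le _
    · intro i hi
      exact absurd hi (Nat.not_lt_zero _)
    · exact hJ₀0.trans_le (Nat.zero_le _)
  obtain ⟨s₄, h₅, a₄⟩ := searchLoop_spec hm hK hs hk hVn (by omega) (by omega) h₄
  rw [h₄.holds.reg_fuel, show σ₄.reg rans = σ.reg rans by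
    rw [show σ₄.reg rans = σ₂.reg rans from hr₃ rans (by decide), a₁, hr₁ _ (by decide)]] at a₄
  have hexec : tryGuess.exec σ = (Cmd.loop rz rfuel searchStep).exec σ₄ := by
    rw [tryGuess, Cmd.exec, Cmd.exec, Cmd.exec, Cmd.exec, hσ₄, ← hadr]
    rfl
  rw [hexec]
  refine ⟨?_, h₅.holds, fun h' => ?_, fun h' => ?_⟩
  · rw [tryGuess]
    refine ⟨?_, s₁, ?_, ?_, ?_⟩
    · show 0 < V
      omega
    · show 0 < V
      omega
    · show 0 < V
      omega
    · have : (Cmd.store (.var rJ + .lit 0) (.lit 0)).exec ((Cmd.set re (.lit 0)).exec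
          ((Cmd.loop rj rN labelStep).exec ((Cmd.set rv (.lit 0)).exec σ))) = σ₄ := by
        rw [hσ₄, ← hadr]
        rfl
      rw [this]
      exact s₄
  · rcases a₄.1 h' with h' | ⟨t, _, d, J, _, _, hacc⟩
    · exact Or.inl h'
    · exact Or.inr ⟨d, J, _, hacc⟩
  · rw [a₄]
    rcases h' with h' | h'
    · exact Or.inl h'
    · exact Or.inr (h' J₀ hJ₀0)

/-- The search is sound, since every labelling that passes the test is a solution, and it succeeds
if some guess leads the tree search to a solution in time. -/
theorem tryAll_spec (hm : 1 ≤ I.m) (hK : 1 ≤ I.K) (hs : 1 ≤ s) (hk : 1 ≤ I.k) {V : ℕ}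
    (hVn : I.n < V) (hV : I.base s < V) (h : Holds I s letter σ) (hans : σ.reg rans = 0) :
    tryAll.Safe V σ ∧ Holds I s letter (tryAll.exec σ) ∧
    ((tryAll.exec σ).reg rans ≠ 0 → ∃ U₁ U₂ d J lb, Accepts I (guessOf I s letter U₁ U₂) d J lb) ∧
    ((∃ U₁ < I.guesses s, ∃ U₂ < I.m ^ I.K, Succeeds I (guessOf I s letter U₁ U₂) (I.fuel s)) →
      (tryAll.exec σ).reg rans ≠ 0) := by
  set Sound : Store → Prop := fun τ => Holds I s letter τ ∧ (τ.reg rans ≠ 0 →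
    ∃ U₁ U₂ d J lb, Accepts I (guessOf I s letter U₁ U₂) d J lb) with hSound
  set good : ℕ → ℕ → Prop := fun U₁ U₂ => Succeeds I (guessOf I s letter U₁ U₂) (I.fuel s)
    with hgood
  have hset : ∀ {τ : Store} {r v : ℕ}, 20 ≤ r → r ≠ 26 → Sound τ → Sound (τ.set r v) := by
    intro τ r v h20 h26 h'
    refine ⟨h'.1.of_eq (fun r' hr => Function.update_of_ne (by omega) _ _) fun _ _ => rfl,
      fun h0 => h'.2 ?_⟩
    rwa [show (τ.set r v).reg rans = τ.reg rans from Store.set_of_ne _ (Ne.symm h26) _] at h0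
  have hinner : ∀ U₁ τ, Sound τ → τ.reg rU1 = U₁ →
      (Cmd.loop rU2 rN2 tryGuess).Safe V τ ∧ Sound ((Cmd.loop rU2 rN2 tryGuess).exec τ) ∧
      ((τ.reg rans ≠ 0 ∨ ∃ U₂ < I.m ^ I.K, good U₁ U₂) →
        ((Cmd.loop rU2 rN2 tryGuess).exec τ).reg rans ≠ 0) := by
    intro U₁ τ hτ hU₁
    obtain ⟨h1, τ', ⟨h2, h3, h4⟩, h5⟩ := Cmd.loop_spec (V := V) (x := rU2) (i := rN2)
      (c := tryGuess) (σ := τ) (fun j τ' => Sound τ' ∧ τ'.reg rU1 = U₁ ∧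
        ((τ.reg rans ≠ 0 ∨ ∃ U₂ < j, good U₁ U₂) → τ'.reg rans ≠ 0))
      ⟨hτ, hU₁, by rintro (h' | ⟨_, h', _⟩); exacts [h', absurd h' (Nat.not_lt_zero _)]⟩ (by
        rintro j - τ' ⟨g1, g2, g3⟩
        have e1 := hset (r := rU2) (v := j) (by decide) (by decide) g1
        obtain ⟨a, b, c, d⟩ := tryGuess_spec hm hK hs hk hVn hV e1.1
        have r1 : (τ'.set rU2 j).reg rU1 = U₁ := (Store.set_of_ne _ (by decide) _).trans g2
        have r2 : (τ'.set rU2 j).reg rU2 = j := Store.set_self _ _ _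
        have r3 : (τ'.set rU2 j).reg rans = τ'.reg rans := Store.set_of_ne _ (by decide) _
        rw [r1, r2] at c d
        rw [r3] at d
        refine ⟨a, ⟨b, fun h0 => ?_⟩, ?_, ?_⟩
        · rcases c h0 with h' | ⟨d, J, lb, h'⟩
          · exact e1.2 h'
          · exact ⟨_, _, d, J, lb, h'⟩
        · rw [Cmd.exec_reg _ _ (by decide), r1]
        · rintro (h' | ⟨U₂, hU₂, h'⟩)
          · exact d (Or.inl (g3 (Or.inl h')))
          · rcases Nat.lt_or_ge U₂ j with hlt | hge
            · exact d (Or.inl (g3 (Or.inr ⟨U₂, hlt, h'⟩)))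
            · obtain rfl : U₂ = j := by omega
              exact d (Or.inr h'))
    rw [h5]
    rw [hτ.1.reg_N2] at h4
    refine ⟨h1, hset (by decide) (by decide) h2, ?_⟩
    rw [show ∀ v, (τ'.set rU2 v).reg rans = τ'.reg rans from
      fun v => Store.set_of_ne _ (by decide) _]
    exact h4
  obtain ⟨h1, τ', ⟨h2, h3⟩, h5⟩ := Cmd.loop_spec (V := V) (x := rU1) (i := rN1)
    (c := .loop rU2 rN2 tryGuess) (σ := σ) (fun j τ' => Sound τ' ∧
      ((∃ U₁ < j, ∃ U₂ < I.m ^ I.K, good U₁ U₂) → τ'.reg rans ≠ 0))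
    ⟨⟨h, fun h' => absurd hans h'⟩, by rintro ⟨_, h', _⟩; exact absurd h' (Nat.not_lt_zero _)⟩ (by
      rintro j - τ' ⟨g1, g2⟩
      have e1 := hset (r := rU1) (v := j) (by decide) (by decide) g1
      obtain ⟨a, b, c⟩ := hinner j _ e1 (Store.set_self _ _ _)
      rw [show (τ'.set rU1 j).reg rans = τ'.reg rans from
        Store.set_of_ne _ (by decide) _] at c
      refine ⟨a, b, ?_⟩
      rintro ⟨U₁, hU₁, h'⟩
      rcases Nat.lt_or_ge U₁ j with hlt | hge
      · exact c (Or.inl (g2 ⟨U₁, hlt, h'⟩))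
      · obtain rfl : U₁ = j := by omega
        exact c (Or.inr h'))
  rw [h.reg_N1] at h3
  have h6 := hset (r := rU1) (v := σ.reg rN1) (by decide) (by decide) h2
  rw [tryAll, h5]
  refine ⟨h1, h6.1, h6.2, ?_⟩
  rw [show ∀ v, (τ'.set rU1 v).reg rans = τ'.reg rans from
    fun v => Store.set_of_ne _ (by decide) _]
  exact h3

end Search

/-! ### Some guess leads to success -/

/-- Numbers below `b ^ L` have arbitrary sequences of `L` digits in base `b`. -/
theorem exists_digits {b : ℕ} (hb : 0 < b) (L : ℕ) : ∀ f : ℕ → ℕ, (∀ t, f t < b) →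
    ∃ U < b ^ L, ∀ t < L, U / b ^ t % b = f t := by
  induction L with
  | zero => exact fun f _ => ⟨0, by simp, by simp⟩
  | succ L ih =>
    intro f hf
    obtain ⟨U, hU, hdig⟩ := ih (fun t => f (t + 1)) fun t => hf (t + 1)
    refine ⟨f 0 + b * U, ?_, ?_⟩
    · have := hf 0
      calc f 0 + b * U < b * (U + 1) := by rw [mul_add]; omega
        _ ≤ b * b ^ L := Nat.mul_le_mul_left _ hU
        _ = b ^ (L + 1) := (pow_succ' b L).symm
    · rintro (_ | t) ht
      · simp [Nat.mod_eq_of_lt (hf 0)]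
      · rw [pow_succ', ← Nat.div_div_eq_div_mul, Nat.add_mul_div_left _ _ hb,
          Nat.div_eq_of_lt (hf 0), zero_add, hdig t (by omega)]

theorem mul_add_div_of_lt {b a r : ℕ} (hr : r < b) : (a * b + r) / b = a := by
  rw [mul_comm, Nat.mul_add_div (by omega), Nat.div_eq_of_lt hr, add_zero]

theorem mul_add_mod_of_lt {b a r : ℕ} (hr : r < b) : (a * b + r) % b = r := by
  rw [mul_comm, Nat.mul_add_mod, Nat.mod_eq_of_lt hr]

/-- Two guesses agree in all the values that the search uses. -/
structure Guess.Agree (I : Inst) (G G' : Guess) : Prop where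
  rep : ∀ p < I.K, G'.rep p = G.rep p
  pat : ∀ p < I.K, ∀ i < I.k, G'.pat p i = G.pat p i
  slot : ∀ x < I.B, G'.slot x = G.slot x
  inc : ∀ i < I.B, ∀ x < I.B, G'.inc i x = G.inc i x
  lab : ∀ i < I.B, G'.lab i = G.lab i
  vis : ∀ t ≤ I.B, G'.vis t = G.vis t
  depth : G'.depth = G.depth

section Agree

variable {I : Inst} {G G' : Guess}

theorem Guess.Agree.admissible (h : G.Agree I G') (hslot : ∀ x, G.slot x < I.K) {e : ℕ}
    (he : e ≤ I.B) {J : ℕ → ℕ} (ha : Admissible I G e J) : Admissible I G' e J := by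
  intro x hx
  obtain ⟨y, hy⟩ := ha x hx
  refine ⟨y, ?_⟩
  simp only [fillers, mem_filter] at hy ⊢
  rw [h.slot x hx, h.rep _ (hslot x)]
  exact ⟨hy.1, hy.2.1, fun i hi hne => hy.2.2 i hi (by rwa [h.inc i (by omega) x hx] at hne)⟩

theorem Guess.Agree.firstMatch (h : G.Agree I G') (j : ℕ) :
    firstMatch I G' j = firstMatch I G j := by
  classical
  unfold FeatureSelection.firstMatch
  congr 1
  refine filter_congr fun i _ => forall₂_congr fun i' hi' => imp_congr_right fun _ => not_congr ?_
  refine forall₂_congr fun p hp => ?_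
  rw [h.rep p hp, h.pat p hp i' hi']

theorem Guess.Agree.rank (h : G.Agree I G') (j : ℕ) : rank I G' j = rank I G j := by
  rw [rank_eq, rank_eq]
  simp only [h.firstMatch]

theorem Guess.Agree.baseLabel (h : G.Agree I G') (j : ℕ) :
    baseLabel I G' j = baseLabel I G j := by
  unfold FeatureSelection.baseLabel
  rw [h.firstMatch, h.rank, h.vis _ (rank_le _ _ _)]

theorem Guess.Agree.label (h : G.Agree I G') {e : ℕ} (he : e ≤ I.B) (J lb : ℕ → ℕ) (j : ℕ) :
    label I G' e J lb j = label I G e J lb j := by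
  classical
  unfold FeatureSelection.label
  have : ∑ i ∈ range e with J i = j, G'.lab i = ∑ i ∈ range e with J i = j, G.lab i :=
    sum_congr rfl fun i hi => h.lab i
      ((mem_range.1 (mem_filter.1 hi).1).trans_le he)
  rw [this]

theorem Guess.Agree.accepts (h : G.Agree I G') (hk : 1 ≤ I.k) {e : ℕ} (he : e ≤ I.B)
    {J lb : ℕ → ℕ} (ha : Accepts I G e J lb) : Accepts I G' e J lb := by
  unfold Accepts at ha ⊢
  convert ha using 7 with t _ y _ p
  refine and_congr_right fun hp => ?_
  rw [I.mis_congr fun j _ => ?_]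
  rw [h.label he, h.pat p hp _ (label_lt hk _ _ _ _)]

/-- The bound for the size of the whole search tree. -/
theorem weight_zero_le (hm : 1 ≤ I.m) {θ : ℕ → ℝ} (hθ : ∀ x, 0 ≤ θ x) {K : ℕ}
    (hsum : ∑ x ∈ range I.B, θ x ≤ 2 * K) (J : ℕ → ℕ) :
    weight I G θ 0 J ≤ (I.m : ℝ) ^ (2 * K) := by
  have hm' : (1 : ℝ) ≤ I.m := by exact_mod_cast hm
  calc weight I G θ 0 J ≤ ∏ x ∈ range I.B, (I.m : ℝ) ^ θ x := by
        refine prod_le_prod (fun _ _ => Real.rpow_nonneg (Nat.cast_nonneg _) _) fun x _ => ?_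
        refine Real.rpow_le_rpow (Nat.cast_nonneg _) ?_ (hθ x)
        exact_mod_cast (card_filter_le _ _).trans (card_range _).le
    _ = (I.m : ℝ) ^ ∑ x ∈ range I.B, θ x := (Real.rpow_sum_of_pos (by linarith) _ _).symm
    _ ≤ (I.m : ℝ) ^ ((2 * K : ℕ) : ℝ) :=
        Real.rpow_le_rpow_of_exponent_le hm' (by exact_mod_cast hsum)
    _ = (I.m : ℝ) ^ (2 * K) := Real.rpow_natCast _ _

theorem Inst.pow_le_guesses (I : Inst) (s : ℕ) : 2 * (I.B + 1) ^ I.B ≤ I.guesses s := by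
  have h2 : 2 ≤ I.base s := by rw [base]; omega
  calc 2 * (I.B + 1) ^ I.B ≤ I.base s * I.base s ^ I.B :=
        Nat.mul_le_mul h2 (Nat.pow_le_pow_left (by rw [base]; omega) _)
    _ = I.base s ^ (I.B + 1) := (pow_succ' _ _).symm
    _ ≤ I.guesses s := Nat.pow_le_pow_right (by omega) (by rw [digits]; omega)

/-- If there is a solution, some pair of guesses describes the guess of `exists_guess`. The search
tree of this guess is small enough to be searched completely in the time granted. -/
theorem exists_succeeds {S : Finset ℕ} {letter : ℕ → ℕ} (hm : 1 ≤ I.m) (hn : 1 ≤ I.n)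
    (hk : 1 ≤ I.k) (hS : S.Nonempty) (hK : I.K = #S ^ I.k)
    (hletter : ∀ a ∈ S, ∃ i < #S, letter i = a) (hc : Clusterable I S) :
    ∃ U₁ < I.guesses #S, ∃ U₂ < I.m ^ I.K,
      Succeeds I (guessOf I #S letter U₁ U₂) (I.fuel #S) := by
  obtain ⟨G, θ, T, hrep, hpat, hslot, hinc, hlab, hvis, hdepth, hθ, hcover, hsum, hT, hadm, hacc⟩ :=
    exists_guess I S hK hm hS hk hc
  have hK1 : 1 ≤ I.K := hK ▸ Nat.one_le_pow _ _ hS.card_pos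
  choose ix hix_lt hix using fun a : S => hletter a.1 a.2
  -- the digits that describe `G`; a digit for the depth follows the `B` digits for the labels
  set D : ℕ → ℕ := fun u =>
    if u % 5 = 0 then ix ⟨_, hpat (u / 5 / I.k) (u / 5 % I.k)⟩
    else if u % 5 = 1 then G.slot (u / 5)
    else if u % 5 = 2 then G.inc (u / 5 / I.B) (u / 5 % I.B)
    else if u % 5 = 3 then if u / 5 < I.B then G.lab (u / 5) else G.depth
    else G.vis (u / 5) with hD
  have hDlt : ∀ u, D u < I.base #S := by
    intro u
    rw [Inst.base]
    simp only [hD]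
    split_ifs
    · have := hix_lt ⟨_, hpat (u / 5 / I.k) (u / 5 % I.k)⟩
      omega
    · have := hslot (u / 5)
      omega
    · have := hinc (u / 5 / I.B) (u / 5 % I.B)
      omega
    · have := hlab (u / 5)
      omega
    · omega
    · have := hvis (u / 5)
      omega
  have hbase : 0 < I.base #S := by rw [Inst.base]; omega
  obtain ⟨U₁, hU₁, hdig₁⟩ := exists_digits hbase (5 * I.digits) D hDlt
  obtain ⟨U₂, hU₂, hdig₂⟩ := exists_digits hm I.K G.rep hrep
  have hdig : ∀ c < 5, ∀ t < I.digits, digit (I.base #S) U₁ c t = D (5 * t + c) :=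
    fun c hc t ht => hdig₁ _ (by omega)
  have h5 : ∀ c < 5, ∀ t, (5 * t + c) % 5 = c ∧ (5 * t + c) / 5 = t := fun c hc t => by omega
  set G' := guessOf I #S letter U₁ U₂ with hG'
  have hag : G.Agree I G' := by
    constructor
    · intro p hp
      exact hdig₂ p hp
    · intro p hp i hi
      have hlt := index_lt hp hi
      have e1 : digit (I.base #S) U₁ 0 (p * I.k + i) = ix ⟨_, hpat p i⟩ := by
        rw [hdig 0 (by omega) _ (by rw [Inst.digits]; omega)]
        simp only [hD, (h5 0 (by omega) (p * I.k + i)).1, (h5 0 (by omega) (p * I.k + i)).2, if_true,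
          mul_add_div_of_lt hi, mul_add_mod_of_lt hi]
      simp only [hG', guessOf]
      rw [e1, Nat.mod_eq_of_lt (hix_lt _), hix]
    · intro x hx
      simp only [hG', guessOf]
      rw [hdig 1 (by omega) _ (by rw [Inst.digits]; omega)]
      simp only [hD, (h5 1 (by omega) x).1, (h5 1 (by omega) x).2]
      exact Nat.mod_eq_of_lt (hslot x)
    · intro i hi x hx
      have hlt := index_lt hi hx
      simp only [hG', guessOf]
      rw [hdig 2 (by omega) _ (by rw [Inst.digits]; omega)]
      simp only [hD, (h5 2 (by omega) (i * I.B + x)).1, (h5 2 (by omega) (i * I.B + x)).2,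
        mul_add_div_of_lt hx, mul_add_mod_of_lt hx]
      exact Nat.mod_eq_of_lt (hinc i x)
    · intro i hi
      simp only [hG', guessOf]
      rw [hdig 3 (by omega) _ (by rw [Inst.digits]; omega)]
      simp [hD, (h5 3 (by omega) i).1, (h5 3 (by omega) i).2, hi]
    · intro t ht
      simp only [hG', guessOf]
      rw [hdig 4 (by omega) _ (by rw [Inst.digits]; omega)]
      simp [hD, (h5 4 (by omega) t).1, (h5 4 (by omega) t).2]
    · simp only [hG', guessOf]
      rw [hdig 3 (by omega) _ (by rw [Inst.digits]; omega)]
      simp [hD, (h5 3 (by omega) I.B).1, (h5 3 (by omega) I.B).2]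
  refine ⟨U₁, hU₁, U₂, hU₂, fun J₀ hJ₀ => ?_⟩
  have hd' : G'.depth ≤ I.B := hag.depth ▸ hdepth
  have hadm' : Admissible I G' G'.depth T := hag.depth ▸ hag.admissible hslot hdepth hadm
  have hcover' : ∀ e < G'.depth, 1 ≤ ∑ x ∈ range I.B with G'.inc e x ≠ 0, θ x := by
    intro e he
    rw [hag.depth] at he
    rw [filter_congr fun x hx => by rw [hag.inc e (by omega) x (mem_range.1 hx)]]
    exact hcover e he
  obtain ⟨N, hN, -, hvisit⟩ := search_subtree hθ hcover' hd' G'.depth 0 J₀ (zero_add _) hJ₀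
    ((hadm'.mono (Nat.zero_le _)).congr fun i hi => absurd hi (Nat.not_lt_zero _))
  obtain ⟨t, ht, J', hJ', hJn, hJT⟩ := hvisit G'.depth T (Nat.zero_le _) le_rfl
    (fun i hi => absurd hi (Nat.not_lt_zero _)) (fun i hi => hT i (hag.depth ▸ hi)) hadm'
  refine ⟨t, ?_, G'.depth, J', hJ', by omega, ?_⟩
  · have hw := weight_zero_le (G := G') hm hθ hsum J₀
    have h1 : ((N + 1 : ℕ) : ℝ) ≤ ((I.n + 1) * (I.B + 1) ^ G'.depth * I.m ^ (2 * I.K) : ℕ) := by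
      push_cast
      exact hN.trans (mul_le_mul_of_nonneg_left hw (by positivity))
    have h2 : N + 1 ≤ (I.n + 1) * (I.B + 1) ^ G'.depth * I.m ^ (2 * I.K) := by exact_mod_cast h1
    have h3 : (I.n + 1) * (I.B + 1) ^ G'.depth ≤ I.guesses #S * I.n := by
      calc (I.n + 1) * (I.B + 1) ^ G'.depth ≤ (2 * I.n) * (I.B + 1) ^ I.B :=
            Nat.mul_le_mul (by omega) (Nat.pow_le_pow_right (by omega) hd')
        _ = 2 * (I.B + 1) ^ I.B * I.n := by ring
        _ ≤ I.guesses #S * I.n := Nat.mul_le_mul_right _ (I.pow_le_guesses _)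
    have h4 := Nat.mul_le_mul_right (I.m ^ (2 * I.K)) h3
    have h5 : I.guesses #S * I.n * I.m ^ (2 * I.K) = I.fuel #S := by
      rw [Inst.fuel, two_mul, pow_add]; ring
    omega
  · refine Accepts.congr (J := T) (lb := baseLabel I G) (fun i hi => (hJT i hi).symm)
      (fun j _ => (hag.baseLabel j).symm) ?_
    rw [hag.depth]
    exact hag.accepts hk hdepth hacc

end Agree

end FeatureSelection

namespace RAM

/-! ### Initialization -/

/-- The command runs safely in at most `C` steps and establishes the postcondition `Q`. -/
def Cmd.Spec (V C : ℕ) (c : Cmd) (σ : Store) (Q : Store → Prop) : Prop :=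
  c.Safe V σ ∧ c.cost σ ≤ C ∧ Q (c.exec σ)

/-- A block of commands, each of cost at most `D`, before a command of cost at most `C`. -/
theorem Cmd.Spec.cons {V C D : ℕ} {c last : Cmd} {l : List Cmd} {σ : Store} {Q Q' : Store → Prop}
    (h : c.Spec V D σ Q') (hl : ∀ τ, Q' τ → (l.foldr .seq last).Spec V (D * l.length + C) τ Q) :
    ((c :: l).foldr .seq last).Spec V (D * (c :: l).length + C) σ Q := by
  obtain ⟨h1, h2, h3⟩ := h
  obtain ⟨g1, g2, g3⟩ := hl _ h3
  refine ⟨⟨h1, g1⟩, ?_, g3⟩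
  simp only [List.foldr_cons, Cmd.cost, List.length_cons, mul_add, mul_one]
  omega

/-- A loop with an invariant `p`, whose body takes at most `C` steps. -/
theorem Cmd.Spec.loop {V C D : ℕ} {x i : ℕ} {c : Cmd} {σ : Store} {Q : Store → Prop}
    (p : ℕ → Store → Prop) (h0 : p 0 σ)
    (hs : ∀ j < σ.reg i, ∀ τ, p j τ → c.Spec V C (τ.set x j) (p (j + 1)))
    (hQ : ∀ τ, p (σ.reg i) τ → Q (τ.set x (σ.reg i))) (hD : 3 + σ.reg i * (C + 4) ≤ D) :
    (Cmd.loop x i c).Spec V D σ Q := by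
  have key : ∀ j ≤ σ.reg i, p j (iterLoop (fun j τ => c.exec (τ.set x j)) j σ) := by
    intro j
    induction j with
    | zero => intro _; exact h0
    | succ j ih => intro hj; exact (hs j (by omega) _ (ih (by omega))).2.2
  refine ⟨fun j hj => (hs j hj _ (key j hj.le)).1, ?_, hQ _ (key _ le_rfl)⟩
  refine le_trans ?_ hD
  rw [Cmd.cost]
  refine Nat.add_le_add_left ((Finset.sum_le_card_nsmul _ _ (C + 4) fun j hj => ?_).trans_eq ?_) 3
  · have hj' := Finset.mem_range.1 hj
    exact Nat.add_le_add_right (hs j hj' _ (key j hj'.le)).2.1 4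
  · rw [Finset.card_range, smul_eq_mul]

/-- The registers in the list `L` hold their final values `vals`, and the memory contains `M`. -/
def Known (vals : ℕ → ℕ) (M : ℕ → ℕ) (L : List ℕ) (σ : Store) : Prop :=
  (∀ r ∈ L, σ.reg r = vals r) ∧ σ.mem = M

theorem Known.set {vals M : ℕ → ℕ} {L : List ℕ} {σ : Store} (h : Known vals M L σ) {x : ℕ}
    (hx : x ∉ L) (v : ℕ) : Known vals M L (σ.set x v) :=
  ⟨fun r hr => by rw [σ.set_of_ne (ne_of_mem_of_not_mem hr hx), h.1 r hr], h.2⟩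

theorem Known.spec_set {vals M : ℕ → ℕ} {L : List ℕ} {σ : Store} (h : Known vals M L σ) {x : ℕ}
    {e : Exp} {V D : ℕ} (hx : x ∉ L)
    (he : ∀ ρ : ℕ → ℕ, (∀ r ∈ L, ρ r = vals r) → e.eval ρ M = vals x) (hV : vals x < V)
    (hD : e.cost σ.reg < D) : (Cmd.set x e).Spec V D σ (Known vals M (x :: L)) := by
  have hv : e.eval σ.reg σ.mem = vals x := by rw [h.2]; exact he _ h.1
  refine ⟨?_, hD, ?_⟩
  · rw [Cmd.Safe, hv]; exact hV
  · rw [Cmd.exec, hv]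
    refine ⟨fun r hr => ?_, h.2⟩
    by_cases hrx : r = x
    · subst hrx; exact σ.set_self _ _
    · rw [σ.set_of_ne hrx, h.1 r ((List.mem_cons.1 hr).resolve_left hrx)]

/-- The loop that writes the table of the powers of the register `b` at the address in the register
`a` and leaves the next power in the register `d`. -/
def powerLoop (x a b d i : ℕ) : Cmd :=
  .loop x i (.seq (.store (.bin .add (.var a) (.var x)) (.var d))
    (.set d (.bin .mul (.var d) (.var b))))

theorem powerLoop_spec {x a b d i V D : ℕ} {σ : Store} (hxa : a ≠ x) (hxb : b ≠ x) (hxd : d ≠ x)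
    (hda : a ≠ d) (hdb : b ≠ d) (hd : σ.reg d = 1) (hb : 1 ≤ σ.reg b)
    (hV : σ.reg b ^ σ.reg i < V) (hD : 3 + σ.reg i * 20 ≤ D) :
    (powerLoop x a b d i).Spec V D σ fun τ => (∀ r, r ≠ d → r ≠ x → τ.reg r = σ.reg r) ∧
      τ.reg d = σ.reg b ^ σ.reg i ∧ (∀ c < σ.reg a, τ.mem c = σ.mem c) ∧
      ∀ t < σ.reg i, τ.mem (σ.reg a + t) = σ.reg b ^ t := by
  refine Cmd.Spec.loop (C := 16) (fun j τ => (∀ r, r ≠ d → r ≠ x → τ.reg r = σ.reg r) ∧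
      τ.reg d = σ.reg b ^ j ∧ (∀ c < σ.reg a, τ.mem c = σ.mem c) ∧
      ∀ t < j, τ.mem (σ.reg a + t) = σ.reg b ^ t)
    ⟨fun _ _ _ => rfl, by simpa using hd, fun _ _ => rfl, fun t ht => absurd ht (Nat.not_lt_zero _)⟩
    ?_ ?_ hD
  · rintro j hj τ ⟨h1, h2, h3, h4⟩
    have e1 : (τ.set x j).reg a = σ.reg a := by rw [τ.set_of_ne hxa, h1 a hda hxa]
    have e2 : (τ.set x j).reg b = σ.reg b := by rw [τ.set_of_ne hxb, h1 b hdb hxb]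
    have e3 : (τ.set x j).reg d = σ.reg b ^ j := by rw [τ.set_of_ne hxd, h2]
    have e4 : (τ.set x j).reg x = j := τ.set_self _ _
    have hp : ∀ t ≤ σ.reg i, σ.reg b ^ t < V := fun t ht =>
      (Nat.pow_le_pow_right hb ht).trans_lt hV
    simp only [Cmd.Spec, Cmd.Safe, Cmd.cost, Cmd.exec, Exp.eval, Exp.cost, BinOp.eval, e1, e2, e3,
      e4]
    refine ⟨⟨hp j hj.le, ?_⟩, by omega, ?_, ?_, ?_, ?_⟩
    · rw [← pow_succ]; exact hp (j + 1) hj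
    · intro r hrd hrx
      simp only [Store.set]
      rw [Function.update_of_ne hrd, Function.update_of_ne hrx, h1 r hrd hrx]
    · simp only [Store.set]
      rw [Function.update_self, pow_succ]
    · intro c hc
      simp only [Store.set]
      rw [Function.update_of_ne (by omega), h3 c hc]
    · intro t ht
      simp only [Store.set]
      by_cases htj : t = j
      · rw [htj, Function.update_self]
      · rw [Function.update_of_ne (by omega), h4 t (by omega)]
  · rintro τ ⟨h1, h2, h3, h4⟩
    exact ⟨fun r hrd hrx => by rw [τ.set_of_ne hrx, h1 r hrd hrx], by rw [τ.set_of_ne hxd, h2], h3,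
      h4⟩

end RAM

namespace FeatureSelection

open Finset RAM

/-- The values of the registers below `20` after the initialization. -/
def regVal (I : Inst) (s : ℕ) : ℕ → ℕ
  | 0 => I.m
  | 1 => I.n
  | 2 => I.k
  | 3 => I.B
  | 5 => s
  | 6 => I.K
  | 7 => I.base s
  | 8 => 5 * I.digits
  | 9 => I.guesses s
  | 10 => I.m ^ I.K
  | 11 => I.fuel s
  | 12 => 6 + s + I.m * I.n
  | 13 => 6 + s + I.m * I.n + 5 * I.digits
  | 14 => 6 + s + I.m * I.n + 5 * I.digits + I.K
  | 15 => 6 + s + I.m * I.n + 5 * I.digits + I.K + I.B + 1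
  | 16 => I.B + 1
  | 17 => I.q
  | 18 => 6 + s
  | _ => 0

/-- The three quantities in which the bounds of the running time are monomials. -/
def Inst.scale (I : Inst) (s : ℕ) : ℕ × ℕ × ℕ := (16 * I.guesses s, I.m ^ (I.K + 1), I.n)

section Scale

variable {I : Inst} {s : ℕ}

theorem Inst.two_le_base : 2 ≤ I.base s := by rw [base]; omega

theorem Inst.base_le_guesses : I.base s ≤ I.guesses s :=
  Nat.le_self_pow (by rw [digits]; omega) _

theorem Inst.digits_lt_guesses : 5 * I.digits < I.guesses s :=
  (Nat.lt_two_pow_self).trans_le (Nat.pow_le_pow_left two_le_base _)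

/-- The limits of all loops and sums are bounded by the monomials that `limitDeg` prescribes. -/
theorem regVal_le (hm : 1 ≤ I.m) (hn : 1 ≤ I.n) (hq : I.q ≤ I.m) (r : ℕ) :
    regVal I s r ≤ monomial (I.scale s) (limitDeg r) := by
  have h1 := I.base_le_guesses (s := s)
  have h2 := I.digits_lt_guesses (s := s)
  have hb : I.base s = I.K + I.k + s + I.B + 2 := rfl
  have hY : 1 ≤ I.m ^ I.K := Nat.one_le_pow _ _ hm
  have hmY : I.m ≤ I.m ^ (I.K + 1) := Nat.le_self_pow (by omega) _
  have hKY : I.m ^ I.K ≤ I.m ^ (I.K + 1) := Nat.pow_le_pow_right hm (by omega)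
  have hadr : 6 + s + I.m * I.n + 5 * I.digits + I.K + I.B + 1 ≤
      16 * I.guesses s * I.m ^ (I.K + 1) * I.n := by
    have e1 : 1 ≤ I.m * I.n := Nat.mul_pos hm hn
    have e2 : I.m * I.n ≤ I.m ^ (I.K + 1) * I.n := Nat.mul_le_mul_right _ hmY
    have e4 : I.guesses s * 1 ≤ I.guesses s * (I.m * I.n) := Nat.mul_le_mul_left _ e1
    have e5 : 2 * (I.m * I.n) ≤ I.guesses s * (I.m * I.n) := Nat.mul_le_mul_right _ (by omega)
    calc 6 + s + I.m * I.n + 5 * I.digits + I.K + I.B + 1 ≤ 16 * (I.guesses s * (I.m * I.n)) := by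
          omega
      _ ≤ 16 * (I.guesses s * (I.m ^ (I.K + 1) * I.n)) := by gcongr
      _ = 16 * I.guesses s * I.m ^ (I.K + 1) * I.n := by ring
  have hfuel : I.fuel s ≤ 16 * I.guesses s * (I.m ^ (I.K + 1)) ^ 2 * I.n := by
    rw [Inst.fuel, pow_two, ← mul_assoc]
    gcongr
    omega
  unfold regVal
  split <;> simp only [limitDeg, monomial, Inst.scale, pow_zero, pow_one, mul_one, one_mul]
  all_goals omega

end Scale

/-- Reads the parameters and computes the derived constants and the two tables of powers. -/
def prelude : List Cmd :=
  [.set rM (.mem (.lit 0)), .set rN (.mem (.lit 1)), .set rk (.mem (.lit 2)),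
    .set rB (.mem (.lit 3)), .set rs (.mem (.lit 5)),
    .set rK (.lit 1), .loop rU1 rk (.set rK (.var rK * .var rs)),
    .set rh (.var rK + .var rk + .var rs + .var rB + .lit 2),
    .set rcnt (.lit 5 * (.var rK * .var rk + .var rB * .var rB + .var rB + .lit 1)),
    .set rA (.lit 6 + .var rs), .set rpowh (.var rA + .var rM * .var rN),
    .set rpowm (.var rpowh + .var rcnt), .set rJ (.var rpowm + .var rK),
    .set rlab (.var rJ + .var rB + .lit 1), .set rB1 (.var rB + .lit 1),
    .set rq (.var rM - .mem (.lit 4)),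
    .set rN1 (.lit 1), powerLoop rU1 rpowh rh rN1 rcnt,
    .set rN2 (.lit 1), powerLoop rU1 rpowm rM rN2 rK,
    .set rfuel (.var rN1 * .var rN2 * .var rN2 * .var rN), .set rans (.lit 0)]

/-- The store after the initialization. -/
structure Ready (I : Inst) (s : ℕ) (letter : ℕ → ℕ) (σ : Store) : Prop where
  holds : Holds I s letter σ
  reg_eq : ∀ r < 20, σ.reg r = regVal I s r
  reg_ans : σ.reg rans = 0

/-- The initialization works in `D` steps per command, where `D` is linear in the number of
structure guesses. -/
theorem prelude_spec {I : Inst} {s : ℕ} {letter M : ℕ → ℕ} {V D C l : ℕ} {last : Cmd}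
    {Q : Store → Prop} (hm : 1 ≤ I.m) (hK : I.K = s ^ I.k) (hs : 1 ≤ s) (hq : I.q = I.m - l)
    (hV : ∀ r, regVal I s r < V) (hD : 32 * I.guesses s ≤ D)
    (h0 : M 0 = I.m) (h1 : M 1 = I.n) (h2 : M 2 = I.k) (h3 : M 3 = I.B) (h4 : M 4 = l)
    (h5 : M 5 = s) (hletter : ∀ i < s, M (6 + i) = letter i)
    (hent : ∀ y < I.m, ∀ j < I.n, M (6 + s + (y * I.n + j)) = I.ent y j)
    (hlast : ∀ τ, Ready I s letter τ → last.Spec V C τ Q) :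
    (prelude.foldr .seq last).Spec V (D * prelude.length + C) ⟨fun _ => 0, M⟩ Q := by
  have hb := I.base_le_guesses (s := s)
  have hdg := I.digits_lt_guesses (s := s)
  have hbase : I.base s = I.K + I.k + s + I.B + 2 := rfl
  have hdig5 : 5 ≤ 5 * I.digits := by rw [Inst.digits]; omega
  have h32 : 30 < D := by omega
  have hV1 : 1 < V := by
    have : I.base s < V := hV 7
    omega
  have hcost : ∀ {e : Exp} {ρ : ℕ → ℕ}, e.cost ρ ≤ 30 → e.cost ρ < D := fun h => h.trans_lt h32
  have hK0 : Known (regVal I s) M [4, 19] ⟨fun _ => 0, M⟩ := by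
    refine ⟨fun r hr => ?_, rfl⟩
    simp only [List.mem_cons, List.not_mem_nil, or_false] at hr
    rcases hr with rfl | rfl <;> rfl
  rw [prelude]
  refine .cons (hK0.spec_set (by decide) (fun ρ h => ?_) (hV _)
    (hcost (Nat.le_of_ble_eq_true rfl))) fun σ hσ => ?_
  · rw [eval_mem, eval_lit, h0]; rfl
  refine .cons (hσ.spec_set (by decide) (fun ρ h => ?_) (hV _)
    (hcost (Nat.le_of_ble_eq_true rfl))) fun σ hσ => ?_
  · rw [eval_mem, eval_lit, h1]; rfl
  refine .cons (hσ.spec_set (by decide) (fun ρ h => ?_) (hV _)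
    (hcost (Nat.le_of_ble_eq_true rfl))) fun σ hσ => ?_
  · rw [eval_mem, eval_lit, h2]; rfl
  refine .cons (hσ.spec_set (by decide) (fun ρ h => ?_) (hV _)
    (hcost (Nat.le_of_ble_eq_true rfl))) fun σ hσ => ?_
  · rw [eval_mem, eval_lit, h3]; rfl
  refine .cons (hσ.spec_set (by decide) (fun ρ h => ?_) (hV _)
    (hcost (Nat.le_of_ble_eq_true rfl))) fun σ hσ => ?_
  · rw [eval_mem, eval_lit, h5]; rfl
  -- the number of row patterns
  refine .cons (Q' := fun τ => Known (regVal I s) M [5, 3, 2, 1, 0, 4, 19] τ ∧ τ.reg rK = 1)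
    ⟨hV1, hcost (Nat.le_of_ble_eq_true rfl), hσ.set (by decide) _, σ.set_self _ _⟩ fun σ hσ => ?_
  have hk : σ.reg rk = I.k := hσ.1.1 2 (by decide)
  refine .cons (Q' := Known (regVal I s) M [6, 5, 3, 2, 1, 0, 4, 19]) (Cmd.Spec.loop (C := 16)
    (fun j τ => Known (regVal I s) M [5, 3, 2, 1, 0, 4, 19] τ ∧ τ.reg rK = s ^ j)
    ⟨hσ.1, hσ.2.trans (pow_zero s).symm⟩ ?_ ?_ ?_) fun σ hσ => ?_
  · rintro j hj τ ⟨g1, g2⟩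
    have e : (.var rK * .var rs : Exp).eval (τ.set rU1 j).reg (τ.set rU1 j).mem = s ^ (j + 1) := by
      rw [eval_mul, eval_var, eval_var, τ.set_of_ne (by decide), τ.set_of_ne (by decide), g2,
        g1.1 5 (by decide), pow_succ]
      rfl
    refine ⟨?_, Nat.le_of_ble_eq_true rfl, ?_⟩
    · rw [Cmd.Safe, e]
      refine lt_of_le_of_lt ?_ (hV 6)
      rw [show regVal I s 6 = I.K from rfl, hK]
      exact Nat.pow_le_pow_right hs (by omega)
    · rw [Cmd.exec, e]
      exact ⟨(g1.set (by decide) _).set (by decide) _, Store.set_self _ _ _⟩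
  · rintro τ ⟨g1, g2⟩
    refine ⟨fun r hr => ?_, g1.2⟩
    rcases List.mem_cons.1 hr with rfl | hr
    · rw [τ.set_of_ne (by decide), g2, hk, ← hK]
      rfl
    · exact (g1.set (by decide) _).1 r hr
  · rw [hk]
    omega
  -- the derived constants
  refine .cons (hσ.spec_set (by decide) (fun ρ h => ?_) (hV _)
    (hcost (Nat.le_of_ble_eq_true rfl))) fun σ hσ => ?_
  · simp only [eval_add, eval_var, eval_lit]
    rw [h 6 (by decide), h 2 (by decide), h 5 (by decide), h 3 (by decide)]
    rfl
  refine .cons (hσ.spec_set (by decide) (fun ρ h => ?_) (hV _)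
    (hcost (Nat.le_of_ble_eq_true rfl))) fun σ hσ => ?_
  · simp only [eval_add, eval_mul, eval_var, eval_lit]
    rw [h 6 (by decide), h 2 (by decide), h 3 (by decide)]
    rfl
  refine .cons (hσ.spec_set (by decide) (fun ρ h => ?_) (hV _)
    (hcost (Nat.le_of_ble_eq_true rfl))) fun σ hσ => ?_
  · simp only [eval_add, eval_var, eval_lit]
    rw [h 5 (by decide)]
    rfl
  refine .cons (hσ.spec_set (by decide) (fun ρ h => ?_) (hV _)
    (hcost (Nat.le_of_ble_eq_true rfl))) fun σ hσ => ?_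
  · simp only [eval_add, eval_mul, eval_var]
    rw [h 18 (by decide), h 0 (by decide), h 1 (by decide)]
    rfl
  refine .cons (hσ.spec_set (by decide) (fun ρ h => ?_) (hV _)
    (hcost (Nat.le_of_ble_eq_true rfl))) fun σ hσ => ?_
  · simp only [eval_add, eval_var]
    rw [h 12 (by decide), h 8 (by decide)]
    rfl
  refine .cons (hσ.spec_set (by decide) (fun ρ h => ?_) (hV _)
    (hcost (Nat.le_of_ble_eq_true rfl))) fun σ hσ => ?_
  · simp only [eval_add, eval_var]
    rw [h 13 (by decide), h 6 (by decide)]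
    rfl
  refine .cons (hσ.spec_set (by decide) (fun ρ h => ?_) (hV _)
    (hcost (Nat.le_of_ble_eq_true rfl))) fun σ hσ => ?_
  · simp only [eval_add, eval_var, eval_lit]
    rw [h 14 (by decide), h 3 (by decide)]
    rfl
  refine .cons (hσ.spec_set (by decide) (fun ρ h => ?_) (hV _)
    (hcost (Nat.le_of_ble_eq_true rfl))) fun σ hσ => ?_
  · simp only [eval_add, eval_var, eval_lit]
    rw [h 3 (by decide)]
    rfl
  refine .cons (hσ.spec_set (by decide) (fun ρ h => ?_) (hV _)
    (hcost (Nat.le_of_ble_eq_true rfl))) fun σ hσ => ?_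
  · simp only [eval_sub, eval_var, eval_mem, eval_lit]
    rw [h 0 (by decide), h4]
    exact hq.symm
  -- the powers of the base
  set L : List ℕ := [17, 16, 15, 14, 13, 12, 18, 8, 7, 6, 5, 3, 2, 1, 0, 4, 19] with hL
  refine .cons (Q' := fun τ => Known (regVal I s) M L τ ∧ τ.reg rN1 = 1)
    ⟨hV1, hcost (Nat.le_of_ble_eq_true rfl), hσ.set (by decide) _, σ.set_self _ _⟩ fun σ hσ => ?_
  have ha : σ.reg rpowh = 6 + s + I.m * I.n := hσ.1.1 12 (by decide)
  have hh : σ.reg rh = I.base s := hσ.1.1 7 (by decide)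
  have hc : σ.reg rcnt = 5 * I.digits := hσ.1.1 8 (by decide)
  have hspec := powerLoop_spec (x := rU1) (a := rpowh) (b := rh) (d := rN1) (i := rcnt) (V := V)
    (D := D) (σ := σ) (by decide) (by decide) (by decide) (by decide) (by decide) hσ.2
    (by rw [hh]; omega) (by rw [hh, hc]; exact hV 9) (by rw [hc]; omega)
  rw [ha, hh, hc] at hspec
  refine .cons hspec ?_
  rintro τ ⟨g1, g2, g3, g4⟩
  have hτ : ∀ r ∈ 9 :: L, τ.reg r = regVal I s r := by
    intro r hr
    rcases List.mem_cons.1 hr with rfl | hr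
    · exact g2
    · rw [g1 r (ne_of_mem_of_not_mem hr (by decide)) (ne_of_mem_of_not_mem hr (by decide)),
        hσ.1.1 r hr]
  rw [hσ.1.2] at g3
  -- the powers of the number of rows
  refine .cons (Q' := fun υ => Known (regVal I s) τ.mem (9 :: L) υ ∧ υ.reg rN2 = 1)
    ⟨hV1, hcost (Nat.le_of_ble_eq_true rfl), Known.set ⟨hτ, rfl⟩ (by decide) _, τ.set_self _ _⟩
    fun υ hυ => ?_
  have ha' : υ.reg rpowm = 6 + s + I.m * I.n + 5 * I.digits := hυ.1.1 13 (by decide)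
  have hh' : υ.reg rM = I.m := hυ.1.1 0 (by decide)
  have hc' : υ.reg rK = I.K := hυ.1.1 6 (by decide)
  have hspec' := powerLoop_spec (x := rU1) (a := rpowm) (b := rM) (d := rN2) (i := rK) (V := V)
    (D := D) (σ := υ) (by decide) (by decide) (by decide) (by decide) (by decide) hυ.2
    (by rw [hh']; omega) (by rw [hh', hc']; exact hV 10) (by rw [hc']; omega)
  rw [ha', hh', hc'] at hspec'
  refine .cons hspec' ?_
  rintro φ ⟨f1, f2, f3, f4⟩
  rw [hυ.1.2] at f3
  have hφ : Known (regVal I s) φ.mem (10 :: 9 :: L) φ := by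
    refine ⟨fun r hr => ?_, rfl⟩
    rcases List.mem_cons.1 hr with rfl | hr
    · exact f2
    · rw [f1 r (ne_of_mem_of_not_mem hr (by decide)) (ne_of_mem_of_not_mem hr (by decide)),
        hυ.1.1 r hr]
  refine .cons (hφ.spec_set (by decide) (fun ρ h => ?_) (hV _)
    (hcost (Nat.le_of_ble_eq_true rfl))) fun χ hχ => ?_
  · simp only [eval_mul, eval_var]
    rw [h 9 (by decide), h 10 (by decide), h 1 (by decide)]
    rfl
  refine .cons (Q' := Ready I s letter) ⟨show 0 < V by omega,
    hcost (Nat.le_of_ble_eq_true rfl), ?_⟩ fun ψ hψ => ?_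
  · have hreg : ∀ r < 20, ((Cmd.set rans (.lit 0)).exec χ).reg r = regVal I s r := by
      intro r hr
      refine (hχ.set (x := rans) (by decide) _).1 r ?_
      rw [hL]
      interval_cases r <;> decide
    have hmem : ((Cmd.set rans (.lit 0)).exec χ).mem = φ.mem := hχ.2
    refine ⟨?_, hreg, χ.set_self _ _⟩
    constructor
    all_goals first
      | exact hreg _ (by decide)
      | skip
    · rw [hreg _ (by decide), hreg _ (by decide)]
      rfl
    · intro i hi
      rw [hmem, f3 _ (by omega), g3 _ (by omega), hletter i hi]
    · intro y hy j hj
      have := index_lt hy hj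
      rw [hmem, f3 _ (by omega), g3 _ (by omega), hent y hy j hj]
    · intro t ht
      rw [hmem, f3 _ (by omega), g4 t ht]
    · intro p hp
      rw [hmem, f4 p hp]
  · simpa using hlast ψ hψ

end FeatureSelection

namespace RAM

/-- The program that runs a command and then answers whether the register `r` is positive. -/
def Cmd.decider (c : Cmd) (r : ℕ) : Program :=
  c.comp 0 ++ [.const 64 0, .jumpLt 64 r ((c.comp 0).length + 3), .halt false, .halt true]

/-- A command that computes whether `answer` holds gives a program that decides `answer`. -/
theorem Cmd.Spec.decides {c : Cmd} {r V W T C : ℕ} {x : List ℕ} {answer : Prop} (hr : r < 32)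
    (hV : 16 ≤ V) (hVW : V ≤ W) (hwf : c.wf = true) (hd : V ^ c.deg ≤ W)
    (hx : ∀ i, x.getD i 0 < V) (hT : C + 3 ≤ T)
    (h : c.Spec V C ⟨fun _ => 0, fun i => x.getD i 0⟩ fun τ => τ.reg r ≠ 0 ↔ answer) :
    Decides (c.decider r) x T W answer := by
  obtain ⟨hsafe, hcost, hans⟩ := h
  have hcode : CodeAt (c.decider r) 0 (c.comp 0 ++
      [.const 64 0, .jumpLt 64 r ((c.comp 0).length + 3), .halt false, .halt true]) := by
    intro i hi
    rw [zero_add]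
    exact List.getElem?_eq_getElem hi
  have hlast := CodeAt.right hcode
  rw [zero_add] at hlast
  obtain ⟨N, hN, c₁, hrun₁, hpc₁, hh₁⟩ := c.comp_run hV hVW
    (σ := ⟨fun _ => 0, fun i => x.getD i 0⟩) (c := ⟨0, fun _ => 0, fun i => x.getD i 0⟩)
    (CodeAt.left hcode) rfl hwf (fun i => ⟨by simp only; omega, (hx i).trans_le hVW⟩)
    ⟨fun _ _ => rfl, rfl⟩ ⟨fun _ _ => by simp only; omega, hx⟩ hsafe hd
  rw [zero_add] at hpc₁
  have hb₁ := hrun₁.below_right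
  set c₂ := c₁.setReg 64 0 with hc₂
  have hb₂ : c₂.Below W := hb₁.setReg (by omega)
  have hrun₂ : Run (c.decider r) W 1 c₁ c₂ := .single (hpc₁ ▸ hlast.head) rfl hb₁ hb₂
  have hpc₂ : c₂.pc = (c.comp 0).length + 1 := by simp only [hc₂, Config.setReg, hpc₁]
  have hv : c₂.reg r = (c.exec ⟨fun _ => 0, fun i => x.getD i 0⟩).reg r := by
    rw [← hh₁.1 r hr]
    exact Function.update_of_ne (by omega) _ _
  have h64 : c₂.reg 64 = 0 := by simp only [hc₂, Config.setReg, Function.update_self]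
  set p := if 0 < c₂.reg r then (c.comp 0).length + 3 else (c.comp 0).length + 1 + 1 with hp
  have hrun₃ : Run (c.decider r) W 1 c₂ (c₂.goto p) := by
    refine .single (hpc₂ ▸ hlast.tail.head) ?_ hb₂ hb₂.goto
    rw [RAM.exec, h64, hpc₂]
  have hrun := hrun₁.trans (hrun₂.trans hrun₃)
  have hhalt : step (c.decider r) (.running (c₂.goto p)) = .halted (decide (0 < c₂.reg r)) := by
    have h2 := hlast.tail.tail.head
    have h3 := hlast.tail.tail.tail.head
    simp only [step, Config.goto, hp]
    split_ifs with h0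
    · rw [h3]
      simp [RAM.exec, h0]
    · rw [h2]
      simp [RAM.exec, h0]
  have hfinal : ∀ t, (step (c.decider r))^[t] (.halted (decide (0 < c₂.reg r))) =
      .halted (decide (0 < c₂.reg r)) := fun t => Function.iterate_fixed rfl t
  have hiter : run (c.decider r) x (N + (1 + 1) + 1) = .halted (decide (0 < c₂.reg r)) := by
    rw [run, init, Function.iterate_succ_apply', hrun.iterate, hhalt]
  refine ⟨⟨_, by omega, _, hiter, ?_⟩, fun t d hd => ?_⟩
  · rw [decide_eq_true_iff, hv, ← hans, Nat.pos_iff_ne_zero]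
  · by_cases ht : t ≤ N + (1 + 1)
    · exact hrun.below_iterate t ht d hd
    · obtain ⟨u, rfl⟩ : ∃ u, t = u + (N + (1 + 1) + 1) := ⟨t - (N + (1 + 1) + 1), by omega⟩
      rw [run, Function.iterate_add_apply] at hd
      rw [run] at hiter
      rw [hiter, hfinal] at hd
      exact absurd hd (by simp)

end RAM

namespace FeatureSelection

open Finset RAM

/-! ### The encoding of an instance -/

/-- Entries of a concatenation of blocks of the same length `N`. -/
theorem getD_flatMap {α : Type*} {f : α → List ℕ} {N : ℕ} (l : List α)
    (hf : ∀ a, (f a).length = N) {y j : ℕ} (hy : y < l.length) (hj : j < N) :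
    (l.flatMap f).getD (y * N + j) 0 = (f l[y]).getD j 0 := by
  induction l generalizing y with
  | nil => exact absurd hy (Nat.not_lt_zero _)
  | cons a l ih =>
    rw [List.flatMap_cons]
    cases y with
    | zero =>
      rw [List.getD_append _ _ _ _ (by rw [hf]; omega)]
      simp
    | succ y =>
      rw [List.getD_append_right _ _ _ _ (by rw [hf, add_mul]; omega), hf]
      have hy' : y < l.length := by simpa using hy
      rw [show (y + 1) * N + j - N = y * N + j by rw [add_mul]; omega, ih hy']
      simp

theorem getD_le_maxEntry (x : List ℕ) (i : ℕ) : x.getD i 0 ≤ maxEntry x := by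
  unfold maxEntry
  induction x generalizing i with
  | nil => simp
  | cons a x ih =>
    cases i with
    | zero => simp
    | succ i =>
      rw [List.getD_cons_succ, List.foldr_cons]
      exact (ih i).trans (le_max_right _ _)

section Encode

variable {m n : ℕ} (S : Finset ℕ) (A : Matrix (Fin m) (Fin n) S) (k B l : ℕ)

/-- The `i`-th letter of the alphabet. -/
def letterOf (S : Finset ℕ) (i : ℕ) : ℕ := (S.sort (· ≤ ·)).getD i 0

theorem letterOf_mem {i : ℕ} (hi : i < #S) : letterOf S i ∈ S := by
  have hi' : i < (S.sort (· ≤ ·)).length := by rwa [length_sort]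
  rw [letterOf, List.getD_eq_getElem _ _ hi', ← mem_sort (· ≤ ·)]
  exact List.getElem_mem hi'

theorem exists_letterOf {a : ℕ} (ha : a ∈ S) : ∃ i < #S, letterOf S i = a := by
  obtain ⟨i, hi, h⟩ := List.getElem_of_mem ((mem_sort (· ≤ ·)).2 ha)
  exact ⟨i, by rwa [length_sort] at hi, by rw [letterOf, List.getD_eq_getElem _ _ hi, h]⟩

theorem encode_getD_letter {i : ℕ} (hi : i < #S) :
    (encode S A k B l).getD (6 + i) 0 = letterOf S i := by
  rw [encode, List.append_assoc, List.getD_append_right _ _ _ _ (by simp),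
    List.getD_append _ _ _ _ (by rw [length_sort]; simpa using hi), letterOf]
  simp

theorem encode_getD_ent {y j : ℕ} (hy : y < m) (hj : j < n) :
    (encode S A k B l).getD (6 + #S + (y * n + j)) 0 = (instOf S A k B l).ent y j := by
  rw [encode, List.getD_append_right _ _ _ _ (by simp; omega)]
  rw [show 6 + #S + (y * n + j) - ([m, n, k, B, l, #S] ++ S.sort (· ≤ ·)).length = y * n + j by
    simp; omega]
  rw [getD_flatMap _ (by simp) (by simpa using hy) hj]
  simp [instOf, hy, hj]

end Encode

/-- The whole algorithm: the search, followed by the test whether there are enough columns for `k`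
non-empty clusters. -/
def algorithm : Cmd :=
  prelude.foldr .seq (.seq tryAll (.set rans (posE (.var rans) * leE (.var rk) (.var rN))))

theorem algorithm_wf : algorithm.wf = true := by decide +kernel

/-- The exponents of the bound for the running time of the search. -/
def searchDeg : ℕ × ℕ × ℕ := tryAll.costDeg limitDeg

/-- The first quantity of `Inst.scale` as a function of `k`, `B` and the size of the alphabet. -/
def scaleOf (p : ℕ × ℕ × ℕ) : ℕ :=
  16 * (p.2.2 ^ p.1 + p.1 + p.2.2 + p.2.1 + 2) ^
    (5 * (p.2.2 ^ p.1 * p.1 + p.2.1 * p.2.1 + p.2.1 + 1))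

theorem primrec_pow : Primrec₂ fun a b : ℕ => a ^ b := Primrec₂.unpaired'.1 Nat.Primrec.pow

theorem computable_scaleOf_pow (d : ℕ) : Computable fun p : ℕ × ℕ × ℕ => scaleOf p ^ d := by
  have hk : Primrec fun p : ℕ × ℕ × ℕ => p.1 := Primrec.fst
  have hB : Primrec fun p : ℕ × ℕ × ℕ => p.2.1 := Primrec.fst.comp Primrec.snd
  have hs : Primrec fun p : ℕ × ℕ × ℕ => p.2.2 := Primrec.snd.comp Primrec.snd
  have hK := primrec_pow.comp hs hk
  have add := @Primrec.nat_add
  have mul := @Primrec.nat_mul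
  have hbase := add.comp (add.comp (add.comp (add.comp hK hk) hs) hB) (Primrec.const 2)
  have hdig := add.comp (add.comp (add.comp (mul.comp hK hk) (mul.comp hB hB)) hB)
    (Primrec.const 1)
  exact (primrec_pow.comp (mul.comp (Primrec.const 16)
    (primrec_pow.comp hbase (mul.comp (Primrec.const 5) hdig))) (Primrec.const d)).to_comp

theorem computable_exponent (d : ℕ) : Computable fun p : ℕ × ℕ => (p.2 ^ p.1 + 1) * d :=
  (Primrec.nat_mul.comp (Primrec.nat_add.comp (primrec_pow.comp Primrec.snd Primrec.fst)
    (Primrec.const 1)) (Primrec.const d)).to_comp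

/-- The algorithm is correct and its cost is bounded by a monomial in `Inst.scale`. -/
theorem algorithm_spec {m n : ℕ} {S : Finset ℕ} {A : Matrix (Fin m) (Fin n) S} {k B l V : ℕ}
    (hm : 1 ≤ m) (hn : 1 ≤ n) (hk : 1 ≤ k) (hS : S.Nonempty)
    (hV : ∀ r, regVal (instOf S A k B l) #S r < V) :
    algorithm.Spec V (2 * scaleOf (k, B, #S) * prelude.length +
        (monomial ((instOf S A k B l).scale #S) searchDeg + 20))
      ⟨fun _ => 0, fun i => (encode S A k B l).getD i 0⟩
      fun τ => τ.reg rans ≠ 0 ↔ IsYes S A k B l := by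
  set I := instOf S A k B l with hI
  have hs : 1 ≤ #S := hS.card_pos
  have hK1 : 1 ≤ I.K := Nat.one_le_pow _ _ hs
  have hq : I.q ≤ I.m := Nat.sub_le _ _
  have hscale : scaleOf (k, B, #S) = 16 * I.guesses #S := rfl
  refine prelude_spec (I := I) (s := #S) (letter := letterOf S) (l := l) hm rfl hs rfl hV
    (by omega) rfl rfl rfl rfl rfl rfl (fun i hi => encode_getD_letter S A k B l hi)
    (fun y hy j hj => encode_getD_ent S A k B l hy hj) fun τ hτ => ?_
  obtain ⟨h1, h2, h3, h4⟩ := tryAll_spec (V := V) hm hK1 hs hk (hV 1) (hV 7) hτ.holds hτ.reg_ans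
  have hscale16 : 16 ≤ 16 * I.guesses #S := by
    have := I.digits_lt_guesses (s := #S)
    omega
  have hcost : tryAll.cost τ ≤ monomial (I.scale #S) searchDeg :=
    Cmd.cost_le hscale16 (Nat.one_le_pow _ _ hm) hn _ tryAll_limited fun r hr => by
      rw [hτ.reg_eq r hr]
      exact regVal_le hm hn hq r
  have hval : (posE (.var rans) * leE (.var rk) (.var rN)).eval (tryAll.exec τ).reg
      (tryAll.exec τ).mem = if (tryAll.exec τ).reg rans ≠ 0 ∧ k ≤ n then 1 else 0 := by
    rw [eval_mul, eval_posE, eval_leE, eval_var, eval_var, eval_var, h2.reg_k, h2.reg_n, ite_and,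
      ite_not, ite_mul, zero_mul, one_mul]
    rfl
  refine ⟨⟨h1, ?_⟩, ?_, ?_⟩
  · have : I.B + 1 < V := hV 16
    rw [Cmd.Safe, hval]
    split_ifs <;> omega
  · exact Nat.add_le_add hcost (Nat.le_of_ble_eq_true rfl)
  · have hiff : (tryAll.exec τ).reg rans ≠ 0 ↔ Clusterable I S := by
      refine ⟨fun h => ?_, fun h => h4 (exists_succeeds hm hn hk hS rfl
        (fun a ha => exists_letterOf S ha) h)⟩
      obtain ⟨U₁, U₂, d, J, lb, hacc⟩ := h3 h
      exact hacc.clusterable hk hK1 hq (fun p i _ _ => letterOf_mem S (Nat.mod_lt _ hs)) hS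
    change ((tryAll.exec τ).set rans _).reg rans ≠ 0 ↔ _
    rw [hval, Store.set_self, isYes_iff hS hk, ← hiff, and_comm (a := k ≤ n)]
    simp

theorem limitDeg_le (r : ℕ) : limitDeg r ≤ (1, 2, 1) := by
  unfold limitDeg
  split <;> exact ⟨by decide, by decide, by decide⟩

/-- The initialization, which consists of `22` commands of cost at most `2 * X` each, and the final
steps are absorbed by a factor `X ^ 3`. -/
theorem time_le {X R d : ℕ} (hX : 512 ≤ X) (hR : 1 ≤ R) :
    2 * X * 22 + (X ^ d * R + 20) + 3 ≤ X ^ (d + 3) * R := by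
  have h1 : 1 ≤ X ^ d * R := Nat.mul_pos (Nat.pow_pos (by omega)) hR
  have h2 : X ^ (d + 3) * R = X * X * X * (X ^ d * R) := by rw [pow_add]; ring
  rw [h2]
  set a := X ^ d * R
  have h3 : X * 512 * 512 * a ≤ X * X * X * a := by gcongr
  have h4 : 1 * a ≤ X * a := Nat.mul_le_mul_right _ (by omega)
  have h5 : X * 1 ≤ X * a := Nat.mul_le_mul_left _ h1
  have h6 : X * 512 * 512 * a = 262144 * (X * a) := by ring
  omega

end FeatureSelection

open FeatureSelection RAM in
theorem theorem1 :
    ∃ (f : ℕ × ℕ × ℕ → ℕ) (g : ℕ × ℕ → ℕ), Computable f ∧ Computable g ∧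
      ∃ (P : RAM.Program) (w : ℕ),
        ∀ (S : Finset ℕ) (m n k B l : ℕ) (A : Matrix (Fin m) (Fin n) S),
          1 ≤ m → 1 ≤ n → 1 ≤ k →
          RAM.Decides P (FeatureSelection.encode S A k B l)
            (f (k, B, S.card) * m ^ g (k, S.card) * n ^ 2)
            ((f (k, B, S.card) * m ^ g (k, S.card) * n ^ 2 +
              FeatureSelection.maxEntry (FeatureSelection.encode S A k B l)) ^ w)
            (FeatureSelection.IsYes S A k B l) := by
  refine ⟨fun p => scaleOf p ^ (searchDeg.1 + 3), fun p => (p.2 ^ p.1 + 1) * (searchDeg.2.1 + 2),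
    computable_scaleOf_pow _, computable_exponent _, algorithm.decider rans, algorithm.deg + 1, ?_⟩
  intro S m n k B l A hm hn hk
  -- the matrix has an entry, hence the alphabet is not empty
  have hS : S.Nonempty := ⟨_, (A ⟨0, hm⟩ ⟨0, hn⟩).2⟩
  set I := instOf S A k B l with hI
  set X := scaleOf (k, B, S.card) with hX
  set R := (m ^ (I.K + 1)) ^ (searchDeg.2.1 + 2) * n ^ 2 with hR
  have hscale : X = 16 * I.guesses S.card := rfl
  have h512 : 512 ≤ X := by
    have h1 := I.digits_lt_guesses (s := S.card)
    have h2 : 2 ^ 5 ≤ I.guesses S.card := (Nat.pow_le_pow_left I.two_le_base 5).trans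
      (Nat.pow_le_pow_right (by have := I.two_le_base (s := S.card); omega)
        (by rw [Inst.digits]; omega))
    omega
  have hY : 1 ≤ m ^ (I.K + 1) := Nat.one_le_pow _ _ hm
  have hR1 : 1 ≤ R := Nat.mul_pos (Nat.pow_pos hY) (Nat.pow_pos hn)
  set T := X ^ (searchDeg.1 + 3) * m ^ ((S.card ^ k + 1) * (searchDeg.2.1 + 2)) * n ^ 2 with hT
  have hTR : T = X ^ (searchDeg.1 + 3) * R := by
    rw [hT, hR, mul_assoc, pow_mul]
    rfl
  have htime := time_le (d := searchDeg.1) h512 hR1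
  rw [← hTR] at htime
  have hmon : monomial (I.scale S.card) searchDeg ≤ X ^ searchDeg.1 * R := by
    rw [monomial, hR, mul_assoc]
    refine Nat.mul_le_mul_left _ (Nat.mul_le_mul ?_ ?_)
    · exact Nat.pow_le_pow_right hY (by omega)
    · exact Nat.pow_le_pow_right hn tryAll_costDeg
  -- all variables and memory cells stay below `V`; intermediate results are below `V ^ deg`
  set V := T + maxEntry (encode S A k B l) with hV
  have hregs : ∀ r, regVal I S.card r < V := by
    intro r
    have h1 := (regVal_le (I := I) (s := S.card) hm hn (Nat.sub_le _ _) r).trans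
      (monomial_mono (b := I.scale S.card) (by rw [Inst.scale]; omega) hY hn (limitDeg_le r))
    have h2 : monomial (I.scale S.card) (1, 2, 1) ≤ X * R := by
      rw [monomial, hR, pow_one, mul_assoc]
      refine Nat.mul_le_mul_left _ (Nat.mul_le_mul ?_ ?_)
      · exact Nat.pow_le_pow_right hY (Nat.le_add_left 2 _)
      · exact Nat.pow_le_pow_right hn one_le_two
    have h3 : X * R < T := by
      rw [hTR]
      refine Nat.mul_lt_mul_of_pos_right ?_ hR1
      calc X = X ^ 1 := (pow_one X).symm
        _ < X ^ (searchDeg.1 + 3) := Nat.pow_lt_pow_right (by omega) (by omega)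
    omega
  refine Cmd.Spec.decides (by decide) (by omega) (Nat.le_self_pow (by omega) _) algorithm_wf
    (Nat.pow_le_pow_right (by omega) (by omega)) (fun i => ?_) ?_
    (algorithm_spec (A := A) (V := V) (B := B) (l := l) hm hn hk hS hregs)
  · have := getD_le_maxEntry (encode S A k B l) i
    omega
  · have : prelude.length = 22 := rfl
    rw [this]
    exact (by omega : 2 * X * 22 + (monomial (I.scale S.card) searchDeg + 20) + 3 ≤ T)
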